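/- All trees are finite. For a tree $T$ on $n$ vertices, $d(u,v)$ is the distance and $d(u)$ the degree. For an edge $e=uv$ let $n_u(e)$ be the number of vertices nearer to $u$ than to $v$ (the order of the component of $T-e$ containing $u$), and put $\mu(e)=\min\{n_u(e),n_v(e)\}$. Consider the indices $$WW(T)=\sum_{\{u,v\}}\binom{1+d(u,v)}{2},\qquad D'(T)=\sum_{\{u,v\}}(d(u)+d(v))\,d(u,v),\qquad Gut(T)=\sum_{\{u,v\}}d(u)d(v)\,d(u,v),$$ $$h(T)=\sum_{e=uv}\bigl(n_u(e)n_v(e)+(n_u(e)-1)(n_v(e)-1)\bigr),\qquad ABC_2(T)=\sum_{e=uv}\sqrt{\frac{n_u(e)+n_v(e)-2}{n_u(e)\,n_v(e)}}$$ (hyper-Wiener, degree distance, Gutman, Wiener–Hosoya and second atom-bond connectivity index), where $\{u,v\}$ runs over the unordered pairs of distinct vertices and $e=uv$ over the edges. **Graphs.** $P_n$ is the path and $S_n$ the star on $n$ vertices. For integers $n_1,\dots,n_k\ge 0$ with $n=k+\sum_i n_i$, $CP(n;n_1,\dots,n_k)$ is the caterpillar obtained from a path $v_1\cdots v_k$ by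 attaching $n_i$ pendent vertices to $v_i$ for each $i$. Put $CP_{n;a,b}=CP(n;a,0,\dots,0,b)$ (a path on $n-a-b\ge2$ vertices with $a$ and $b$ pendent vertices attached to its two ends), and let $CP^{s}_{n,k}$ be the caterpillar with $n_s=n-k$ and all other $n_i=0$. $SP_{n,q}$ is the balanced starlike tree: a centre from which $q$ legs (paths) issue, having $n-1$ vertices in total, with leg sizes pairwise differing by at most $1$. **Classes.** $\mathcal T_n$: trees on $n$ vertices; $\mathcal C(n,k)$: all $CP(n;n_1,\dots,n_k)$ with $n_i\ge 0$ and $k+\sum_i n_i=n$; $\mathcal T(n,k-1)$: trees in $\mathcal T_n$ of diameter $k-1$; $\mathcal T_n(q)$: trees in $\mathcal T_n$ with exactly $q$ pendent vertices; $\mathcal T_n^\Delta$: trees in $\mathcal T_n$ of maximum degree $\Delta$. **Theorem.** (A) For every $n$, each $F\in\{h,D',Gut\}$ is of Wiener type on $\mathcal T_n$: there is a function $f$, strictly increasing on $\{1,\dots,\lfloor n/2\rfloor\}$, with $F(T)=\sum_{e\in E(T)}f(\mu(e))$ for all $T\in\mathcal T_n$. The index $ABC_2$ is of anti-Wiener type: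 the same holds with $f$ strictly decreasing. (B) For every $F\in\{WW,h,D',Gut\}$, each tree listed belongs to the class in question and is, up to isomorphism, the unique tree in it attaining the stated extremum of $F$: 1. in $\mathcal T_n$ ($n\ge1$): maximum $P_n$, minimum $S_n$; 2. in $\mathcal C(n,k)$ ($2\le k\le n-1$): maximum $CP_{n;\lfloor (n-k)/2\rfloor,\lceil (n-k)/2\rceil}$, minimum $CP_{n,k}^{\lceil k/2\rceil}$; 3. in $\mathcal T(n,k-1)$ ($3\le k\le n$): minimum $CP_{n,k}^{\lceil k/2\rceil}$; 4. in $\mathcal T_n(q)$ ($2<q<n-1$): maximum $CP_{n;\lfloor q/2\rfloor,\lceil q/2\rceil}$, minimum $SP_{n,q}$; 5. in $\mathcal T_n^\Delta$ ($2<\Delta<n-1$): maximum $CP_{n;1,\Delta-1}$. (C) For $F=ABC_2$ the same holds with "maximum" and "minimum" interchanged throughout. -/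

import Mathlib

namespace TreeIndices

/-- A real-valued topological index, evaluated on finite graphs. -/
abbrev TreeIndex : Type 1 := (V : Type) → [Fintype V] → SimpleGraph V → ℝ

/-- A class of finite graphs. -/
abbrev TreeClass : Type 1 := (V : Type) → [Fintype V] → SimpleGraph V → Prop

section Indices

variable {V : Type} [Fintype V]

open Classical in
/-- The sum of `g u v` over the edges `uv` of `G`, for a symmetric function `g`. -/
noncomputable def edgeSum (G : SimpleGraph V) (g : V → V → ℝ) (hg : ∀ u v, g u v = g v u) : ℝ :=
  ∑ e ∈ G.edgeFinset, Sym2.lift ⟨g, hg⟩ e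

/-- The sum of `g u v` over the unordered pairs `{u, v}` of distinct vertices, that is, over the
edges of the complete graph. -/
noncomputable def pairSum (g : V → V → ℝ) (hg : ∀ u v, g u v = g v u) : ℝ :=
  edgeSum (⊤ : SimpleGraph V) g hg

open Classical in
/-- The vertices that are nearer to `u` than to `v`. If `uv` is an edge of a tree, this is the
vertex set of the component of the tree without `uv` that contains `u`. -/
noncomputable def side (G : SimpleGraph V) (u v : V) : Finset V :=
  Finset.univ.filter fun w => G.dist w u < G.dist w v

/-- `n_u(e)` for the edge `e = uv`. -/
noncomputable def sideCard (G : SimpleGraph V) (u v : V) : ℕ := (side G u v).card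

/-- `μ(e) = min (n_u(e)) (n_v(e))` for the edge `e = uv`. -/
noncomputable def edgeMu (G : SimpleGraph V) (u v : V) : ℕ := min (sideCard G u v) (sideCard G v u)

theorem edgeMu_comm (G : SimpleGraph V) (u v : V) : edgeMu G u v = edgeMu G v u :=
  min_comm _ _

open Classical in
/-- `h[e]` for the edge `e = uv`: the product of the numbers of vertices that the two components of
`T - e` keep when `u` and `v` are deleted. -/
noncomputable def hosoyaInner (G : SimpleGraph V) (u v : V) : ℕ :=
  ((side G u v).erase u).card * ((side G v u).erase v).card

end Indices

/-- The hyper-Wiener index. -/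
noncomputable def hyperWiener : TreeIndex := fun _ _ G =>
  pairSum (fun u v => (((1 + G.dist u v).choose 2 : ℕ) : ℝ))
    (fun u v => by rw [SimpleGraph.dist_comm])

/-- The Wiener–Hosoya index. -/
noncomputable def wienerHosoya : TreeIndex := fun _ _ G =>
  edgeSum G (fun u v => ((sideCard G u v * sideCard G v u + hosoyaInner G u v : ℕ) : ℝ))
    (fun u v => by
      rw [mul_comm (sideCard G u v), hosoyaInner, hosoyaInner, mul_comm (Finset.card _)])

open Classical in
/-- The degree distance. -/
noncomputable def degreeDistance : TreeIndex := fun _ _ G =>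
  pairSum (fun u v => (((G.degree u + G.degree v) * G.dist u v : ℕ) : ℝ))
    (fun u v => by rw [SimpleGraph.dist_comm, add_comm])

open Classical in
/-- The Gutman index. -/
noncomputable def gutman : TreeIndex := fun _ _ G =>
  pairSum (fun u v => ((G.degree u * G.degree v * G.dist u v : ℕ) : ℝ))
    (fun u v => by rw [SimpleGraph.dist_comm, mul_comm (G.degree u)])

/-- The second atom-bond connectivity index. -/
noncomputable def abc₂ : TreeIndex := fun _ _ G =>
  edgeSum G (fun u v =>
      Real.sqrt (((sideCard G u v : ℝ) + sideCard G v u - 2) / (sideCard G u v * sideCard G v u)))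
    (fun u v => by rw [add_comm (sideCard G u v : ℝ), mul_comm (sideCard G u v : ℝ)])

/-- The trees on `n` vertices. -/
def treesOn (n : ℕ) : TreeClass := fun V _ T => T.IsTree ∧ Fintype.card V = n

/-- `F` is of Wiener type on the trees with `n` vertices: it is the sum of `f (μ(e))` over the
edges for an edge contribution function `f` that is strictly increasing on `1, …, ⌊n/2⌋`. -/
def IsWienerType (n : ℕ) (F : TreeIndex) : Prop :=
  ∃ f : ℕ → ℝ, StrictMonoOn f (Set.Icc 1 (n / 2)) ∧
    ∀ (V : Type) [Fintype V] (T : SimpleGraph V), treesOn n V T →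
      F V T = edgeSum T (fun u v => f (edgeMu T u v)) (fun u v => by rw [edgeMu_comm])

/-- `F` is of anti-Wiener type on the trees with `n` vertices: the same, with `f` strictly
decreasing. -/
def IsAntiWienerType (n : ℕ) (F : TreeIndex) : Prop :=
  ∃ f : ℕ → ℝ, StrictAntiOn f (Set.Icc 1 (n / 2)) ∧
    ∀ (V : Type) [Fintype V] (T : SimpleGraph V), treesOn n V T →
      F V T = edgeSum T (fun u v => f (edgeMu T u v)) (fun u v => by rw [edgeMu_comm])

/-- The caterpillar `CP(n; a₁, …, a_k)`: the path `v₁ ⋯ v_k` with `a_i` pendent vertices attached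
to `v_i`. (The index `i : Fin k` stands for `v_{i+1}`.) -/
def caterpillar {k : ℕ} (a : Fin k → ℕ) : SimpleGraph (Fin k ⊕ (Σ i : Fin k, Fin (a i))) where
  Adj x y :=
    match x, y with
    | .inl i, .inl j => (SimpleGraph.pathGraph k).Adj i j
    | .inl i, .inr p => p.1 = i
    | .inr p, .inl i => p.1 = i
    | .inr _, .inr _ => False
  symm := ⟨by
    rintro (i | p) (j | r) h
    · exact SimpleGraph.Adj.symm h
    · exact h
    · exact h
    · exact h⟩
  loopless := ⟨by
    rintro (i | p) h
    · exact SimpleGraph.irrefl _ h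
    · exact h⟩

/-- The double star path `CP(n; a, 0, …, 0, b)` over a path with `k` vertices. -/
abbrev doubleStarPath (k a b : ℕ) :=
  caterpillar fun i : Fin k => (if i.val = 0 then a else 0) + (if i.val + 1 = k then b else 0)

/-- `CP_{n,k}^s`: the caterpillar over `v₁ ⋯ v_k` whose `n - k` pendent vertices are all attached
to `v_s`. -/
abbrev centralCaterpillar (n k s : ℕ) :=
  caterpillar fun i : Fin k => if i.val + 1 = s then n - k else 0

/-- The starlike tree with centre `none` and `q` legs, which are paths on `l i` vertices; the vertex
`⟨i, 0⟩` of each leg is adjacent to the centre. -/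
def starlike {q : ℕ} (l : Fin q → ℕ) : SimpleGraph (Option (Σ i : Fin q, Fin (l i))) where
  Adj x y :=
    match x, y with
    | none, none => False
    | none, some p => p.2.val = 0
    | some p, none => p.2.val = 0
    | some p, some r => p.1 = r.1 ∧ (p.2.val + 1 = r.2.val ∨ r.2.val + 1 = p.2.val)
  symm := ⟨by
    rintro (_ | p) (_ | r) h
    · exact h
    · exact h
    · exact h
    · exact ⟨h.1.symm, h.2.symm⟩⟩
  loopless := ⟨by
    rintro (_ | p) h
    · exact h
    · rcases h.2 with h | h <;> omega⟩

/-- The balanced starlike tree `SP_{n,q}`: the `n - 1` vertices other than the centre are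
distributed over the `q` legs as evenly as possible. -/
abbrev balancedStarlike (n q : ℕ) :=
  starlike fun i : Fin q => (n - 1) / q + if i.val < (n - 1) % q then 1 else 0

/-- `𝒞(n, k)`: the caterpillars on `n` vertices with respect to a path on `k` vertices. -/
def caterpillarsOn (n k : ℕ) : TreeClass := fun _ _ T =>
  ∃ a : Fin k → ℕ, (∑ i, a i) + k = n ∧ Nonempty (T ≃g caterpillar a)

/-- The trees on `n` vertices with diameter `d`. -/
def treesWithDiam (n d : ℕ) : TreeClass := fun V _ T => treesOn n V T ∧ T.diam = d

open Classical in
/-- The trees on `n` vertices with exactly `q` pendent vertices. -/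
def treesWithPendent (n q : ℕ) : TreeClass := fun V _ T =>
  treesOn n V T ∧ (Finset.univ.filter fun v => T.degree v = 1).card = q

open Classical in
/-- The trees on `n` vertices with maximum degree `D`. -/
def treesWithMaxDegree (n D : ℕ) : TreeClass := fun V _ T =>
  treesOn n V T ∧ T.maxDegree = D

/-- `H` is, up to isomorphism, the unique member of the class `C` with the largest value of `F`. -/
def IsUniqueMax (F : TreeIndex) (C : TreeClass) {W : Type} [Fintype W] (H : SimpleGraph W) : Prop :=
  C W H ∧ ∀ (V : Type) [Fintype V] (T : SimpleGraph V), C V T →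
    F V T ≤ F W H ∧ (F V T = F W H ↔ Nonempty (T ≃g H))

/-- `H` is, up to isomorphism, the unique member of the class `C` with the smallest value of
`F`. -/
def IsUniqueMin (F : TreeIndex) (C : TreeClass) {W : Type} [Fintype W] (H : SimpleGraph W) : Prop :=
  C W H ∧ ∀ (V : Type) [Fintype V] (T : SimpleGraph V), C V T →
    F W H ≤ F V T ∧ (F V T = F W H ↔ Nonempty (T ≃g H))

end TreeIndices

/-! Two kinds of data govern all five indices: distance sums and edge counts. In a tree on `n`
vertices an edge whose smaller side has `m` vertices separates `m(n-m)` pairs, so the Wiener index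
`W`, the sum of all distances, equals the sum of `μ(n-μ)` over the edges. Summing `deg(u) d(r,u)`
over `u` amounts to summing the distances of both ends of every edge, which gives `D' = 4W - n(n-1)`
and `Gut = 4W - (2n-1)(n-1)`; directly, `h = 2W - (n-1)²`. Since `m(n-m)` increases strictly up to
`n/2`, this proves (A). The hyper-Wiener index is the sum of `d + d(d-1)/2`. Hence the four
increasing indices are increasing affine functions of `distSum (wt α)` with `α` equal to `0` or `1`.
The index `ABC₂` is a sum of a decreasing function of `μ`, and Abel summation expresses it through
the numbers of edges with `μ ≥ t`.

The relation `Majorized` records what suffices for (B) and (C): an inequality of distance sums for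
all `α ≥ 0`, isomorphism in case of equality, and inequalities of the edge counts for `t ≥ 2`.
Equality in `ABC₂` forces equality of all relevant edge counts, hence of `W`, hence isomorphism.
Each item then reduces to a majorization.

Maxima: deletion of leaves leaves the other distances unchanged. The distances from a fixed vertex
take all values from `0` up to their maximum, so a leaf has the largest distance sum when all levels
are singletons; this gives the path (`majorized_path`). For prescribed leaves
(`majorized_doubleStarPath`) the tree without them is at best a path, the feet are at best its ends,
and the distances between feet are at best those of two equal groups at the ends, since an edge
splits `q` points into parts with product at most `⌊q/2⌋⌈q/2⌉`; convexity of `wt α` carries this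
over to all weights. With a vertex of degree `D` (`majorized_of_degree`) no distance exceeds
`n+1-D`, and the level argument is applied with this cap.

Minimum for a given geodesic on `k` vertices (`majorized_centralCaterpillar`): a vertex off the path
contributes least when adjacent to a central path vertex, and two such vertices contribute least at
distance `2`. Adjacent off-path pairs are closer than that, but their lower end is not adjacent to
the path and pays for the gain. With `k = 2` this covers the star.

Minimum for at most `q` leaves (`majorized_balanced`): rooted at a centroid, every small branch lies
above some leaf, and a leaf has at most one branch of each size above it. So at most `q(t-1)` edges
have `μ < t`; this settles the edge counts, hence `W`, and equality forces a balanced starlike tree.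
The sum of `d(d-1)` is not a function of the edge counts. It is handled by induction, deleting both
ends of a longest path: their contribution is bounded below by packing the remaining vertices into
levels of at most `q-2` vertices over that path, and the balanced starlike tree attains the bound.
-/

namespace TreeIndices

open SimpleGraph Classical

/-! ### Distances and geodesics in trees -/

section Metric

variable {V : Type} {T : SimpleGraph V}

theorem exists_adj_dist_eq (hT : T.Connected) {r x : V} (h : x ≠ r) :
    ∃ p, T.Adj x p ∧ T.dist r x = T.dist r p + 1 := by
  obtain ⟨w, hw⟩ := hT.exists_walk_length_eq_dist x r
  cases w with
  | nil => exact absurd rfl h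
  | @cons _ p _ hadj w =>
    refine ⟨p, hadj, ?_⟩
    have h1 : T.dist p r ≤ w.length := dist_le w
    have h2 := hT.dist_triangle (u := r) (v := p) (w := x)
    have h3 : T.dist p x = 1 := dist_eq_one_iff_adj.2 hadj.symm
    rw [Walk.length_cons] at hw
    rw [dist_comm (u := r) (v := p)] at *
    rw [dist_comm (u := r) (v := x)] at *
    omega

/-- Shortest walks to `p` and to `q`, prolonged to `x`, are again shortest, hence paths; an acyclic
graph has only one path from `r` to `x`, so the penultimate vertices agree. -/
theorem closer_unique (hT : T.IsTree) {r x p q : V} (hp : T.Adj x p) (hq : T.Adj x q)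
    (hdp : T.dist r x = T.dist r p + 1) (hdq : T.dist r x = T.dist r q + 1) : p = q := by
  obtain ⟨w, hw, hwl⟩ := hT.connected.exists_path_of_dist r p
  obtain ⟨z, hz, hzl⟩ := hT.connected.exists_path_of_dist r q
  have key : ∀ {p q : V} {w : T.Walk r p} {z : T.Walk r q} (hp : T.Adj x p) (hq : T.Adj x q),
      w.length = T.dist r p → z.length = T.dist r q → T.dist r x = T.dist r p + 1 →
      T.dist r x = T.dist r q + 1 → w.concat hp.symm = z.concat hq.symm := by
    intro p q w z hp hq hw hz h1 h2
    have a : (w.concat hp.symm).IsPath := Walk.isPath_of_length_eq_dist _ (by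
      rw [Walk.length_concat]; omega)
    have b : (z.concat hq.symm).IsPath := Walk.isPath_of_length_eq_dist _ (by
      rw [Walk.length_concat]; omega)
    exact congrArg Subtype.val (hT.isAcyclic.subsingleton_path r x |>.elim ⟨_, a⟩ ⟨_, b⟩)
  have h := key hp hq hwl hzl hdp hdq
  have := congrArg Walk.penultimate h
  simpa using this

/-- The neighbour of `x` that is nearer to the root `r` (and `x` itself if there is none). -/
noncomputable def par (T : SimpleGraph V) (r x : V) : V :=
  if h : ∃ p, T.Adj x p ∧ T.dist r x = T.dist r p + 1 then h.choose else x

theorem par_adj (hT : T.Connected) {r x : V} (h : x ≠ r) : T.Adj x (par T r x) := by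
  have h' := exists_adj_dist_eq hT h
  rw [par, dif_pos h']
  exact h'.choose_spec.1

theorem dist_par (hT : T.Connected) {r x : V} (h : x ≠ r) :
    T.dist r x = T.dist r (par T r x) + 1 := by
  have h' := exists_adj_dist_eq hT h
  rw [par, dif_pos h']
  exact h'.choose_spec.2

theorem eq_par (hT : T.IsTree) {r x p : V} (hp : T.Adj x p)
    (hd : T.dist r x = T.dist r p + 1) : p = par T r x := by
  have h : x ≠ r := by
    rintro rfl
    rw [dist_self] at hd
    omega
  exact closer_unique hT hp (par_adj hT.connected h) hd (dist_par hT.connected h)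

/-- Every geodesic between the two sides of an edge runs through that edge. The induction moves `y`
one step towards `z`. -/
theorem dist_crossing (hT : T.IsTree) {x p y z : V} (hxp : T.Adj x p)
    (hy : T.dist y x < T.dist y p) (hz : T.dist z p < T.dist z x) :
    T.dist y z = T.dist y x + 1 + T.dist p z := by
  have hc := hT.connected
  induction hn : T.dist y z generalizing y with
  | zero =>
    rw [hc.dist_eq_zero_iff] at hn
    subst hn
    omega
  | succ n ih =>
    have hne : y ≠ z := by
      rintro rfl
      rw [dist_self] at hn
      omega
    obtain ⟨y', hadj, hd⟩ := exists_adj_dist_eq hc hne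
    have hd' : T.dist y' z = n := by
      rw [dist_comm (u := z), dist_comm (u := z)] at hd
      omega
    have e1 := hT.dist_eq_dist_add_one_of_adj y hxp
    have e2 := hT.dist_eq_dist_add_one_of_adj y' hxp
    have ex := hT.dist_eq_dist_add_one_of_adj x hadj
    have ep := hT.dist_eq_dist_add_one_of_adj p hadj
    rw [dist_comm (u := x), dist_comm (u := x) (v := y')] at ex
    rw [dist_comm (u := p), dist_comm (u := p) (v := y')] at ep
    by_cases hy' : T.dist y' x < T.dist y' p
    · have h := ih hy' hd'
      rw [← hn]
      have t := hc.dist_triangle (u := y) (v := p) (w := z)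
      rcases ex with ex | ex
      · omega
      · exfalso
        have t2 : T.dist y x + 1 + T.dist p z < T.dist y z := by omega
        omega
    · rcases eq_or_ne y x with rfl | hyx
      · rw [dist_self] at *
        have h0 : T.dist y' p = 0 := by omega
        rw [hc.dist_eq_zero_iff] at h0
        subst h0
        omega
      -- Crossing from some `y ≠ x` would give `y` two neighbours nearer to `p`: the one towards
      -- `x`, and `y'`.
      · exfalso
        obtain ⟨a, ha, had⟩ := exists_adj_dist_eq hc hyx
        have hap := hc.dist_triangle (u := p) (v := x) (w := a)
        have hpx : T.dist p x = 1 := dist_eq_one_iff_adj.2 hxp.symm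
        have eqa := hT.dist_eq_dist_add_one_of_adj p ha
        rw [dist_comm (u := x)] at had
        rw [dist_comm (u := p) (v := y)] at eqa
        have : a = y' := closer_unique hT (r := p) ha hadj
          (by rw [dist_comm (u := p) (v := y)]; omega)
          (by rw [dist_comm (u := p) (v := y), dist_comm (u := p) (v := y')]; omega)
        subst this
        rw [dist_comm (u := x)] at had
        omega

/-- Geodesics are indexed by all of `ℕ`, with arbitrary values beyond `m`. With truncated
subtraction, `(i - j) + (j - i)` is `|i - j|`; this form is used throughout because `omega` can
treat it. -/
theorem exists_geodesic (hT : T.Connected) {u v : V} {m : ℕ} (h : T.dist u v = m) :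
    ∃ p : ℕ → V, p 0 = u ∧ p m = v ∧
      ∀ i j, i ≤ m → j ≤ m → T.dist (p i) (p j) = (i - j) + (j - i) := by
  obtain ⟨w, hw⟩ := hT.exists_walk_length_eq_dist u v
  have hm : w.length = m := by omega
  have h0 : w.getVert 0 = u := w.getVert_zero
  have h1 : w.getVert m = v := by rw [← hm]; exact w.getVert_length
  have step : ∀ i d, i + d ≤ m → T.dist (w.getVert i) (w.getVert (i + d)) ≤ d := by
    intro i d
    induction d with
    | zero => intro _; simp
    | succ d ih =>
      intro hd
      have a := ih (by omega)
      have b : T.dist (w.getVert (i + d)) (w.getVert (i + d + 1)) = 1 :=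
        dist_eq_one_iff_adj.2 (w.adj_getVert_succ (by omega))
      have c := hT.dist_triangle (u := w.getVert i) (v := w.getVert (i + d))
        (w := w.getVert (i + d + 1))
      rw [← add_assoc]
      omega
  have le : ∀ i j, i ≤ j → j ≤ m → T.dist (w.getVert i) (w.getVert j) = j - i := by
    intro i j hij hj
    have a := step 0 i (by omega)
    have b := step i (j - i) (by omega)
    have c := step j (m - j) (by omega)
    have e1 : i + (j - i) = j := by omega
    have e2 : j + (m - j) = m := by omega
    rw [zero_add, h0] at a
    rw [e1] at b
    rw [e2, h1] at c
    have t1 := hT.dist_triangle (u := u) (v := w.getVert i) (w := w.getVert j)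
    have t2 := hT.dist_triangle (u := u) (v := w.getVert j) (w := v)
    omega
  refine ⟨w.getVert, h0, h1, fun i j hi hj => ?_⟩
  rcases le_total i j with hij | hij
  · rw [le i j hij hj]; omega
  · rw [dist_comm, le j i hij hi]; omega

/-- A recognition principle for graph distances. -/
theorem dist_eq_of_recursion {G : SimpleGraph V} {u : V} {φ : V → ℕ} (h0 : φ u = 0)
    (hstep : ∀ v w, G.Adj v w → φ v ≤ φ w + 1)
    (hpre : ∀ v, v ≠ u → ∃ w, G.Adj v w ∧ φ v = φ w + 1) (v : V) :
    G.Reachable u v ∧ G.dist u v = φ v := by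
  have hwalk : ∀ n v, φ v = n → ∃ w : G.Walk u v, w.length = n := by
    intro n
    induction n with
    | zero =>
      intro v hv
      rcases eq_or_ne v u with rfl | hne
      · exact ⟨Walk.nil, rfl⟩
      · obtain ⟨w, _, h⟩ := hpre v hne
        omega
    | succ n ih =>
      intro v hv
      have hne : v ≠ u := by rintro rfl; omega
      obtain ⟨w, hadj, h⟩ := hpre v hne
      obtain ⟨q, hq⟩ := ih w (by omega)
      exact ⟨q.concat hadj.symm, by rw [Walk.length_concat, hq]⟩
  have hlow : ∀ a b (w : G.Walk a b), φ b ≤ φ a + w.length := by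
    intro a b w
    induction w with
    | nil => simp
    | cons hadj w ih =>
      have := hstep _ _ hadj.symm
      rw [Walk.length_cons]
      omega
  obtain ⟨w, hw⟩ := hwalk _ v rfl
  refine ⟨w.reachable, le_antisymm (hw ▸ dist_le w) ?_⟩
  obtain ⟨q, hq⟩ := w.reachable.exists_walk_length_eq_dist
  have := hlow _ _ q
  omega

/-- Every edge has the form `{x, f x}` with `x ≠ r`, so there are at most `n - 1` edges, and a
connected graph with so few edges is a tree. -/
theorem isTree_of_parent [Fintype V] {G : SimpleGraph V} (hG : G.Connected) (r : V)
    (f : V → V) (hf : ∀ x y, G.Adj x y → (x ≠ r ∧ f x = y) ∨ (y ≠ r ∧ f y = x)) :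
    G.IsTree := by
  rw [isTree_iff_connected_and_card]
  refine ⟨hG, le_antisymm ?_ hG.card_vert_le_card_edgeSet_add_one⟩
  have hsub : G.edgeFinset ⊆ (Finset.univ.erase r).image fun x => s(x, f x) := by
    intro e
    induction e with
    | _ x y =>
      intro he
      rw [mem_edgeFinset, mem_edgeSet] at he
      rw [Finset.mem_image]
      rcases hf x y he with ⟨h, rfl⟩ | ⟨h, rfl⟩
      · exact ⟨x, by simp [h], rfl⟩
      · exact ⟨y, by simp [h], Sym2.eq_swap⟩
  have h1 := (Finset.card_le_card hsub).trans Finset.card_image_le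
  have h2 : (Finset.univ.erase r).card + 1 = Fintype.card V := by
    rw [Finset.card_erase_add_one (Finset.mem_univ r), Finset.card_univ]
  rw [Nat.card_eq_fintype_card, Nat.card_eq_fintype_card, ← edgeFinset_card]
  omega

theorem dist_iso {W : Type} {G : SimpleGraph W} (e : T ≃g G) (u v : V) :
    G.dist (e u) (e v) = T.dist u v := by
  have hmap : ∀ {A B : Type} {X : SimpleGraph A} {Y : SimpleGraph B} (e : X ≃g Y) (u v : A),
      X.Reachable u v → Y.dist (e u) (e v) ≤ X.dist u v := by
    intro A B X Y e u v h
    obtain ⟨w, hw⟩ := h.exists_walk_length_eq_dist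
    have := dist_le (w.map e.toHom)
    rw [Walk.length_map, hw] at this
    exact this
  by_cases h : T.Reachable u v
  · refine le_antisymm (hmap e u v h) ?_
    have h' : G.Reachable (e u) (e v) := h.map e.toHom
    have := hmap e.symm (e u) (e v) h'
    simpa using this
  · have h' : ¬ G.Reachable (e u) (e v) := by
      intro h'
      have := h'.map e.symm.toHom
      simp at this
      exact h this
    rw [dist_eq_zero_of_not_reachable h, dist_eq_zero_of_not_reachable h']

/-- A bijective homomorphism between trees is an isomorphism. -/
theorem nonempty_iso_of_bijective [Fintype V] {W : Type} [Fintype W] {G : SimpleGraph W}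
    (hT : T.IsTree) (hG : G.IsTree) (f : V → W) (hf : Function.Bijective f)
    (hadj : ∀ x y, T.Adj x y → G.Adj (f x) (f y)) : Nonempty (T ≃g G) := by
  let e := Equiv.ofBijective f hf
  have hle : T.map e ≤ G := by
    rintro _ _ ⟨-, u, v, h, rfl, rfl⟩
    exact hadj u v h
  have hc : (T.map e).Connected := by
    rw [← (SimpleGraph.Iso.map e T).connected_iff]
    exact hT.connected
  -- Trees are minimal among the connected graphs, so `G` cannot properly contain the connected
  -- image of `T`.
  have heq : G = T.map e :=
    le_antisymm ((isTree_iff_minimal_connected.1 hG).2 hc hle) hle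
  exact ⟨heq ▸ SimpleGraph.Iso.map e T⟩

end Metric

end TreeIndices

namespace TreeIndices

open SimpleGraph Classical

/-! ### Descendants and ancestors in a rooted tree -/

section Rooted

variable {V : Type} [Fintype V] {T : SimpleGraph V}

/-- The descendants of `x` (including `x`) when the tree `T` is rooted at `r`. -/
noncomputable def sub (T : SimpleGraph V) (r x : V) : Finset V :=
  Finset.univ.filter fun y => T.dist r y = T.dist r x + T.dist x y

theorem mem_sub {r x y : V} : y ∈ sub T r x ↔ T.dist r y = T.dist r x + T.dist x y := by
  simp [sub]

theorem mem_side {u v w : V} : w ∈ side T u v ↔ T.dist w u < T.dist w v := by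
  simp [side]

theorem mem_side_iff (hT : T.IsTree) {u v w : V} (h : T.Adj u v) :
    w ∈ side T u v ↔ T.dist w v = T.dist w u + 1 := by
  have := hT.dist_eq_dist_add_one_of_adj w h
  rw [mem_side]
  omega

theorem side_compl (hT : T.IsTree) {u v : V} (h : T.Adj u v) : (side T u v)ᶜ = side T v u := by
  ext w
  have := hT.dist_eq_dist_add_one_of_adj w h
  rw [Finset.mem_compl, mem_side, mem_side]
  omega

theorem self_mem_sub {r x : V} : x ∈ sub T r x := by simp [mem_sub]

theorem root_notMem_sub (hT : T.Connected) {r x : V} (h : x ≠ r) : r ∉ sub T r x := by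
  rw [mem_sub, dist_self]
  have := hT.pos_dist_of_ne h.symm
  omega

/-- This links the unrooted sides of an edge, in which the indices are defined, with the branches of
a rooted tree, in which all counting is done. -/
theorem side_eq_sub (hT : T.IsTree) {r x p : V} (h : T.Adj x p)
    (hd : T.dist r x = T.dist r p + 1) : side T x p = sub T r x := by
  ext y
  rw [mem_sub]
  have hr : T.dist r p < T.dist r x := by omega
  have e := hT.dist_eq_dist_add_one_of_adj y h
  constructor
  · intro hy
    rw [mem_side] at hy
    have := dist_crossing hT h hy hr
    rw [dist_comm (u := r) (v := y), dist_comm (u := x) (v := y), this,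
      dist_comm (u := p) (v := r)]
    omega
  · intro hy
    rw [mem_side]
    by_contra hcon
    have t := hT.connected.dist_triangle (u := r) (v := p) (w := y)
    rw [dist_comm (u := p) (v := y)] at t
    rw [dist_comm (u := x) (v := y)] at hy
    omega

theorem side_par (hT : T.IsTree) {r x : V} (h : x ≠ r) : side T x (par T r x) = sub T r x :=
  side_eq_sub hT (par_adj hT.connected h) (dist_par hT.connected h)

theorem sub_subset (hT : T.Connected) {r x y : V} (h : y ∈ sub T r x) :
    sub T r y ⊆ sub T r x := by
  intro z hz
  rw [mem_sub] at *
  have h1 := hT.dist_triangle (u := x) (v := y) (w := z)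
  have h2 := hT.dist_triangle (u := r) (v := x) (w := z)
  omega

theorem sub_ssubset (hT : T.Connected) {r x y : V} (h : y ∈ sub T r x) (hne : y ≠ x) :
    sub T r y ⊂ sub T r x := by
  refine (Finset.ssubset_iff_of_subset (sub_subset hT h)).2 ⟨x, self_mem_sub, ?_⟩
  rw [mem_sub] at *
  have := hT.pos_dist_of_ne hne
  rw [dist_comm] at this
  omega

/-- The ancestors of `y` form a chain. If the edge above `x` separated `z` from `x`, the geodesic
from `z` to `y` would pass through `x`, and `z` would be nearer to the root than `x`. -/
theorem mem_sub_of_le (hT : T.IsTree) {r x y z : V} (hx : y ∈ sub T r x) (hz : y ∈ sub T r z)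
    (hle : T.dist r x ≤ T.dist r z) : z ∈ sub T r x := by
  rcases eq_or_ne x r with rfl | hne
  · simp [mem_sub]
  have hadj := par_adj hT.connected hne
  have hs := side_par hT hne
  by_contra hcon
  rw [← hs, ← Finset.mem_compl, side_compl hT hadj, mem_side] at hcon
  have hy := hx
  rw [← hs, mem_side] at hy
  have := dist_crossing hT hadj hy hcon
  rw [mem_sub] at hx hz
  have e := dist_par hT.connected hne
  have t := hT.connected.dist_triangle (u := r) (v := par T r x) (w := z)
  have t2 := hT.connected.dist_triangle (u := r) (v := z) (w := par T r x)
  rw [dist_comm (u := y) (v := z), dist_comm (u := y) (v := x)] at this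
  rw [dist_comm (u := z) (v := par T r x)] at t2
  omega

/-- The ancestors of `y` are `y` itself and those of its parent. The root is left out, so the count
is the number of edges between `r` and `y`. -/
theorem card_ancestors (hT : T.IsTree) (r y : V) :
    ((Finset.univ.erase r).filter fun x => y ∈ sub T r x).card = T.dist r y := by
  induction hn : T.dist r y generalizing y with
  | zero =>
    rw [hT.connected.dist_eq_zero_iff] at hn
    subst hn
    rw [Finset.card_eq_zero, Finset.filter_eq_empty_iff]
    intro x hx
    exact root_notMem_sub hT.connected (Finset.ne_of_mem_erase hx)
  | succ n ih =>
    have hne : y ≠ r := by rintro rfl; simp at hn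
    have hp := dist_par hT.connected hne
    have hadj := par_adj hT.connected hne
    have ih' := ih (par T r y) (by omega)
    have : ((Finset.univ.erase r).filter fun x => y ∈ sub T r x) =
        insert y ((Finset.univ.erase r).filter fun x => par T r y ∈ sub T r x) := by
      ext x
      simp only [Finset.mem_filter, Finset.mem_erase, Finset.mem_univ, and_true,
        Finset.mem_insert]
      have hyp : y ∈ sub T r (par T r y) := by
        rw [mem_sub, dist_eq_one_iff_adj.2 hadj.symm, hp]
      constructor
      · rintro ⟨hx, hy⟩
        rcases eq_or_ne x y with rfl | hxy
        · exact Or.inl rfl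
        · refine Or.inr ⟨hx, mem_sub_of_le hT hy hyp ?_⟩
          rw [mem_sub] at hy
          have := hT.connected.pos_dist_of_ne hxy
          omega
      · rintro (rfl | ⟨hx, hy⟩)
        · exact ⟨hne, self_mem_sub⟩
        · exact ⟨hx, sub_subset hT.connected hy hyp⟩
    rw [this, Finset.card_insert_of_notMem, ih']
    simp only [Finset.mem_filter, mem_sub, not_and]
    intro _
    have : T.dist y (par T r y) = 1 := dist_eq_one_iff_adj.2 hadj
    omega

end Rooted

/-! ### Sums over edges, edge counts and Wiener's formula -/

section Sums

variable {V : Type} [Fintype V]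

theorem two_mul_edgeSum (G : SimpleGraph V) (g : V → V → ℝ) (hg : ∀ u v, g u v = g v u) :
    2 * edgeSum G g hg = ∑ u, ∑ v, if G.Adj u v then g u v else 0 := by
  have h1 : (∑ u, ∑ v, if G.Adj u v then g u v else 0) =
      ∑ x ∈ (Finset.univ : Finset (V × V)).filter (fun x => G.Adj x.1 x.2), g x.1 x.2 := by
    rw [Finset.sum_filter, ← Finset.univ_product_univ, Finset.sum_product]
  rw [h1, edgeSum, Finset.mul_sum]
  rw [← Finset.sum_fiberwise_of_maps_to (t := G.edgeFinset) (g := fun x : V × V => s(x.1, x.2))]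
  · refine Finset.sum_congr rfl fun e => ?_
    induction e with
    | _ a b =>
      intro he
      rw [mem_edgeFinset, mem_edgeSet] at he
      have : ((Finset.univ : Finset (V × V)).filter (fun x => G.Adj x.1 x.2)).filter
          (fun x => s(x.1, x.2) = s(a, b)) = {(a, b), (b, a)} := by
        ext ⟨c, d⟩
        simp only [Finset.mem_filter, Finset.mem_univ, true_and, Sym2.eq_iff, Finset.mem_insert,
          Finset.mem_singleton, Prod.mk.injEq]
        constructor
        · rintro ⟨_, h⟩; exact h
        · rintro (⟨rfl, rfl⟩ | ⟨rfl, rfl⟩)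
          · exact ⟨he, Or.inl ⟨rfl, rfl⟩⟩
          · exact ⟨he.symm, Or.inr ⟨rfl, rfl⟩⟩
      rw [this, Finset.sum_pair (by simpa using fun h _ => he.ne h), Sym2.lift_mk]
      simp only
      rw [hg b a]
      ring
  · rintro ⟨a, b⟩ h
    simpa using h

theorem two_mul_pairSum (g : V → V → ℝ) (hg : ∀ u v, g u v = g v u) (h0 : ∀ u, g u u = 0) :
    2 * pairSum g hg = ∑ u, ∑ v, g u v := by
  rw [pairSum, two_mul_edgeSum]
  refine Finset.sum_congr rfl fun u _ => Finset.sum_congr rfl fun v _ => ?_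
  by_cases h : u = v
  · subst h; simp [h0]
  · simp [h]

/-- Each edge has exactly one end farther from the root, and this end determines the edge. -/
theorem edgeSum_eq_rooted {T : SimpleGraph V} (hT : T.IsTree) (r : V) (g : V → V → ℝ)
    (hg : ∀ u v, g u v = g v u) :
    edgeSum T g hg = ∑ x ∈ Finset.univ.erase r, g x (par T r x) := by
  rw [edgeSum]
  symm
  refine Finset.sum_bij (fun x _ => s(x, par T r x)) ?_ ?_ ?_ ?_
  · intro x hx
    rw [mem_edgeFinset, mem_edgeSet]
    exact par_adj hT.connected (Finset.ne_of_mem_erase hx)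
  · intro x hx y hy h
    rw [Sym2.eq_iff] at h
    rcases h with h | ⟨h1, h2⟩
    · exact h.1
    · have a := dist_par hT.connected (Finset.ne_of_mem_erase hx)
      have b := dist_par hT.connected (Finset.ne_of_mem_erase hy)
      rw [h2] at a
      rw [← h1] at b
      omega
  · intro e
    induction e with
    | _ a b =>
      intro he
      rw [mem_edgeFinset, mem_edgeSet] at he
      rcases hT.dist_eq_dist_add_one_of_adj r he with h | h
      · have hr : a ≠ r := by rintro rfl; simp at h
        exact ⟨a, by simp [hr], by rw [← eq_par hT he h]⟩
      · have hr : b ≠ r := by rintro rfl; simp at h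
        exact ⟨b, by simp [hr], by rw [← eq_par hT he.symm h, Sym2.eq_swap]⟩
  · intro x hx
    rfl

theorem edgeSum_congr {G : SimpleGraph V} {g g' : V → V → ℝ} {hg : ∀ u v, g u v = g v u}
    {hg' : ∀ u v, g' u v = g' v u} (h : ∀ u v, G.Adj u v → g u v = g' u v) :
    edgeSum G g hg = edgeSum G g' hg' := by
  refine Finset.sum_congr rfl fun e => ?_
  induction e with
  | _ a b =>
    intro he
    rw [mem_edgeFinset, mem_edgeSet] at he
    exact h a b he

theorem card_edgeFinset_tree {T : SimpleGraph V} (hT : T.IsTree) :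
    T.edgeFinset.card + 1 = Fintype.card V := by
  rw [← hT.card_edgeFinset]

/-- Abel summation. It reduces comparisons of such sums, for all monotone `f` at once, to
comparisons of the cardinalities of superlevel sets. -/
theorem sum_comp_eq_layers {α : Type*} (s : Finset α) (m : α → ℕ) (f : ℕ → ℝ) {N : ℕ}
    (hN : ∀ a ∈ s, m a ≤ N) :
    ∑ a ∈ s, f (m a) = s.card * f 0 +
      ∑ t ∈ Finset.range N, (f (t + 1) - f t) * ((s.filter fun a => t + 1 ≤ m a).card : ℝ) := by
  have h1 : ∀ a ∈ s, f (m a) = f 0 +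
      ∑ t ∈ Finset.range N, (f (t + 1) - f t) * (if t + 1 ≤ m a then 1 else 0) := by
    intro a ha
    simp only [mul_ite, mul_one, mul_zero]
    rw [← Finset.sum_filter]
    have : (Finset.range N).filter (fun t => t + 1 ≤ m a) = Finset.range (m a) := by
      ext t
      have := hN a ha
      simp only [Finset.mem_filter, Finset.mem_range]
      omega
    rw [this, Finset.sum_range_sub]
    ring
  rw [Finset.sum_congr rfl h1, Finset.sum_add_distrib, Finset.sum_const, nsmul_eq_mul,
    Finset.sum_comm]
  congr 1
  refine Finset.sum_congr rfl fun t _ => ?_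
  rw [← Finset.mul_sum, Finset.sum_boole]

/-- The number of edges `e` with `t ≤ μ(e)`. -/
noncomputable def edgeCount (T : SimpleGraph V) (t : ℕ) : ℕ :=
  (T.edgeFinset.filter fun e => t ≤ Sym2.lift ⟨edgeMu T, edgeMu_comm T⟩ e).card

theorem edgeCount_cast (T : SimpleGraph V) (t : ℕ) :
    (edgeCount T t : ℝ) = edgeSum T (fun u v => if t ≤ edgeMu T u v then 1 else 0)
      (fun u v => by rw [edgeMu_comm]) := by
  rw [edgeCount, edgeSum, ← Finset.sum_boole]
  refine Finset.sum_congr rfl fun e _ => ?_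
  induction e with
  | _ a b => exact if_congr Iff.rfl rfl rfl

section Tree

variable {T : SimpleGraph V}

theorem sideCard_par (hT : T.IsTree) {r x : V} (h : x ≠ r) :
    sideCard T x (par T r x) = (sub T r x).card := by
  rw [sideCard, side_par hT h]

theorem sideCard_add (hT : T.IsTree) {u v : V} (h : T.Adj u v) :
    sideCard T u v + sideCard T v u = Fintype.card V := by
  rw [sideCard, sideCard, ← side_compl hT h, Finset.card_add_card_compl]

theorem sideCard_pos {u v : V} (h : T.Adj u v) : 1 ≤ sideCard T u v := by
  refine Finset.card_pos.2 ⟨u, ?_⟩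
  rw [mem_side, dist_self, dist_eq_one_iff_adj.2 h]
  omega

theorem edgeMu_mem (hT : T.IsTree) {u v : V} (h : T.Adj u v) :
    1 ≤ edgeMu T u v ∧ edgeMu T u v ≤ Fintype.card V / 2 := by
  have h1 := sideCard_add hT h
  have h2 := sideCard_pos h
  have h3 := sideCard_pos h.symm
  rw [edgeMu]
  omega

/-- The edge above `x` has sides of size `|sub x|` and `n - |sub x|`, and `t ≤ μ` says that both are
at least `t`. The root is free, which lets each estimate choose a convenient one. -/
theorem edgeCount_eq (hT : T.IsTree) (r : V) (t : ℕ) :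
    edgeCount T t = ((Finset.univ.erase r).filter fun x =>
      t ≤ (sub T r x).card ∧ (sub T r x).card + t ≤ Fintype.card V).card := by
  have h := edgeCount_cast T t
  rw [edgeSum_eq_rooted hT r, Finset.sum_boole] at h
  rw [Nat.cast_injective h]
  congr 1
  refine Finset.filter_congr fun x hx => ?_
  have hx := Finset.ne_of_mem_erase hx
  have := sideCard_add hT (par_adj hT.connected hx)
  rw [edgeMu, le_min_iff]
  rw [sideCard_par hT hx] at *
  omega

theorem edgeSum_mu_eq (hT : T.IsTree) (f : ℕ → ℝ) :
    edgeSum T (fun u v => f (edgeMu T u v)) (fun u v => by rw [edgeMu_comm]) =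
      T.edgeFinset.card * f 0 + ∑ t ∈ Finset.range (Fintype.card V / 2),
        (f (t + 1) - f t) * (edgeCount T (t + 1) : ℝ) := by
  have := sum_comp_eq_layers T.edgeFinset (Sym2.lift ⟨edgeMu T, edgeMu_comm T⟩) f
    (N := Fintype.card V / 2) (by
      intro e
      induction e with
      | _ a b =>
        intro he
        rw [mem_edgeFinset, mem_edgeSet] at he
        exact (edgeMu_mem hT he).2)
  simp only [edgeCount]
  rw [← this, edgeSum]
  refine Finset.sum_congr rfl fun e _ => ?_
  induction e with
  | _ a b => rfl

theorem edgeCount_one (hT : T.IsTree) : edgeCount T 1 = T.edgeFinset.card := by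
  rw [edgeCount, Finset.filter_true_of_mem]
  intro e
  induction e with
  | _ a b =>
    intro he
    rw [mem_edgeFinset, mem_edgeSet] at he
    exact (edgeMu_mem hT he).1

/-- Wiener's formula for a family of points, repetitions allowed: an edge counts once for each
ordered pair of points that it separates. The identity family gives the Wiener index; the feet of
leaves are the other application. -/
theorem sum_dist_eq_edgeSum (hT : T.IsTree) {ι : Type} [Fintype ι] (u : ι → V) :
    ∑ i, ∑ j, (T.dist (u i) (u j) : ℝ) = 2 * edgeSum T
      (fun x y => ((Finset.univ.filter fun i => u i ∈ side T x y).card : ℝ) *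
        (Finset.univ.filter fun i => u i ∈ side T y x).card) (fun _ _ => mul_comm _ _) := by
  -- The distance counts the oriented edges that have `a` behind them and `b` ahead of them. With
  -- root `a`, these are the edges from the parent of an ancestor `y` of `b` to `y`.
  have key : ∀ a b : V, (T.dist a b : ℝ) = ∑ x, ∑ y,
      if T.Adj x y then (if a ∈ side T x y then 1 else 0) * (if b ∈ side T y x then 1 else 0)
        else (0 : ℝ) := by
    intro a b
    rw [← card_ancestors hT a b, ← Finset.sum_boole, Finset.sum_comm,
      ← Finset.sum_subset (Finset.subset_univ (Finset.univ.erase a))]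
    · refine Finset.sum_congr rfl fun y hy => ?_
      have hy := Finset.ne_of_mem_erase hy
      have hadj := par_adj hT.connected hy
      have hd := dist_par hT.connected hy
      rw [Finset.sum_eq_single (par T a y)]
      · have : a ∈ side T (par T a y) y := by rw [mem_side]; omega
        rw [if_pos hadj.symm, if_pos this, one_mul, side_par hT hy]
      · intro x _ hx
        split_ifs with h1 h2
        · exfalso
          rw [mem_side_iff hT h1] at h2
          exact hx (eq_par hT h1.symm h2)
        all_goals simp
      · simp
    · intro y _ hy
      have : y = a := by simpa using hy
      subst this
      refine Finset.sum_eq_zero fun x _ => ?_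
      simp [mem_side]
  rw [two_mul_edgeSum]
  simp_rw [key]
  have : ∀ x y, (if T.Adj x y then ((Finset.univ.filter fun i => u i ∈ side T x y).card : ℝ) *
        (Finset.univ.filter fun i => u i ∈ side T y x).card else 0) = ∑ i, ∑ j,
      if T.Adj x y then (if u i ∈ side T x y then 1 else 0) *
        (if u j ∈ side T y x then 1 else 0) else (0 : ℝ) := by
    intro x y
    split_ifs with h
    · rw [← Finset.sum_mul_sum, Finset.sum_boole, Finset.sum_boole]
    · simp
  simp_rw [this]
  rw [Finset.sum_congr rfl fun i _ => Finset.sum_comm]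
  rw [Finset.sum_comm]
  refine Finset.sum_congr rfl fun x _ => ?_
  rw [Finset.sum_congr rfl fun i _ => Finset.sum_comm]
  rw [Finset.sum_comm]

end Tree

end Sums

end TreeIndices

/-! ### The five indices in terms of `μ` and of distance sums -/

namespace TreeIndices

open SimpleGraph Classical

/-- The weights `d + α * (d choose 2)`: `α = 0` belongs to the Wiener index and `α = 1` to the
hyper-Wiener index. -/
noncomputable def wt (α : ℝ) (d : ℕ) : ℝ := d + α * (d * (d - 1) / 2)

theorem wt_zero (α : ℝ) : wt α 0 = 0 := by simp [wt]

theorem wt_succ (α : ℝ) (d : ℕ) : wt α (d + 1) = wt α d + (α * d + 1) := by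
  simp only [wt]
  push_cast
  ring

theorem wt_strictMono {α : ℝ} (hα : 0 ≤ α) : StrictMono (wt α) := by
  refine strictMono_nat_of_lt_succ fun d => ?_
  rw [wt_succ]
  have : 0 ≤ α * d := by positivity
  linarith

/-- The sum of `g` over the distances of all ordered pairs of vertices. -/
noncomputable def distSum {V : Type} [Fintype V] (g : ℕ → ℝ) (T : SimpleGraph V) : ℝ :=
  ∑ u, ∑ v, g (T.dist u v)

section Formulas

variable {V : Type} [Fintype V] {T : SimpleGraph V}

theorem two_mul_hyperWiener (T : SimpleGraph V) : 2 * hyperWiener V T = distSum (wt 1) T := by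
  rw [hyperWiener, two_mul_pairSum _ _ (by simp), distSum]
  refine Finset.sum_congr rfl fun u _ => Finset.sum_congr rfl fun v _ => ?_
  rw [Nat.cast_choose_two, wt]
  push_cast
  ring

theorem mul_sideCard (hT : T.IsTree) {u v : V} (h : T.Adj u v) :
    (sideCard T u v : ℝ) * sideCard T v u =
      edgeMu T u v * ((Fintype.card V : ℝ) - edgeMu T u v) := by
  rw [← sideCard_add hT h, edgeMu]
  rcases le_total (sideCard T u v) (sideCard T v u) with h | h
  · rw [min_eq_left h]; push_cast; ring
  · rw [min_eq_right h]; push_cast; ring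

theorem distSum_wt_zero (hT : T.IsTree) : distSum (wt 0) T = 2 * edgeSum T
    (fun u v => (edgeMu T u v : ℝ) * ((Fintype.card V : ℝ) - edgeMu T u v))
    (fun u v => by rw [edgeMu_comm]) := by
  have h := sum_dist_eq_edgeSum hT (id : V → V)
  have h2 : distSum (wt 0) T = ∑ i, ∑ j, (T.dist i j : ℝ) := by
    simp [distSum, wt]
  rw [h2]
  simp only [id] at h
  rw [h]
  congr 1
  refine edgeSum_congr fun u v huv => ?_
  rw [← mul_sideCard hT huv]
  simp [sideCard]

/-- Wiener's formula read backwards: it turns the edge sums for `h`, `D'` and `Gut` into affine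
functions of the Wiener index. The factor `1/2` appears because `distSum` counts ordered pairs. -/
theorem edgeSum_affine (hT : T.IsTree) (c e : ℝ) :
    edgeSum T (fun u v => c * ((edgeMu T u v : ℝ) *
      ((Fintype.card V : ℝ) - edgeMu T u v)) + e) (fun u v => by rw [edgeMu_comm]) =
      c / 2 * distSum (wt 0) T + e * (Fintype.card V - 1) := by
  have hn := card_edgeFinset_tree hT
  rw [distSum_wt_zero hT, ← hn]
  have : c / 2 * (2 * edgeSum T
    (fun u v => (edgeMu T u v : ℝ) * (((T.edgeFinset.card + 1 : ℕ) : ℝ) - edgeMu T u v))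
    (fun u v => by rw [edgeMu_comm])) = c * edgeSum T
    (fun u v => (edgeMu T u v : ℝ) * (((T.edgeFinset.card + 1 : ℕ) : ℝ) - edgeMu T u v))
    (fun u v => by rw [edgeMu_comm]) := by ring
  rw [this, edgeSum, edgeSum, Finset.mul_sum]
  push_cast
  rw [add_sub_cancel_right, mul_comm e, ← nsmul_eq_mul, ← Finset.sum_const,
    ← Finset.sum_add_distrib]
  refine Finset.sum_congr rfl fun x _ => ?_
  induction x with
  | _ a b => rfl

theorem card_side_erase {u v : V} (h : T.Adj u v) :
    ((side T u v).erase u).card + 1 = sideCard T u v := by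
  refine Finset.card_erase_add_one ?_
  rw [mem_side, dist_self, dist_eq_one_iff_adj.2 h]
  omega

theorem wienerHosoya_eq (hT : T.IsTree) : wienerHosoya V T = edgeSum T
    (fun u v => 2 * ((edgeMu T u v : ℝ) * ((Fintype.card V : ℝ) - edgeMu T u v)) +
      (1 - Fintype.card V)) (fun u v => by rw [edgeMu_comm]) := by
  rw [wienerHosoya]
  refine edgeSum_congr fun u v h => ?_
  rw [← mul_sideCard hT h, hosoyaInner, ← sideCard_add hT h, ← card_side_erase h,
    ← card_side_erase h.symm]
  push_cast
  ring

/-- Both sides sum the distances of the two ends of all edges from `r`: the edge above `x`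
contributes `d(r,x) + (d(r,x) - 1)`. -/
theorem sum_degree_mul (hT : T.IsTree) (r : V) :
    ∑ u, (T.degree u : ℝ) * T.dist r u =
      2 * ∑ u, (T.dist r u : ℝ) - (Fintype.card V - 1) := by
  have h1 : 2 * ∑ u, (T.degree u : ℝ) * T.dist r u =
      2 * edgeSum T (fun u v => (T.dist r u : ℝ) + T.dist r v) (fun _ _ => add_comm _ _) := by
    rw [two_mul_edgeSum]
    have : ∀ u v, (if T.Adj u v then (T.dist r u : ℝ) + T.dist r v else 0) =
      (if T.Adj u v then (T.dist r u : ℝ) else 0) + (if T.Adj u v then (T.dist r v : ℝ) else 0) := by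
      intro u v
      split_ifs <;> simp
    simp_rw [this, Finset.sum_add_distrib]
    have h2 : ∀ u, ∑ v, (if T.Adj u v then (T.dist r u : ℝ) else 0) =
        T.degree u * T.dist r u := by
      intro u
      rw [← Finset.sum_filter, Finset.sum_const, nsmul_eq_mul, ← card_neighborFinset_eq_degree,
        neighborFinset_eq_filter]
    rw [Finset.sum_comm (f := fun u v => if T.Adj u v then (T.dist r v : ℝ) else 0)]
    have h3 : ∀ u, ∑ v, (if T.Adj v u then (T.dist r u : ℝ) else 0) =
        T.degree u * T.dist r u := by
      intro u
      rw [← h2]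
      simp_rw [T.adj_comm u]
    simp_rw [h2, h3]
    ring
  have h2 : ∑ u, (T.degree u : ℝ) * T.dist r u =
      edgeSum T (fun u v => (T.dist r u : ℝ) + T.dist r v) (fun _ _ => add_comm _ _) := by
    linarith
  rw [h2, edgeSum_eq_rooted hT r]
  have h3 : ∀ x ∈ Finset.univ.erase r, (T.dist r x : ℝ) + T.dist r (par T r x) =
      2 * T.dist r x - 1 := by
    intro x hx
    have := dist_par hT.connected (Finset.ne_of_mem_erase hx)
    rw [this]
    push_cast
    ring
  rw [Finset.sum_congr rfl h3, Finset.sum_sub_distrib, ← Finset.mul_sum]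
  have h4 := Finset.add_sum_erase Finset.univ (fun x => (T.dist r x : ℝ)) (Finset.mem_univ r)
  rw [SimpleGraph.dist_self] at h4
  have h5 := Finset.card_erase_add_one (Finset.mem_univ r)
  rw [Finset.card_univ] at h5
  rw [← h4, ← h5]
  simp

theorem sum_degree (hT : T.IsTree) : ∑ u, (T.degree u : ℝ) = 2 * (Fintype.card V - 1) := by
  have h := T.sum_degrees_eq_twice_card_edges
  have h2 := card_edgeFinset_tree hT
  rw [← h2]
  have : ((∑ u, T.degree u : ℕ) : ℝ) = ((2 * T.edgeFinset.card : ℕ) : ℝ) := by rw [h]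
  push_cast at this
  rw [this]
  push_cast
  ring

theorem distSum_wt_zero' (T : SimpleGraph V) : distSum (wt 0) T = ∑ i, ∑ j, (T.dist i j : ℝ) := by
  simp [distSum, wt]

/-- Summing `sum_degree_mul` over all `r` gives `4W - n(n-1)`, and the constant is spread evenly
over the `n - 1` edges. -/
theorem degreeDistance_eq (hT : T.IsTree) : degreeDistance V T = edgeSum T
    (fun u v => 4 * ((edgeMu T u v : ℝ) * ((Fintype.card V : ℝ) - edgeMu T u v)) +
      (- Fintype.card V)) (fun u v => by rw [edgeMu_comm]) := by
  have h : 2 * degreeDistance V T = 2 * ∑ v, ∑ u, (T.degree u : ℝ) * T.dist v u := by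
    rw [degreeDistance, two_mul_pairSum _ _ (by simp)]
    push_cast
    simp_rw [add_mul, Finset.sum_add_distrib]
    have e : ∑ u, ∑ v, (T.degree u : ℝ) * T.dist u v = ∑ v, ∑ u, (T.degree u : ℝ) * T.dist v u := by
      rw [Finset.sum_comm]
      refine Finset.sum_congr rfl fun u _ => Finset.sum_congr rfl fun v _ => ?_
      rw [T.dist_comm]
    rw [e, two_mul]
  rw [edgeSum_affine hT]
  simp_rw [sum_degree_mul hT] at h
  rw [Finset.sum_sub_distrib, ← Finset.mul_sum, ← distSum_wt_zero'] at h
  simp only [Finset.sum_const, Finset.card_univ, nsmul_eq_mul] at h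
  linarith

/-- `sum_degree_mul` is applied twice, the second time after summation with the weights `deg(r)`;
together with the total degree `2(n-1)` this yields `4W - (2n-1)(n-1)`. -/
theorem gutman_eq (hT : T.IsTree) : gutman V T = edgeSum T
    (fun u v => 4 * ((edgeMu T u v : ℝ) * ((Fintype.card V : ℝ) - edgeMu T u v)) +
      (1 - 2 * Fintype.card V)) (fun u v => by rw [edgeMu_comm]) := by
  have h : 2 * gutman V T = ∑ v, (T.degree v : ℝ) * ∑ u, (T.degree u : ℝ) * T.dist v u := by
    rw [gutman, two_mul_pairSum _ _ (by simp)]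
    push_cast
    simp_rw [Finset.mul_sum, mul_assoc]
  have h2 : ∑ v, (T.degree v : ℝ) * ∑ u, (T.dist v u : ℝ) =
      ∑ u, ∑ v, (T.degree v : ℝ) * T.dist u v := by
    simp_rw [Finset.mul_sum]
    rw [Finset.sum_comm]
    refine Finset.sum_congr rfl fun u _ => Finset.sum_congr rfl fun v _ => ?_
    rw [T.dist_comm]
  rw [edgeSum_affine hT]
  simp_rw [sum_degree_mul hT] at h h2
  have h3 : ∑ x, (T.degree x : ℝ) * (2 * ∑ u, (T.dist x u : ℝ) - (Fintype.card V - 1)) =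
      2 * ∑ x, (T.degree x : ℝ) * ∑ u, (T.dist x u : ℝ) -
        (∑ x, (T.degree x : ℝ)) * (Fintype.card V - 1) := by
    rw [Finset.mul_sum, Finset.sum_mul, ← Finset.sum_sub_distrib]
    exact Finset.sum_congr rfl fun x _ => by ring
  rw [sum_degree hT] at h3
  rw [h3, h2, Finset.sum_sub_distrib, ← Finset.mul_sum, ← distSum_wt_zero'] at h
  simp only [Finset.sum_const, Finset.card_univ, nsmul_eq_mul] at h
  linarith

theorem abc₂_eq (hT : T.IsTree) : abc₂ V T = edgeSum T
    (fun u v => Real.sqrt (((Fintype.card V : ℝ) - 2) /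
      ((edgeMu T u v : ℝ) * ((Fintype.card V : ℝ) - edgeMu T u v))))
    (fun u v => by rw [edgeMu_comm]) := by
  rw [abc₂]
  refine edgeSum_congr fun u v h => ?_
  rw [← mul_sideCard hT h, ← sideCard_add hT h]
  push_cast
  rfl

/-- The difference of the two sides is `(b - a)(n - a - b)`. -/
theorem mul_lt_mul_of_lt_half {n a b : ℕ} (hab : a < b) (hb : b ≤ n / 2) :
    (a : ℝ) * ((n : ℝ) - a) < b * (n - b) := by
  have h1 : a + b < n := by omega
  have h2 : ((a + b : ℕ) : ℝ) < n := by exact_mod_cast h1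
  have h3 : (a : ℝ) < b := by exact_mod_cast hab
  push_cast at h2
  nlinarith

theorem strictMonoOn_affine (n : ℕ) {c : ℝ} (hc : 0 < c) (e : ℝ) :
    StrictMonoOn (fun m : ℕ => c * ((m : ℝ) * ((n : ℝ) - m)) + e) (Set.Icc 1 (n / 2)) := by
  intro a ha b hb hab
  have := mul_lt_mul_of_lt_half hab hb.2
  have := mul_lt_mul_of_pos_left this hc
  simp only
  linarith

theorem strictAntiOn_abc (n : ℕ) :
    StrictAntiOn (fun m : ℕ => Real.sqrt (((n : ℝ) - 2) / ((m : ℝ) * ((n : ℝ) - m))))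
      (Set.Icc 1 (n / 2)) := by
  intro a ha b hb hab
  have h := mul_lt_mul_of_lt_half hab hb.2
  have ha1 : 1 ≤ a := ha.1
  have hb2 : b ≤ n / 2 := hb.2
  -- Two different arguments in the interval force `n / 2 ≥ 2`, so the numerator `n - 2` is
  -- positive.
  have hn : 4 ≤ n := by omega
  have hn' : (4 : ℝ) ≤ n := by exact_mod_cast hn
  have han : (a : ℝ) < n := by exact_mod_cast (by omega : a < n)
  have ha0 : (0 : ℝ) < a := by exact_mod_cast ha1
  have hpos : 0 < (a : ℝ) * ((n : ℝ) - a) := mul_pos ha0 (by linarith)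
  refine Real.sqrt_lt_sqrt (div_nonneg (by linarith) (hpos.trans h).le) ?_
  exact div_lt_div_of_pos_left (by linarith) hpos h

end Formulas

theorem isWienerType_wienerHosoya (n : ℕ) : IsWienerType n wienerHosoya :=
  ⟨_, strictMonoOn_affine n two_pos (1 - n), fun V _ T ⟨hT, hn⟩ => by
    subst hn; exact wienerHosoya_eq hT⟩

theorem isWienerType_degreeDistance (n : ℕ) : IsWienerType n degreeDistance :=
  ⟨_, strictMonoOn_affine n four_pos (-n), fun V _ T ⟨hT, hn⟩ => by
    subst hn; exact degreeDistance_eq hT⟩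

theorem isWienerType_gutman (n : ℕ) : IsWienerType n gutman :=
  ⟨_, strictMonoOn_affine n four_pos (1 - 2 * n), fun V _ T ⟨hT, hn⟩ => by
    subst hn; exact gutman_eq hT⟩

theorem isAntiWienerType_abc₂ (n : ℕ) : IsAntiWienerType n abc₂ :=
  ⟨_, strictAntiOn_abc n, fun V _ T ⟨hT, hn⟩ => by subst hn; exact abc₂_eq hT⟩

/-! ### Majorization of trees and comparison of the indices -/

section Compare

variable {V W : Type} [Fintype V] [Fintype W] {T : SimpleGraph V} {H : SimpleGraph W}

theorem distSum_iso (e : T ≃g H) (g : ℕ → ℝ) : distSum g T = distSum g H := by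
  rw [distSum, distSum, ← e.toEquiv.sum_comp]
  refine Finset.sum_congr rfl fun u _ => ?_
  rw [← e.toEquiv.sum_comp]
  exact Finset.sum_congr rfl fun v _ => by
    rw [← dist_iso e]; rfl

theorem sideCard_iso (e : T ≃g H) (u v : V) : sideCard H (e u) (e v) = sideCard T u v := by
  rw [sideCard, sideCard]
  refine (Finset.card_bij (fun w _ => e w) ?_ ?_ ?_).symm
  · intro w hw
    rw [mem_side] at *
    simpa [dist_iso] using hw
  · intro a _ b _ h
    exact e.injective h
  · intro w hw
    refine ⟨e.symm w, ?_, by simp⟩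
    rw [mem_side] at *
    rw [← dist_iso e, ← dist_iso e]
    simpa using hw

theorem edgeCount_iso (e : T ≃g H) (t : ℕ) : edgeCount T t = edgeCount H t := by
  have : (2 : ℝ) * edgeCount T t = 2 * edgeCount H t := by
    rw [edgeCount_cast, edgeCount_cast, two_mul_edgeSum, two_mul_edgeSum, ← e.toEquiv.sum_comp]
    refine Finset.sum_congr rfl fun u _ => ?_
    rw [← e.toEquiv.sum_comp]
    refine Finset.sum_congr rfl fun v _ => ?_
    have h1 : H.Adj (e.toEquiv u) (e.toEquiv v) ↔ T.Adj u v := e.map_adj_iff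
    have h2 : edgeMu H (e.toEquiv u) (e.toEquiv v) = edgeMu T u v := by
      rw [edgeMu, edgeMu, ← sideCard_iso e, ← sideCard_iso e]
      rfl
    simp only [h1, h2]
  have h2 : (edgeCount T t : ℝ) = edgeCount H t := by linarith
  exact_mod_cast h2

/-- The terms with `f 0` and with `edgeCount 1` cancel, as both trees have `n - 1` edges. So only
the increments of `f` on `1, …, ⌊n/2⌋` and the counts for `t ≥ 2` matter. -/
theorem edgeSum_mu_sub (hT : T.IsTree) (hH : H.IsTree)
    (hn : Fintype.card V = Fintype.card W) (f : ℕ → ℝ) :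
    edgeSum H (fun u v => f (edgeMu H u v)) (fun u v => by rw [edgeMu_comm]) -
      edgeSum T (fun u v => f (edgeMu T u v)) (fun u v => by rw [edgeMu_comm]) =
      ∑ t ∈ Finset.Ico 1 (Fintype.card W / 2),
        (f (t + 1) - f t) * ((edgeCount H (t + 1) : ℝ) - edgeCount T (t + 1)) := by
  have h1 := card_edgeFinset_tree hT
  have h2 := card_edgeFinset_tree hH
  have h3 : T.edgeFinset.card = H.edgeFinset.card := by omega
  rw [edgeSum_mu_eq hT, edgeSum_mu_eq hH, h3, hn, add_sub_add_left_eq_sub,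
    ← Finset.sum_sub_distrib]
  simp_rw [← mul_sub]
  rcases Nat.eq_zero_or_pos (Fintype.card W / 2) with h0 | h0
  · simp [h0]
  · rw [Finset.sum_range_eq_add_Ico _ h0, zero_add, edgeCount_one hT, edgeCount_one hH, h3]
    simp

/-- `T` is majorized by `H`, with respect to the distance sums and to the numbers of edges with
large `μ`; in case of equal distance sums, the graphs are isomorphic. -/
structure Majorized (T : SimpleGraph V) (H : SimpleGraph W) : Prop where
  distSum_le : ∀ α : ℝ, 0 ≤ α → distSum (wt α) T ≤ distSum (wt α) H
  iso : ∀ α : ℝ, 0 ≤ α → distSum (wt α) T = distSum (wt α) H → Nonempty (T ≃g H)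
  edgeCount_le : ∀ t, 2 ≤ t → edgeCount T t ≤ edgeCount H t

theorem Majorized.of_iso {V' W' : Type} [Fintype V'] [Fintype W'] {T' : SimpleGraph V'}
    {H' : SimpleGraph W'} (h : Majorized T H) (e : T ≃g T') (e' : H ≃g H') : Majorized T' H' where
  distSum_le α hα := by
    rw [← distSum_iso e, ← distSum_iso e']
    exact h.distSum_le α hα
  iso α hα heq := by
    rw [← distSum_iso e, ← distSum_iso e'] at heq
    obtain ⟨f⟩ := h.iso α hα heq
    exact ⟨(e.symm.trans f).trans e'⟩
  edgeCount_le t ht := by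
    rw [← edgeCount_iso e, ← edgeCount_iso e']
    exact h.edgeCount_le t ht

/-- In the Abel sum the increments of the contribution function are negative and the differences of
the counts are nonnegative. -/
theorem Majorized.abc₂_le (h : Majorized T H) (hT : T.IsTree) (hH : H.IsTree)
    (hn : Fintype.card V = Fintype.card W) :
    abc₂ W H ≤ abc₂ V T ∧ (abc₂ V T = abc₂ W H → Nonempty (T ≃g H)) := by
  have hs := edgeSum_mu_sub hT hH hn (fun m : ℕ => Real.sqrt (((Fintype.card W : ℝ) - 2) /
      ((m : ℝ) * ((Fintype.card W : ℝ) - m))))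
  have heqT := abc₂_eq hT
  rw [hn] at heqT
  rw [← abc₂_eq hH, ← heqT] at hs
  have hlt : ∀ t ∈ Finset.Ico 1 (Fintype.card W / 2),
      Real.sqrt (((Fintype.card W : ℝ) - 2) / (((t + 1 : ℕ) : ℝ) *
        ((Fintype.card W : ℝ) - ((t + 1 : ℕ) : ℝ)))) -
      Real.sqrt (((Fintype.card W : ℝ) - 2) / ((t : ℝ) * ((Fintype.card W : ℝ) - t))) < 0 := by
    intro t ht
    rw [Finset.mem_Ico] at ht
    exact sub_neg.2 (strictAntiOn_abc (Fintype.card W) (a := t) (b := t + 1)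
      ⟨by omega, by omega⟩ ⟨by omega, by omega⟩ (by omega))
  have hle : ∀ t ∈ Finset.Ico 1 (Fintype.card W / 2),
      (0 : ℝ) ≤ (edgeCount H (t + 1) : ℝ) - edgeCount T (t + 1) := by
    intro t ht
    rw [Finset.mem_Ico] at ht
    exact sub_nonneg.2 (by exact_mod_cast h.edgeCount_le (t + 1) (by omega))
  have hterm := fun t ht => mul_nonpos_of_nonpos_of_nonneg (hlt t ht).le (hle t ht)
  refine ⟨by linarith [Finset.sum_nonpos hterm], fun heq => ?_⟩
  rw [heq, sub_self] at hs
  have hz := (Finset.sum_eq_zero_iff_of_nonpos hterm).1 hs.symm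
  refine h.iso 0 le_rfl ?_
  -- Equality makes every term vanish, and the increments are nonzero, so the edge counts agree.
  -- Then the Wiener indices agree as well, and the equality clause for `α = 0` applies.
  have hs2 := edgeSum_mu_sub hT hH hn (fun m : ℕ => (m : ℝ) * ((Fintype.card W : ℝ) - m))
  rw [Finset.sum_eq_zero, sub_eq_zero] at hs2
  · rw [distSum_wt_zero hT, distSum_wt_zero hH, hs2, hn]
  · intro t ht
    rw [mul_eq_zero]
    right
    exact (mul_eq_zero.1 (hz t ht)).resolve_left (hlt t ht).ne

end Compare

/-- The hyper-Wiener, Wiener–Hosoya, degree distance and Gutman indices of trees on `n` vertices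
are increasing affine functions of a distance sum. -/
theorem exists_affine (n : ℕ) {F : TreeIndex}
    (hF : F ∈ ({hyperWiener, wienerHosoya, degreeDistance, gutman} : Set TreeIndex)) :
    ∃ α c e : ℝ, 0 ≤ α ∧ 0 < c ∧ ∀ (V : Type) [Fintype V] (T : SimpleGraph V), treesOn n V T →
      F V T = c * distSum (wt α) T + e := by
  simp only [Set.mem_insert_iff, Set.mem_singleton_iff] at hF
  rcases hF with rfl | rfl | rfl | rfl
  · exact ⟨1, 1 / 2, 0, by norm_num, by norm_num, fun V _ T h => by
      rw [← two_mul_hyperWiener]; ring⟩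
  · refine ⟨0, 2 / 2, (1 - n) * (n - 1), le_rfl, by norm_num, fun V _ T h => ?_⟩
    rw [wienerHosoya_eq h.1, edgeSum_affine h.1, h.2]
  · refine ⟨0, 4 / 2, (- n) * (n - 1), le_rfl, by norm_num, fun V _ T h => ?_⟩
    rw [degreeDistance_eq h.1, edgeSum_affine h.1, h.2]
  · refine ⟨0, 4 / 2, (1 - 2 * n) * (n - 1), le_rfl, by norm_num, fun V _ T h => ?_⟩
    rw [gutman_eq h.1, edgeSum_affine h.1, h.2]

theorem abc₂_iso {V W : Type} [Fintype V] [Fintype W] {T : SimpleGraph V} {H : SimpleGraph W}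
    (hT : T.IsTree) (e : T ≃g H) : abc₂ V T = abc₂ W H := by
  have hH := e.isTree_iff.1 hT
  have hn := Fintype.card_congr e.toEquiv
  have hs := edgeSum_mu_sub hT hH hn (fun m : ℕ => Real.sqrt (((Fintype.card W : ℝ) - 2) /
      ((m : ℝ) * ((Fintype.card W : ℝ) - m))))
  have heqT := abc₂_eq hT
  rw [hn] at heqT
  rw [← abc₂_eq hH, ← heqT] at hs
  simp_rw [edgeCount_iso e, sub_self, mul_zero, Finset.sum_const_zero] at hs
  linarith

/-! ### From majorization to unique extremal trees -/

section Extremal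

variable {n : ℕ} {C : TreeClass} {W : Type} [Fintype W] {H : SimpleGraph W}

theorem isUniqueMax_of_majorized
    (hC : ∀ (V : Type) [Fintype V] (T : SimpleGraph V), C V T → treesOn n V T) (hH : C W H)
    (h : ∀ (V : Type) [Fintype V] (T : SimpleGraph V), C V T → Majorized T H) :
    (∀ F ∈ ({hyperWiener, wienerHosoya, degreeDistance, gutman} : Set TreeIndex),
      IsUniqueMax F C H) ∧ IsUniqueMin abc₂ C H := by
  constructor
  · intro F hF
    obtain ⟨α, c, e, hα, hc, heq⟩ := exists_affine n hF
    refine ⟨hH, fun V _ T hT => ?_⟩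
    rw [heq V T (hC V T hT), heq W H (hC W H hH)]
    have hm := h V T hT
    refine ⟨?_, fun he => hm.iso α hα ?_, fun ⟨f⟩ => by rw [distSum_iso f]⟩
    · have := mul_le_mul_of_nonneg_left (hm.distSum_le α hα) hc.le
      linarith
    · exact mul_left_cancel₀ hc.ne' (add_right_cancel he)
  · refine ⟨hH, fun V _ T hT => ?_⟩
    have h1 := hC V T hT
    have h2 := hC W H hH
    have := (h V T hT).abc₂_le h1.1 h2.1 (h1.2.trans h2.2.symm)
    exact ⟨this.1, this.2, fun ⟨f⟩ => abc₂_iso h1.1 f⟩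

theorem isUniqueMin_of_majorized
    (hC : ∀ (V : Type) [Fintype V] (T : SimpleGraph V), C V T → treesOn n V T) (hH : C W H)
    (h : ∀ (V : Type) [Fintype V] (T : SimpleGraph V), C V T → Majorized H T) :
    (∀ F ∈ ({hyperWiener, wienerHosoya, degreeDistance, gutman} : Set TreeIndex),
      IsUniqueMin F C H) ∧ IsUniqueMax abc₂ C H := by
  constructor
  · intro F hF
    obtain ⟨α, c, e, hα, hc, heq⟩ := exists_affine n hF
    refine ⟨hH, fun V _ T hT => ?_⟩
    rw [heq V T (hC V T hT), heq W H (hC W H hH)]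
    have hm := h V T hT
    refine ⟨?_, fun he => ?_, fun ⟨f⟩ => by rw [distSum_iso f]⟩
    · have := mul_le_mul_of_nonneg_left (hm.distSum_le α hα) hc.le
      linarith
    · obtain ⟨f⟩ := hm.iso α hα (mul_left_cancel₀ hc.ne' (add_right_cancel he)).symm
      exact ⟨f.symm⟩
  · refine ⟨hH, fun V _ T hT => ?_⟩
    have h1 := hC V T hT
    have h2 := hC W H hH
    have := (h V T hT).abc₂_le h2.1 h1.1 (h2.2.trans h1.2.symm)
    refine ⟨this.1, fun he => ?_, fun ⟨f⟩ => abc₂_iso h1.1 f⟩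
    obtain ⟨f⟩ := this.2 he.symm
    exact ⟨f.symm⟩

end Extremal

end TreeIndices

namespace TreeIndices

open SimpleGraph Classical

/-! ### Partial sums of a weight and their convexity -/

section Weights

variable {g : ℕ → ℝ}

/-- `g 1 + ⋯ + g m`. -/
noncomputable def hsum (g : ℕ → ℝ) (m : ℕ) : ℝ := ∑ t ∈ Finset.range m, g (t + 1)

/-- The sum of `g |i - j|` over `i, j < k`, the distance sum of a path on `k` vertices. -/
noncomputable def pathSum (g : ℕ → ℝ) (k : ℕ) : ℝ :=
  ∑ i ∈ Finset.range k, ∑ j ∈ Finset.range k, g ((i - j) + (j - i))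

theorem hsum_succ (g : ℕ → ℝ) (m : ℕ) : hsum g (m + 1) = hsum g m + g (m + 1) :=
  Finset.sum_range_succ _ _

theorem hsum_add (g : ℕ → ℝ) (m d : ℕ) :
    hsum g (m + d) = hsum g m + ∑ t ∈ Finset.range d, g (m + t + 1) :=
  Finset.sum_range_add _ _ _

theorem sum_range_eq_hsum (h0 : g 0 = 0) (m : ℕ) : ∑ t ∈ Finset.range (m + 1), g t = hsum g m := by
  rw [Finset.sum_range_succ', h0, add_zero, hsum]

theorem sum_range_dist (G : ℕ → ℝ) {j k : ℕ} (h : j ≤ k) :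
    ∑ i ∈ Finset.range k, G ((i - j) + (j - i)) =
      ∑ t ∈ Finset.range j, G (t + 1) + ∑ t ∈ Finset.range (k - j), G t := by
  obtain ⟨m, rfl⟩ := Nat.exists_eq_add_of_le h
  rw [Finset.sum_range_add, ← Finset.sum_range_reflect (fun t => G (t + 1)) j,
    Nat.add_sub_cancel_left]
  congr 1
  · refine Finset.sum_congr rfl fun i hi => ?_
    rw [Finset.mem_range] at hi
    congr 1
    omega
  · refine Finset.sum_congr rfl fun i hi => ?_
    congr 1
    omega

theorem sum_range_dist_succ (g : ℕ → ℝ) {j k : ℕ} (h : j < k) :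
    ∑ i ∈ Finset.range k, g (1 + ((i - j) + (j - i))) =
      hsum g (j + 1) + hsum g (k - j) - g 1 := by
  have := sum_range_dist (fun d => g (1 + d)) h.le
  rw [this]
  have h1 : ∑ t ∈ Finset.range j, g (1 + (t + 1)) = hsum g (j + 1) - g 1 := by
    rw [hsum, Finset.sum_range_succ', zero_add, add_sub_cancel_right]
    exact Finset.sum_congr rfl fun t _ => by rw [add_comm]
  have h2 : ∑ t ∈ Finset.range (k - j), g (1 + t) = hsum g (k - j) :=
    Finset.sum_congr rfl fun t _ => by rw [add_comm]
  rw [h1, h2]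
  ring

theorem pathSum_succ (h0 : g 0 = 0) (k : ℕ) :
    pathSum g (k + 1) = pathSum g k + 2 * hsum g k := by
  rw [pathSum, Finset.sum_range_succ]
  simp_rw [Finset.sum_range_succ _ k]
  rw [Finset.sum_add_distrib, ← pathSum]
  have h1 : ∑ x ∈ Finset.range k, g (x - k + (k - x)) = hsum g k := by
    have := sum_range_dist g (le_refl k)
    rw [this]
    simp [hsum]
  have h2 : ∑ x ∈ Finset.range k, g (k - x + (x - k)) = hsum g k := by
    rw [← h1]
    exact Finset.sum_congr rfl fun t _ => by rw [add_comm]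
  rw [h1, h2]
  simp only [Nat.sub_self, add_zero, h0]
  ring

/-- Partial sums of an increasing sequence are convex, so spreading the two arguments apart
increases the sum. This places pendent vertices at the end of a path for the maximum and at its
centre for the minimum. -/
theorem hsum_add_le (hg : StrictMono g) {x y u v : ℕ} (h : x + y = u + v) (hu : x ≤ u)
    (hv : x ≤ v) : hsum g u + hsum g v ≤ hsum g x + hsum g y := by
  obtain ⟨d, rfl⟩ := Nat.exists_eq_add_of_le hu
  have hy : y = v + d := by omega
  subst hy
  rw [hsum_add, hsum_add]
  have : ∑ t ∈ Finset.range d, g (x + t + 1) ≤ ∑ t ∈ Finset.range d, g (v + t + 1) :=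
    Finset.sum_le_sum fun t _ => hg.monotone (by omega)
  linarith

theorem hsum_add_lt (hg : StrictMono g) {x y u v : ℕ} (h : x + y = u + v) (hu : x < u)
    (hv : x < v) : hsum g u + hsum g v < hsum g x + hsum g y := by
  obtain ⟨d, rfl⟩ := Nat.exists_eq_add_of_le hu.le
  have hy : y = v + d := by omega
  subst hy
  rw [hsum_add, hsum_add]
  have : ∑ t ∈ Finset.range d, g (x + t + 1) < ∑ t ∈ Finset.range d, g (v + t + 1) :=
    Finset.sum_lt_sum_of_nonempty (Finset.nonempty_range_iff.2 (by omega))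
      fun t _ => hg (by omega)
  linarith

end Weights

/-! ### Sums over distance levels -/

section Levels

variable {V : Type} [Fintype V] {g : ℕ → ℝ}

/-- If some value exceeds `t`, then each of `0, …, t` is attained, which uses up at least `t + 1`
vertices below the level. -/
theorem card_level_le {φ : V → ℕ} (hφ : ∀ x, ∀ m ≤ φ x, ∃ y, φ y = m) (t : ℕ) :
    (Finset.univ.filter fun x => t + 1 ≤ φ x).card ≤ Fintype.card V - (t + 1) := by
  rcases (Finset.univ.filter fun x => t + 1 ≤ φ x).eq_empty_or_nonempty with h | ⟨z, hz⟩
  · rw [h, Finset.card_empty]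
    exact Nat.zero_le _
  · have hz : t + 1 ≤ φ z := by simpa using hz
    have h1 : t + 1 ≤ (Finset.univ.filter fun x => ¬ (t + 1 ≤ φ x)).card := by
      rw [← Finset.card_range (t + 1)]
      refine (Finset.card_le_card ?_).trans (Finset.card_image_le (f := φ))
      intro m hm
      rw [Finset.mem_range] at hm
      obtain ⟨y, rfl⟩ := hφ z m (by omega)
      exact Finset.mem_image_of_mem _ (by simpa using hm)
    have h2 := Finset.card_filter_add_card_filter_not (s := (Finset.univ : Finset V))
      (fun x => t + 1 ≤ φ x)
    rw [Finset.card_univ] at h2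
    omega

theorem lt_card_of_levels {φ : V → ℕ} (hφ : ∀ x, ∀ m ≤ φ x, ∃ y, φ y = m) (x : V) :
    φ x < Fintype.card V := by
  by_contra h
  have h1 := card_level_le hφ (φ x - 1)
  have hpos : 0 < Fintype.card V := Fintype.card_pos_iff.2 ⟨x⟩
  have : 0 < (Finset.univ.filter fun y => φ x - 1 + 1 ≤ φ y).card :=
    Finset.card_pos.2 ⟨x, by simp; omega⟩
  omega

theorem sum_levels_sub {φ : V → ℕ} (hφ : ∀ x, ∀ m ≤ φ x, ∃ y, φ y = m) (g : ℕ → ℝ) :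
    ∑ m ∈ Finset.range (Fintype.card V), g m - ∑ x, g (φ x) =
      ∑ t ∈ Finset.range (Fintype.card V), (g (t + 1) - g t) *
        (((Fintype.card V - (t + 1) : ℕ) : ℝ) -
          (Finset.univ.filter fun x => t + 1 ≤ φ x).card) := by
  rw [sum_comp_eq_layers Finset.univ φ g (N := Fintype.card V)
    fun a _ => (lt_card_of_levels hφ a).le]
  rw [show ∑ m ∈ Finset.range (Fintype.card V), g m =
    ∑ m ∈ Finset.range (Fintype.card V), g (id m) from rfl,
    sum_comp_eq_layers (Finset.range (Fintype.card V)) id g (N := Fintype.card V)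
      fun a ha => (Finset.mem_range.1 ha).le, Finset.card_range, Finset.card_univ,
    add_sub_add_left_eq_sub, ← Finset.sum_sub_distrib]
  simp_rw [← mul_sub]
  refine Finset.sum_congr rfl fun t _ => ?_
  congr 3
  have : (Finset.range (Fintype.card V)).filter (fun a => t + 1 ≤ id a) =
      Finset.Ico (t + 1) (Fintype.card V) := by
    ext a
    simp only [Finset.mem_filter, Finset.mem_range, id, Finset.mem_Ico]
    tauto
  rw [this, Nat.card_Ico]

theorem sum_levels_le {φ : V → ℕ} (hφ : ∀ x, ∀ m ≤ φ x, ∃ y, φ y = m) (hg : Monotone g) :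
    ∑ x, g (φ x) ≤ ∑ m ∈ Finset.range (Fintype.card V), g m := by
  have h := sum_levels_sub hφ g
  have : 0 ≤ ∑ t ∈ Finset.range (Fintype.card V), (g (t + 1) - g t) *
        (((Fintype.card V - (t + 1) : ℕ) : ℝ) -
          (Finset.univ.filter fun x => t + 1 ≤ φ x).card) :=
    Finset.sum_nonneg fun t _ => mul_nonneg (sub_nonneg.2 (hg (Nat.le_succ t)))
      (sub_nonneg.2 (by exact_mod_cast card_level_le hφ t))
  linarith

/-- Equality of the sums makes each nonnegative term of the Abel sum vanish. Strictness is required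
only at `t`, so that weights which become constant from some point on are allowed. -/
theorem card_level_eq {φ : V → ℕ} (hφ : ∀ x, ∀ m ≤ φ x, ∃ y, φ y = m) (hg : Monotone g)
    (heq : ∑ x, g (φ x) = ∑ m ∈ Finset.range (Fintype.card V), g m) {t : ℕ}
    (ht : t < Fintype.card V) (hlt : g t < g (t + 1)) :
    (Finset.univ.filter fun x => t + 1 ≤ φ x).card = Fintype.card V - (t + 1) := by
  have h := sum_levels_sub hφ g
  rw [heq, sub_self] at h
  have h0 := (Finset.sum_eq_zero_iff_of_nonneg (fun t _ => mul_nonneg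
    (sub_nonneg.2 (hg (Nat.le_succ t)))
      (sub_nonneg.2 (by exact_mod_cast card_level_le hφ t)))).1 h.symm t (Finset.mem_range.2 ht)
  have := (mul_eq_zero.1 h0).resolve_left (sub_pos.2 hlt).ne'
  have h2 := sub_eq_zero.1 this
  exact_mod_cast h2.symm

end Levels

theorem exists_dist_eq {V : Type} {T : SimpleGraph V} (hT : T.Connected) (v x : V) (m : ℕ)
    (hm : m ≤ T.dist v x) : ∃ y, T.dist v y = m := by
  obtain ⟨p, h0, _, hp⟩ := exists_geodesic hT (rfl : T.dist v x = _)
  refine ⟨p m, ?_⟩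
  have := hp 0 m (Nat.zero_le _) hm
  rw [h0] at this
  omega

/-! ### Deletion of leaves, and the maximality of the path -/

section Prune

variable {V : Type} [Fintype V] {T : SimpleGraph V}

theorem eq_of_degree_one {z a b : V} (h : T.degree z = 1) (ha : T.Adj z a) (hb : T.Adj z b) :
    a = b := by
  obtain ⟨c, _, hc⟩ := degree_eq_one_iff_existsUnique_adj.1 h
  rw [hc a ha, hc b hb]

theorem dist_leaf (hT : T.IsTree) {x u y : V} (h : T.degree x = 1) (hu : T.Adj x u)
    (hy : y ≠ x) : T.dist x y = 1 + T.dist u y := by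
  have h1 := par_adj hT.connected hy.symm
  have h2 := dist_par hT.connected hy.symm
  rw [eq_of_degree_one h h1 hu] at h2
  rw [T.dist_comm, h2, T.dist_comm (u := u), add_comm]

/-- The graph that remains when the vertices in `L` are deleted. -/
def prune (T : SimpleGraph V) (L : Finset V) : SimpleGraph {x // x ∉ L} :=
  T.comap Subtype.val

/-- A leaf is never an inner vertex of a geodesic: it would need one neighbour towards each end, but
has only one neighbour. -/
theorem dist_prune_aux (hT : T.IsTree) {L : Finset V} (hL : ∀ x ∈ L, T.degree x = 1)
    (x y : {x // x ∉ L}) :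
    (prune T L).Reachable x y ∧ (prune T L).dist x y = T.dist x.1 y.1 := by
  refine dist_eq_of_recursion (φ := fun y => T.dist x.1 y.1) T.dist_self ?_ ?_ y
  · intro v w h
    have := hT.dist_eq_dist_add_one_of_adj x.1 (show T.Adj v.1 w.1 from h)
    omega
  · intro v hv
    have hne : v.1 ≠ x.1 := fun h => hv (Subtype.ext h)
    have h1 := par_adj hT.connected hne
    have h2 := dist_par hT.connected hne
    refine ⟨⟨par T x.1 v.1, fun hmem => ?_⟩, h1, h2⟩
    have hz : par T x.1 v.1 ≠ x.1 := fun h => x.2 (h ▸ hmem)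
    have h3 := par_adj hT.connected hz
    have h4 := dist_par hT.connected hz
    have := eq_of_degree_one (hL _ hmem) h1.symm h3
    rw [← this] at h4
    omega

theorem dist_prune (hT : T.IsTree) {L : Finset V} (hL : ∀ x ∈ L, T.degree x = 1)
    (x y : {x // x ∉ L}) : (prune T L).dist x y = T.dist x.1 y.1 :=
  (dist_prune_aux hT hL x y).2

theorem isTree_prune (hT : T.IsTree) {L : Finset V} (hL : ∀ x ∈ L, T.degree x = 1)
    (hne : ∃ x, x ∉ L) : (prune T L).IsTree := by
  obtain ⟨x, hx⟩ := hne
  refine ⟨?_, ?_⟩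
  · have : Nonempty {x // x ∉ L} := ⟨⟨x, hx⟩⟩
    exact ⟨fun x y => (dist_prune_aux hT hL x y).1⟩
  · exact hT.isAcyclic.comap ⟨Subtype.val, fun h => h⟩ Subtype.val_injective

theorem card_prune (L : Finset V) : Fintype.card {x // x ∉ L} = Fintype.card V - L.card := by
  rw [Fintype.card_subtype_compl, Fintype.card_coe]

theorem sum_notMem_eq (L : Finset V) (f : V → ℝ) :
    ∑ x ∈ Lᶜ, f x = ∑ x : {x // x ∉ L}, f x :=
  Finset.sum_subtype _ (fun x => by simp) f

theorem distSum_split (hT : T.IsTree) {L : Finset V} (hL : ∀ x ∈ L, T.degree x = 1) (g : ℕ → ℝ) :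
    distSum g T = distSum g (prune T L) + 2 * ∑ x ∈ L, ∑ y : {y // y ∉ L}, g (T.dist x y) +
      ∑ x ∈ L, ∑ y ∈ L, g (T.dist x y) := by
  have h1 : distSum g (prune T L) = ∑ x ∈ Lᶜ, ∑ y ∈ Lᶜ, g (T.dist x y) := by
    rw [distSum, sum_notMem_eq]
    refine Finset.sum_congr rfl fun x _ => ?_
    rw [sum_notMem_eq]
    exact Finset.sum_congr rfl fun y _ => by rw [dist_prune hT hL]
  have h2 : ∑ x ∈ L, ∑ y : {y // y ∉ L}, g (T.dist x y) = ∑ x ∈ L, ∑ y ∈ Lᶜ, g (T.dist x y) :=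
    Finset.sum_congr rfl fun x _ => (sum_notMem_eq L fun y => g (T.dist x y)).symm
  have h3 : ∑ x ∈ Lᶜ, ∑ y ∈ L, g (T.dist x y) = ∑ x ∈ L, ∑ y ∈ Lᶜ, g (T.dist x y) := by
    rw [Finset.sum_comm]
    exact Finset.sum_congr rfl fun x _ => Finset.sum_congr rfl fun y _ => by rw [T.dist_comm]
  rw [h1, h2, distSum, ← Finset.sum_add_sum_compl L]
  simp_rw [← Finset.sum_add_sum_compl L (fun y => g (T.dist _ y))]
  rw [Finset.sum_add_distrib, Finset.sum_add_distrib, h3]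
  ring

theorem distSum_leaf (hT : T.IsTree) {v : V} (hv : T.degree v = 1) {g : ℕ → ℝ} (h0 : g 0 = 0) :
    distSum g T = distSum g (prune T {v}) + 2 * ∑ y, g (T.dist v y) := by
  have hL : ∀ x ∈ ({v} : Finset V), T.degree x = 1 := by
    intro x hx
    rw [Finset.mem_singleton] at hx
    rwa [hx]
  rw [distSum_split hT hL, Finset.sum_singleton, Finset.sum_singleton, Finset.sum_singleton,
    T.dist_self, h0, add_zero, ← sum_notMem_eq {v} fun y => g (T.dist v y),
    ← Finset.sum_add_sum_compl {v} fun y => g (T.dist v y), Finset.sum_singleton, T.dist_self, h0,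
    zero_add]

/-- Among the trees on `n` vertices, the path has the largest distance sum. -/
theorem distSum_le_pathSum {g : ℕ → ℝ} (h0 : g 0 = 0) (hg : Monotone g) (n : ℕ) :
    ∀ (V : Type) [Fintype V] (T : SimpleGraph V), T.IsTree → Fintype.card V = n →
      distSum g T ≤ pathSum g n := by
  induction n with
  | zero =>
    intro V _ T hT hn
    have := Fintype.card_pos_iff.2 hT.connected.nonempty
    omega
  | succ n ih =>
    intro V _ T hT hn
    rcases Nat.eq_zero_or_pos n with rfl | hpos
    · have : Subsingleton V := Fintype.card_le_one_iff_subsingleton.1 (by omega)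
      have h : distSum g T = 0 := by
        refine Finset.sum_eq_zero fun u _ => Finset.sum_eq_zero fun v _ => ?_
        rw [Subsingleton.elim u v, T.dist_self, h0]
      rw [h]
      simp [pathSum, h0]
    · have : Nontrivial V := Fintype.one_lt_card_iff_nontrivial.1 (by omega)
      obtain ⟨v, hv⟩ := hT.exists_vert_degree_one_of_nontrivial
      obtain ⟨w, hw⟩ := exists_ne v
      have hL : ∀ x ∈ ({v} : Finset V), T.degree x = 1 := by
        intro x hx
        rw [Finset.mem_singleton] at hx
        rwa [hx]
      have h1 := ih _ (prune T {v}) (isTree_prune hT hL ⟨w, by simpa using hw⟩)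
        (by rw [card_prune, hn, Finset.card_singleton]; rfl)
      -- The distances from the deleted leaf fill an initial segment of `ℕ`, so their sum is at most
      -- the one seen from the end of a path.
      have h2 := sum_levels_le (exists_dist_eq hT.connected v) hg
      rw [hn, sum_range_eq_hsum h0] at h2
      rw [distSum_leaf hT hv h0, pathSum_succ h0]
      linarith

/-- It suffices to find two vertices at distance `n - 1`. Equality must hold in the estimate for the
deleted leaf, hence already this leaf is one of them; no induction is needed. -/
theorem exists_path_of_distSum_eq {g : ℕ → ℝ} (h0 : g 0 = 0) (hg : StrictMono g)
    (hT : T.IsTree) {n : ℕ} (hn : Fintype.card V = n) (heq : distSum g T = pathSum g n) :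
    ∃ p : ℕ → V, (∀ i j, i < n → j < n → T.dist (p i) (p j) = (i - j) + (j - i)) := by
  have hpos := Fintype.card_pos_iff.2 hT.connected.nonempty
  suffices h : ∃ u v, T.dist u v = n - 1 by
    obtain ⟨u, v, h⟩ := h
    obtain ⟨p, _, _, hp⟩ := exists_geodesic hT.connected h
    exact ⟨p, fun i j hi hj => hp i j (by omega) (by omega)⟩
  obtain ⟨m, rfl⟩ : ∃ m, n = m + 1 := ⟨n - 1, by omega⟩
  rcases Nat.eq_zero_or_pos m with rfl | hm
  · obtain ⟨u⟩ := hT.connected.nonempty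
    exact ⟨u, u, T.dist_self⟩
  · have : Nontrivial V := Fintype.one_lt_card_iff_nontrivial.1 (by omega)
    obtain ⟨v, hv⟩ := hT.exists_vert_degree_one_of_nontrivial
    obtain ⟨w, hw⟩ := exists_ne v
    have hL : ∀ x ∈ ({v} : Finset V), T.degree x = 1 := by
      intro x hx
      rw [Finset.mem_singleton] at hx
      rwa [hx]
    have h1 := distSum_le_pathSum h0 hg.monotone m _ (prune T {v})
      (isTree_prune hT hL ⟨w, by simpa using hw⟩)
      (by rw [card_prune, hn, Finset.card_singleton]; rfl)
    have h2 := sum_levels_le (exists_dist_eq hT.connected v) hg.monotone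
    rw [distSum_leaf hT hv h0, pathSum_succ h0] at heq
    have h3 := h2
    rw [hn, sum_range_eq_hsum h0] at h3
    have h4 : ∑ y, g (T.dist v y) = ∑ t ∈ Finset.range (Fintype.card V), g t := by
      rw [hn, sum_range_eq_hsum h0]
      linarith
    -- There are `m + 1` vertices, so exactly one of them has distance at least `m` from the leaf.
    have h5 := card_level_eq (exists_dist_eq hT.connected v) hg.monotone h4 (t := m - 1)
      (by omega) (hg (by omega))
    have h6 : 0 < (Finset.univ.filter fun x => m - 1 + 1 ≤ T.dist v x).card := by omega
    obtain ⟨x, hx⟩ := Finset.card_pos.1 h6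
    have hx : m - 1 + 1 ≤ T.dist v x := by simpa using hx
    have := lt_card_of_levels (exists_dist_eq hT.connected v) x
    exact ⟨v, x, by omega⟩

end Prune

end TreeIndices

namespace TreeIndices

open SimpleGraph Classical

/-! ### Distances, distance sums and edge counts of caterpillars -/

section Caterpillar

variable {k : ℕ} {a : Fin k → ℕ}

/-- The index of the path vertex that carries a vertex of a caterpillar. -/
def catPos (a : Fin k → ℕ) : Fin k ⊕ (Σ i : Fin k, Fin (a i)) → ℕ :=
  Sum.elim (fun i => i.val) fun p => p.1.val

/-- The distance of a vertex of a caterpillar from the path. -/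
def catHeight (a : Fin k → ℕ) : Fin k ⊕ (Σ i : Fin k, Fin (a i)) → ℕ :=
  Sum.elim (fun _ => 0) fun _ => 1

theorem caterpillar_dist_aux (x y : Fin k ⊕ (Σ i : Fin k, Fin (a i))) :
    (caterpillar a).Reachable x y ∧ (caterpillar a).dist x y = if y = x then 0 else
      (catPos a x - catPos a y) + (catPos a y - catPos a x) + catHeight a x + catHeight a y := by
  refine dist_eq_of_recursion (φ := fun y => if y = x then 0 else
    (catPos a x - catPos a y) + (catPos a y - catPos a x) + catHeight a x + catHeight a y)
    (by simp) ?_ ?_ y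
  · rintro (i | p) (j | q) h
    · have h : (pathGraph k).Adj i j := h
      rw [pathGraph_adj] at h
      simp only [catPos, catHeight, Sum.elim_inl]
      split_ifs with h1 h2 h2
      · omega
      · omega
      · subst h2
        simp only [Sum.elim_inl]
        omega
      · omega
    · have h : q.1 = i := h
      simp only [catPos, catHeight, Sum.elim_inl, Sum.elim_inr]
      split_ifs with h1 h2 h2
      · omega
      · omega
      · subst h2 h
        simp
      · subst h
        omega
    · have h : p.1 = j := h
      simp only [catPos, catHeight, Sum.elim_inl, Sum.elim_inr]
      split_ifs with h1 h2 h2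
      · omega
      · omega
      · subst h2 h
        simp
      · subst h
        omega
    · exact h.elim
  · rintro (i | p) hv
    · rcases lt_trichotomy (catPos a x) i.val with hlt | heq | hgt
      · refine ⟨.inl ⟨i.val - 1, by omega⟩, ?_, ?_⟩
        · change (pathGraph k).Adj _ _
          rw [pathGraph_adj]
          simp only
          omega
        · rw [if_neg hv]
          have hlt' := hlt
          rcases x with j | q <;>
            simp only [catPos, catHeight, Sum.elim_inl, Sum.elim_inr, Sum.inl.injEq, Fin.ext_iff,
              reduceCtorEq, if_false] at * <;> first | omega | (split_ifs <;> omega)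
      · refine ⟨x, ?_, ?_⟩
        · rcases x with j | q
          · exact absurd (congrArg Sum.inl (Fin.ext heq.symm)) hv
          · exact (Fin.ext heq : q.1 = i)
        · rw [if_neg hv, if_pos rfl]
          rcases x with j | q
          · exact absurd (congrArg Sum.inl (Fin.ext heq.symm)) hv
          · simp only [catPos, catHeight, Sum.elim_inl, Sum.elim_inr] at *
            omega
      · refine ⟨.inl ⟨i.val + 1, ?_⟩, ?_, ?_⟩
        · rcases x with j | q <;> simp only [catPos, Sum.elim_inl, Sum.elim_inr] at hgt <;> omega
        · change (pathGraph k).Adj _ _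
          rw [pathGraph_adj]
          simp
        · rw [if_neg hv]
          have hgt' := hgt
          rcases x with j | q <;>
            simp only [catPos, catHeight, Sum.elim_inl, Sum.elim_inr, Sum.inl.injEq, Fin.ext_iff,
              reduceCtorEq, if_false] at * <;> first | omega | (split_ifs <;> omega)
    · refine ⟨.inl p.1, rfl, ?_⟩
      rw [if_neg hv]
      simp only [catPos, catHeight, Sum.elim_inl, Sum.elim_inr] at *
      split_ifs with h1
      · subst h1
        simp
      · omega

theorem caterpillar_dist (x y : Fin k ⊕ (Σ i : Fin k, Fin (a i))) :
    (caterpillar a).dist x y = if y = x then 0 else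
      (catPos a x - catPos a y) + (catPos a y - catPos a x) + catHeight a x + catHeight a y :=
  (caterpillar_dist_aux x y).2

theorem caterpillar_dist_inl_inl (i j : Fin k) : (caterpillar a).dist (.inl i) (.inl j) =
    (i.val - j.val) + (j.val - i.val) := by
  rw [caterpillar_dist]
  simp only [catPos, catHeight, Sum.elim_inl]
  split_ifs with h
  · rw [Sum.inl.inj h]; omega
  · omega

theorem caterpillar_dist_inl_inr (i : Fin k) (p : Σ i : Fin k, Fin (a i)) :
    (caterpillar a).dist (.inl i) (.inr p) = 1 + ((i.val - p.1.val) + (p.1.val - i.val)) := by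
  rw [caterpillar_dist, if_neg (by simp)]
  simp only [catPos, catHeight, Sum.elim_inl, Sum.elim_inr]
  omega

theorem caterpillar_dist_inr_inr {p q : Σ i : Fin k, Fin (a i)} (h : p ≠ q) :
    (caterpillar a).dist (.inr p) (.inr q) = 2 + ((p.1.val - q.1.val) + (q.1.val - p.1.val)) := by
  rw [caterpillar_dist, if_neg (by simpa using h.symm)]
  simp only [catPos, catHeight, Sum.elim_inr]
  omega

theorem isTree_caterpillar (hk : 0 < k) (a : Fin k → ℕ) : (caterpillar a).IsTree := by
  have : Nonempty (Fin k ⊕ (Σ i : Fin k, Fin (a i))) := ⟨.inl ⟨0, hk⟩⟩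
  refine isTree_of_parent ⟨fun x y => (caterpillar_dist_aux x y).1⟩ (.inl ⟨0, hk⟩)
    (Sum.elim (fun i => .inl ⟨i.val - 1, by omega⟩) fun p => .inl p.1) ?_
  rintro (i | p) (j | q) h
  · have h : (pathGraph k).Adj i j := h
    rw [pathGraph_adj] at h
    simp only [ne_eq, Sum.elim_inl, Sum.inl.injEq, Fin.ext_iff]
    omega
  · have h : q.1 = i := h
    exact Or.inr ⟨by simp, by simp [h]⟩
  · have h : p.1 = j := h
    exact Or.inl ⟨by simp, by simp [h]⟩
  · exact h.elim

theorem card_caterpillar (a : Fin k → ℕ) :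
    Fintype.card (Fin k ⊕ (Σ i : Fin k, Fin (a i))) = k + ∑ i, a i := by
  simp

theorem sum_caterpillar (f : Fin k ⊕ (Σ i : Fin k, Fin (a i)) → ℝ) :
    ∑ x, f x = ∑ i, f (.inl i) + ∑ i, ∑ j : Fin (a i), f (.inr ⟨i, j⟩) := by
  rw [Fintype.sum_sum_type, Fintype.sum_sigma]

/-- The last bracket treats all ordered pairs of pendent vertices as if they were distinct, giving
`g 2` for a vertex paired with itself, and then subtracts these terms. -/
theorem distSum_caterpillar (a : Fin k → ℕ) {g : ℕ → ℝ} (h0 : g 0 = 0) :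
    distSum g (caterpillar a) = pathSum g k +
      2 * ∑ i : Fin k, (a i : ℝ) * ∑ j ∈ Finset.range k, g (1 + ((j - i) + (i - j))) +
      (∑ i : Fin k, (a i : ℝ) *
        ∑ j : Fin k, (a j : ℝ) * g (2 + ((i.val - j.val) + (j.val - i.val))) -
        (∑ i : Fin k, (a i : ℝ)) * g 2) := by
  have hrr : ∀ p : Σ i : Fin k, Fin (a i),
      ∑ i, ∑ j : Fin (a i), g ((caterpillar a).dist (.inr p) (.inr ⟨i, j⟩)) =
      ∑ j : Fin k, (a j : ℝ) * g (2 + ((p.1.val - j.val) + (j.val - p.1.val))) - g 2 := by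
    intro p
    have h1 : ∀ q : Σ i : Fin k, Fin (a i), g ((caterpillar a).dist (.inr p) (.inr q)) =
        g (2 + ((p.1.val - q.1.val) + (q.1.val - p.1.val))) - if q = p then g 2 else 0 := by
      intro q
      split_ifs with h
      · subst h
        simp [h0]
      · rw [caterpillar_dist_inr_inr (Ne.symm h), sub_zero]
    rw [← Fintype.sum_sigma (fun q : Σ i : Fin k, Fin (a i) =>
      g ((caterpillar a).dist (.inr p) (.inr q)))]
    simp_rw [h1]
    rw [Finset.sum_sub_distrib, Finset.sum_ite_eq' Finset.univ p, if_pos (Finset.mem_univ _),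
      Fintype.sum_sigma]
    simp
  rw [distSum, sum_caterpillar]
  simp_rw [sum_caterpillar, hrr, caterpillar_dist_inl_inl, caterpillar_dist_inl_inr,
    (caterpillar a).dist_comm (u := .inr _) (v := .inl _), caterpillar_dist_inl_inr]
  simp only [Finset.sum_add_distrib, Finset.sum_const, Finset.card_univ, Fintype.card_fin,
    nsmul_eq_mul]
  have e1 : ∑ i : Fin k, ∑ j : Fin k, g ((i.val - j.val) + (j.val - i.val)) = pathSum g k := by
    rw [pathSum, Finset.sum_range]
    refine Finset.sum_congr rfl fun i _ => ?_
    rw [Finset.sum_range]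
  have e2 : ∀ i : Fin k, ∑ j : Fin k, g (1 + ((j.val - i.val) + (i.val - j.val))) =
      ∑ j ∈ Finset.range k, g (1 + ((j - i) + (i - j))) := by
    intro i
    rw [Finset.sum_range]
  have e3 : ∑ i : Fin k, ∑ j : Fin k, (a j : ℝ) * g (1 + ((i.val - j.val) + (j.val - i.val))) =
      ∑ i : Fin k, (a i : ℝ) * ∑ j : Fin k, g (1 + ((j.val - i.val) + (i.val - j.val))) := by
    rw [Finset.sum_comm]
    simp_rw [Finset.mul_sum]
  rw [e1, e3]
  simp_rw [e2, mul_sub]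
  rw [Finset.sum_sub_distrib, Finset.sum_mul]
  ring

/-- The number of vertices of a caterpillar that are carried by `v_i, …, v_k`. -/
def tailCard (a : Fin k → ℕ) (i : ℕ) : ℕ := ∑ j : Fin k, if i ≤ j.val then 1 + a j else 0

theorem card_filter_caterpillar (P : Fin k ⊕ (Σ i : Fin k, Fin (a i)) → Prop)
    [DecidablePred P] :
    (Finset.univ.filter P).card = (Finset.univ.filter fun i => P (.inl i)).card +
      ∑ i, (Finset.univ.filter fun j : Fin (a i) => P (.inr ⟨i, j⟩)).card := by
  simp_rw [Finset.card_filter]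
  rw [Fintype.sum_sum_type, Fintype.sum_sigma]

theorem card_sub_inl (hk : 0 < k) (a : Fin k → ℕ) (i : Fin k) :
    (sub (caterpillar a) (.inl ⟨0, hk⟩) (.inl i)).card = tailCard a i := by
  rw [sub, card_filter_caterpillar, tailCard, Finset.card_filter, ← Finset.sum_add_distrib]
  refine Finset.sum_congr rfl fun j _ => ?_
  simp_rw [caterpillar_dist_inl_inl, caterpillar_dist_inl_inr]
  by_cases h : i.val ≤ j.val
  · rw [if_pos (by omega), if_pos h, Finset.filter_true_of_mem (fun _ _ => by omega)]
    simp
  · rw [if_neg (by omega), if_neg h, Finset.filter_false_of_mem (fun _ _ => by omega)]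
    simp

theorem card_sub_inr (hk : 0 < k) (a : Fin k → ℕ) (p : Σ i : Fin k, Fin (a i)) :
    (sub (caterpillar a) (.inl ⟨0, hk⟩) (.inr p)).card = 1 := by
  rw [Finset.card_eq_one]
  refine ⟨.inr p, ?_⟩
  ext y
  rw [mem_sub, Finset.mem_singleton]
  constructor
  · intro h
    by_contra hne
    rcases y with j | q
    · rw [caterpillar_dist_inl_inl, (caterpillar a).dist_comm (u := .inr _),
        caterpillar_dist_inl_inr, caterpillar_dist_inl_inr] at h
      omega
    · rw [caterpillar_dist_inr_inr (fun h => hne (by rw [h])), caterpillar_dist_inl_inr,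
        caterpillar_dist_inl_inr] at h
      omega
  · rintro rfl
    simp

/-- Pendent edges have `μ ≤ 1`, so for `t ≥ 2` only the path edges remain; the index `i` stands for
the edge whose far end is the path vertex with index `i`. -/
theorem edgeCount_caterpillar (hk : 0 < k) (a : Fin k → ℕ) {t : ℕ} (ht : 2 ≤ t) :
    edgeCount (caterpillar a) t = ((Finset.Ico 1 k).filter fun i =>
      t ≤ tailCard a i ∧ tailCard a i + t ≤ k + ∑ i, a i).card := by
  rw [edgeCount_eq (isTree_caterpillar hk a) (.inl ⟨0, hk⟩), card_caterpillar]
  symm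
  refine Finset.card_bij (fun i hi => .inl ⟨i, ?_⟩) ?_ ?_ ?_
  · simp only [Finset.mem_filter, Finset.mem_Ico] at hi
    omega
  · intro i hi
    simp only [Finset.mem_filter, Finset.mem_Ico] at hi
    simp only [Finset.mem_filter, Finset.mem_erase, Finset.mem_univ, and_true, ne_eq,
      Sum.inl.injEq, Fin.mk.injEq, card_sub_inl]
    exact ⟨by omega, hi.2⟩
  · intro i _ j _ h
    simpa using h
  · rintro (i | p) h
    · simp only [Finset.mem_filter, Finset.mem_erase, Finset.mem_univ, and_true, ne_eq,
        Sum.inl.injEq, Fin.ext_iff, card_sub_inl] at h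
      exact ⟨i.val, by simp only [Finset.mem_filter, Finset.mem_Ico]; omega, rfl⟩
    · simp only [Finset.mem_filter, card_sub_inr] at h
      omega

theorem degree_caterpillar_inr (p : Σ i : Fin k, Fin (a i)) :
    (caterpillar a).degree (.inr p) = 1 := by
  rw [degree_eq_one_iff_existsUnique_adj]
  refine ⟨.inl p.1, rfl, ?_⟩
  rintro (j | q) h
  · have h : p.1 = j := h
    rw [h]
  · exact h.elim

theorem degree_caterpillar_inl (i : Fin k) : (caterpillar a).degree (.inl i) =
    (pathGraph k).degree i + a i := by
  rw [← card_neighborFinset_eq_degree, neighborFinset_eq_filter, card_filter_caterpillar,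
    ← card_neighborFinset_eq_degree, neighborFinset_eq_filter]
  congr 1
  rw [Finset.sum_eq_single i]
  · rw [Finset.filter_true_of_mem (p := fun j : Fin (a i) =>
      (caterpillar a).Adj (.inl i) (.inr ⟨i, j⟩)) fun _ _ => rfl]
    simp
  · intro j _ hj
    rw [Finset.card_eq_zero, Finset.filter_eq_empty_iff]
    exact fun _ _ h => hj h
  · simp

end Caterpillar

end TreeIndices

namespace TreeIndices

open SimpleGraph Classical

section Recognition

variable {V : Type} [Fintype V] {T : SimpleGraph V}

/-- A tree all of whose vertices are adjacent to a given path is a caterpillar. -/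
theorem nonempty_iso_caterpillar (hT : T.IsTree) {k : ℕ} {p : Fin k → V}
    (hp : Function.Injective p) (hadj : ∀ i j : Fin k, i.val + 1 = j.val → T.Adj (p i) (p j))
    {J : V → Fin k} (hJ : ∀ x, x ∉ Set.range p → T.Adj x (p (J x))) {a : Fin k → ℕ}
    (ha : ∀ i, Nat.card {x // x ∉ Set.range p ∧ J x = i} = a i) :
    Nonempty (T ≃g caterpillar a) := by
  obtain ⟨v⟩ := hT.connected.nonempty
  have hk : 0 < k := (J v).pos
  have e : ∀ i, {x // x ∉ Set.range p ∧ J x = i} ≃ Fin (a i) := fun i =>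
    Finite.equivFinOfCardEq (ha i)
  let f : Fin k ⊕ (Σ i : Fin k, Fin (a i)) → V :=
    Sum.elim p fun q => ((e q.1).symm q.2).1
  have hf : Function.Bijective f := by
    constructor
    · rintro (i | q) (j | r) h
      · exact congrArg Sum.inl (hp h)
      · have h : p i = ((e r.1).symm r.2).1 := h
        exact absurd ⟨i, h⟩ ((e r.1).symm r.2).2.1
      · have h : ((e q.1).symm q.2).1 = p j := h
        exact absurd ⟨j, h.symm⟩ ((e q.1).symm q.2).2.1
      · obtain ⟨i, q⟩ := q
        obtain ⟨j, r⟩ := r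
        have h : ((e i).symm q).1 = ((e j).symm r).1 := h
        have hij : i = j := by
          rw [← ((e i).symm q).2.2, ← ((e j).symm r).2.2, h]
        subst hij
        have := (e i).symm.injective (Subtype.ext h)
        rw [this]
    · intro x
      by_cases hx : x ∈ Set.range p
      · obtain ⟨i, hi⟩ := hx
        exact ⟨.inl i, hi⟩
      · exact ⟨.inr ⟨J x, e (J x) ⟨x, hx, rfl⟩⟩, by simp [f]⟩
  obtain ⟨φ⟩ := nonempty_iso_of_bijective (isTree_caterpillar hk a) hT f hf (by
    rintro (i | q) (j | r) h
    · have h : (pathGraph k).Adj i j := h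
      rw [pathGraph_adj] at h
      rcases h with h | h
      · exact hadj i j h
      · exact (hadj j i h).symm
    · obtain ⟨r, l⟩ := r
      obtain rfl : r = i := h
      have h1 := hJ _ ((e r).symm l).2.1
      rw [((e r).symm l).2.2] at h1
      exact h1.symm
    · obtain ⟨q, l⟩ := q
      obtain rfl : q = j := h
      have h1 := hJ _ ((e q).symm l).2.1
      rw [((e q).symm l).2.2] at h1
      exact h1
    · exact h.elim)
  exact ⟨φ.symm⟩

end Recognition

/-! ### Double star paths -/

section DoubleStarPath

variable {k a b : ℕ}

theorem sum_doubleStarPath (hk : 0 < k) (F : Fin k → ℝ) :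
    ∑ i : Fin k, (((if i.val = 0 then a else 0) + (if i.val + 1 = k then b else 0) : ℕ) : ℝ) * F i =
      a * F ⟨0, hk⟩ + b * F ⟨k - 1, by omega⟩ := by
  push_cast
  simp_rw [add_mul, Finset.sum_add_distrib]
  congr 1
  · rw [Finset.sum_eq_single ⟨0, hk⟩]
    · simp
    · intro i _ hi
      rw [if_neg (fun h => hi (Fin.ext h)), zero_mul]
    · simp
  · rw [Finset.sum_eq_single ⟨k - 1, by omega⟩]
    · rw [if_pos (by simp only; omega)]
    · intro i _ hi
      rw [if_neg (fun h => hi (Fin.ext (by simp only; omega))), zero_mul]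
    · simp

theorem hsum_one (g : ℕ → ℝ) : hsum g 1 = g 1 := by simp [hsum]

theorem distSum_doubleStarPath (hk : 0 < k) {g : ℕ → ℝ} (h0 : g 0 = 0) :
    distSum g (doubleStarPath k a b) = pathSum g k + 2 * ((a + b) * hsum g k) +
      ((a * (a - 1) + b * (b - 1)) * g 2 + 2 * (a * b) * g (k + 1)) := by
  have h1 : ∑ i : Fin k, (((if i.val = 0 then a else 0) +
      (if i.val + 1 = k then b else 0) : ℕ) : ℝ) = a + b := by
    have := sum_doubleStarPath (a := a) (b := b) hk fun _ => 1
    simpa only [mul_one] using this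
  rw [distSum_caterpillar _ h0, h1]
  simp_rw [sum_doubleStarPath hk]
  rw [sum_range_dist_succ g hk, sum_range_dist_succ g (by omega : k - 1 < k)]
  have e1 : k - 1 + 1 = k := by omega
  have e2 : k - (k - 1) = 1 := by omega
  have e3 : 2 + (0 - (k - 1) + (k - 1 - 0)) = k + 1 := by omega
  have e4 : 2 + (k - 1 - 0 + (0 - (k - 1))) = k + 1 := by omega
  rw [e1, e2, e3, e4, hsum_one]
  simp only [Nat.sub_self, Nat.sub_zero, add_zero]
  ring

theorem tailCard_eq (a : Fin k → ℕ) (i : ℕ) :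
    tailCard a i = (k - i) + ∑ j : Fin k, if i ≤ j.val then a j else 0 := by
  rw [tailCard]
  have h : ∀ j : Fin k, (if i ≤ j.val then 1 + a j else 0) =
      (if i ≤ j.val then 1 else 0) + if i ≤ j.val then a j else 0 := by
    intro j
    split_ifs <;> rfl
  simp_rw [h]
  rw [Finset.sum_add_distrib, Fin.sum_univ_eq_sum_range (fun j => if i ≤ j then 1 else 0) k,
    ← Finset.card_filter]
  congr 1
  have : (Finset.range k).filter (fun j => i ≤ j) = Finset.Ico i k := by
    ext j
    simp only [Finset.mem_filter, Finset.mem_range, Finset.mem_Ico]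
    tauto
  rw [this, Nat.card_Ico]

theorem tailCard_doubleStarPath {i : ℕ} (hi : 1 ≤ i) (hik : i < k) :
    tailCard (fun i : Fin k => (if i.val = 0 then a else 0) + (if i.val + 1 = k then b else 0)) i =
      k - i + b := by
  rw [tailCard_eq]
  congr 1
  rw [Finset.sum_eq_single ⟨k - 1, by omega⟩]
  · rw [if_pos (by simp only; omega), if_neg (by simp only; omega), if_pos (by simp only; omega),
      zero_add]
  · intro j _ hj
    split_ifs with h1 h2 h3 h3
    · omega
    · omega
    · exact absurd (Fin.ext (by simp only; omega)) hj
    · rfl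
    · rfl
  · simp

theorem sum_nat_doubleStarPath (hk : 0 < k) :
    ∑ i : Fin k, ((if i.val = 0 then a else 0) + (if i.val + 1 = k then b else 0)) = a + b := by
  have := sum_doubleStarPath (a := a) (b := b) hk fun _ => 1
  simp only [mul_one] at this
  exact_mod_cast this

theorem card_doubleStarPath (hk : 0 < k) : Fintype.card (Fin k ⊕ (Σ i : Fin k,
    Fin ((if i.val = 0 then a else 0) + (if i.val + 1 = k then b else 0)))) = k + (a + b) := by
  rw [card_caterpillar, sum_nat_doubleStarPath hk]

/-- The edge before the path vertex `i` has `k - i + b` vertices behind it and `i + a` before it;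
both are at least `t` on the interval whose length is given here. -/
theorem le_edgeCount_doubleStarPath (hk : 0 < k) {t : ℕ} (ht : 2 ≤ t) :
    min k (k + b + 1 - t) - max 1 (t - a) ≤ edgeCount (doubleStarPath k a b) t := by
  rw [edgeCount_caterpillar hk _ ht, sum_nat_doubleStarPath hk, ← Nat.card_Ico]
  refine Finset.card_le_card fun i hi => ?_
  rw [Finset.mem_Ico] at hi
  rw [Finset.mem_filter, Finset.mem_Ico, tailCard_doubleStarPath (by omega) (by omega)]
  omega

theorem isTree_doubleStarPath (hk : 0 < k) : (doubleStarPath k a b).IsTree :=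
  isTree_caterpillar hk _

theorem doubleStarPath_symm (hk : 0 < k) :
    Nonempty (doubleStarPath k a b ≃g doubleStarPath k b a) := by
  refine nonempty_iso_caterpillar (isTree_doubleStarPath hk) (p := fun i => .inl i.rev)
    (fun i j h => Fin.rev_injective (Sum.inl_injective h)) ?_
    (J := Sum.elim Fin.rev fun p => p.1.rev) ?_ ?_
  · intro i j h
    change (pathGraph k).Adj _ _
    rw [pathGraph_adj, Fin.val_rev, Fin.val_rev]
    omega
  · rintro (i | p) hx
    · exact absurd ⟨i.rev, by simp⟩ hx
    · change p.1 = _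
      simp
  · intro i
    rw [Nat.subtype_card (Finset.univ.map ⟨fun j => .inr ⟨i.rev, j⟩, fun j l h => by simpa using h⟩)]
    · rw [Finset.card_map, Finset.card_univ, Fintype.card_fin, Fin.val_rev, add_comm]
      have := i.isLt
      congr 1
      · exact if_congr (by omega) rfl rfl
      · exact if_congr (by omega) rfl rfl
    · rintro (j | p)
      · simp only [Finset.mem_map, reduceCtorEq, and_false, exists_false,
          false_iff, not_and]
        exact fun h => absurd ⟨j.rev, by simp⟩ h
      · obtain ⟨j, l⟩ := p
        constructor
        · intro h
          simp only [Finset.mem_map, Finset.mem_univ, true_and] at h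
          obtain ⟨_, rfl, _⟩ := h
          exact ⟨by simp, by simp⟩
        · rintro ⟨_, h⟩
          have h : j.rev = i := h
          obtain rfl : j = i.rev := by rw [← h, Fin.rev_rev]
          exact Finset.mem_map.2 ⟨l, Finset.mem_univ _, rfl⟩

end DoubleStarPath

/-! ### Central caterpillars -/

section CentralCaterpillar

variable {n k s : ℕ}

theorem sum_centralCaterpillar (hs : s < k) (F : Fin k → ℝ) :
    ∑ i : Fin k, ((if i.val + 1 = s + 1 then n - k else 0 : ℕ) : ℝ) * F i =
      ((n - k : ℕ) : ℝ) * F ⟨s, hs⟩ := by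
  rw [Finset.sum_eq_single ⟨s, hs⟩]
  · rw [if_pos rfl]
  · intro i _ hi
    rw [if_neg (fun h => hi (Fin.ext (by simp only; omega))), Nat.cast_zero, zero_mul]
  · simp

theorem sum_nat_centralCaterpillar (hs : s < k) :
    ∑ i : Fin k, (if i.val + 1 = s + 1 then n - k else 0) = n - k := by
  have := sum_centralCaterpillar (n := n) hs fun _ => 1
  simp only [mul_one] at this
  exact_mod_cast this

theorem distSum_centralCaterpillar (hs : s < k) {g : ℕ → ℝ} (h0 : g 0 = 0) :
    distSum g (centralCaterpillar n k (s + 1)) = pathSum g k +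
      2 * (((n - k : ℕ) : ℝ) * (hsum g (s + 1) + hsum g (k - s) - g 1)) +
      ((n - k : ℕ) : ℝ) * (((n - k : ℕ) : ℝ) - 1) * g 2 := by
  have h1 : ∑ i : Fin k, ((if i.val + 1 = s + 1 then n - k else 0 : ℕ) : ℝ) = (n - k : ℕ) := by
    have := sum_centralCaterpillar (n := n) hs fun _ => 1
    simpa only [mul_one] using this
  rw [distSum_caterpillar _ h0, h1]
  simp_rw [sum_centralCaterpillar hs]
  rw [sum_range_dist_succ g hs]
  simp only [Nat.sub_self, add_zero]
  ring

theorem tailCard_centralCaterpillar (hs : s < k) (i : ℕ) :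
    tailCard (fun i : Fin k => if i.val + 1 = s + 1 then n - k else 0) i =
      k - i + if i ≤ s then n - k else 0 := by
  rw [tailCard_eq]
  congr 1
  rw [Finset.sum_eq_single ⟨s, hs⟩]
  · simp
  · intro j _ hj
    have : j.val ≠ s := fun h => hj (Fin.ext h)
    simp [this]
  · simp

/-- All pendent vertices hang on a central vertex, so the side of an edge away from it is a bare
piece of the path and must contain `t` path vertices. This leaves the edges with `t ≤ i ≤ k - t`. -/
theorem edgeCount_centralCaterpillar_le (hk : 0 < k) (hkn : k ≤ n) {t : ℕ} (ht : 2 ≤ t) :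
    edgeCount (centralCaterpillar n k ((k + 1) / 2)) t ≤ k + 1 - 2 * t := by
  obtain ⟨s, hs⟩ : ∃ s, (k + 1) / 2 = s + 1 := ⟨(k + 1) / 2 - 1, by omega⟩
  rw [hs, edgeCount_caterpillar hk _ ht, sum_nat_centralCaterpillar (by omega)]
  have : (Finset.Ico t (k + 1 - t)).card = k + 1 - 2 * t := by rw [Nat.card_Ico]; omega
  rw [← this]
  refine Finset.card_le_card fun i hi => ?_
  rw [Finset.mem_filter, Finset.mem_Ico, tailCard_centralCaterpillar (by omega)] at hi
  rw [Finset.mem_Ico]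
  split_ifs at hi <;> omega

end CentralCaterpillar

section PathGraph

theorem caterpillar_iso_pathGraph (n : ℕ) : Nonempty (doubleStarPath n 0 0 ≃g pathGraph n) := by
  have : ∀ i : Fin n, IsEmpty (Fin ((if i.val = 0 then 0 else 0) +
      (if i.val + 1 = n then 0 else 0))) := fun i => ⟨fun j => by
    have := j.isLt
    simp at this⟩
  have : IsEmpty (Σ i : Fin n, Fin ((if i.val = 0 then 0 else 0) +
      (if i.val + 1 = n then 0 else 0))) := ⟨fun p => (this p.1).false p.2⟩
  exact ⟨⟨Equiv.sumEmpty _ _, by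
    rintro (i | p) (j | q)
    · rfl
    all_goals exact (this.false (by assumption)).elim⟩⟩

end PathGraph

end TreeIndices

namespace TreeIndices

open SimpleGraph Classical

/-! ### Upper bounds for edge counts -/

section Counts

variable {V : Type} [Fintype V] {T : SimpleGraph V}

theorem edgeSum_le {g : V → V → ℝ} {hg : ∀ u v, g u v = g v u} {c : ℝ}
    (h : ∀ u v, T.Adj u v → g u v ≤ c) : edgeSum T g hg ≤ T.edgeFinset.card * c := by
  rw [edgeSum, ← nsmul_eq_mul]
  refine Finset.sum_le_card_nsmul _ _ _ fun e => ?_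
  induction e with
  | _ a b =>
    intro he
    rw [mem_edgeFinset, mem_edgeSet] at he
    exact h a b he

theorem card_sub_lt (hT : T.Connected) {r x y : V} (h : y ∈ sub T r x) (hne : y ≠ x) :
    (sub T r y).card < (sub T r x).card :=
  Finset.card_lt_card (sub_ssubset hT h hne)

theorem sub_leaf (hT : T.IsTree) {r x : V} (hx : T.degree x = 1) (hr : x ≠ r) :
    sub T r x = {x} := by
  ext y
  rw [Finset.mem_singleton]
  constructor
  · intro hy
    by_contra hne
    rw [mem_sub, dist_par hT.connected hr,
      dist_leaf hT hx (par_adj hT.connected hr) hne] at hy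
    have := hT.connected.dist_triangle (u := r) (v := par T r x) (w := y)
    omega
  · rintro rfl
    exact self_mem_sub

theorem exists_mem_sub_card_eq_one (hT : T.Connected) (r x : V) :
    ∃ z ∈ sub T r x, (sub T r z).card = 1 := by
  obtain ⟨z, hz, hmin⟩ := Finset.exists_min_image (sub T r x) (fun z => (sub T r z).card)
    ⟨x, self_mem_sub⟩
  refine ⟨z, hz, ?_⟩
  rw [Finset.card_eq_one]
  refine ⟨z, ?_⟩
  ext w
  rw [Finset.mem_singleton]
  constructor
  · intro hw
    by_contra hne
    have h1 := hmin w (sub_subset hT hz hw)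
    have h2 := card_sub_lt hT hw hne
    omega
  · rintro rfl
    exact self_mem_sub

theorem eq_of_mem_sub_adj (hT : T.IsTree) {r b b' w : V} (hb : T.Adj r b) (hb' : T.Adj r b')
    (h : w ∈ sub T r b) (h' : w ∈ sub T r b') : b = b' := by
  have d1 : T.dist r b = 1 := dist_eq_one_iff_adj.2 hb
  have d2 : T.dist r b' = 1 := dist_eq_one_iff_adj.2 hb'
  have := mem_sub_of_le hT h h' (by omega)
  rw [mem_sub] at this
  exact hT.connected.dist_eq_zero_iff.1 (by omega)

theorem exists_branch (hT : T.IsTree) {r x : V} (h : x ≠ r) :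
    ∃ b, T.Adj r b ∧ x ∈ sub T r b := by
  refine ⟨par T x r, par_adj hT.connected h.symm, ?_⟩
  have := dist_par hT.connected h.symm
  have h1 : T.dist r (par T x r) = 1 := dist_eq_one_iff_adj.2 (par_adj hT.connected h.symm)
  rw [mem_sub, T.dist_comm (u := r) (v := x), T.dist_comm (v := x)]
  omega

/-- Among the oriented edges with at least `t` vertices on both sides, take one, from `u` to `v`,
with fewest vertices on the side of `u`. Rooted at `u`, all edges to be counted have their lower end
below `v` or equal to it. If `x₀` is the lower end of the lightest one, the other lower ends avoid
the at least `t` vertices below `x₀`, and at most `n - t` vertices lie below `v`. -/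
theorem edgeCount_add_le (hT : T.IsTree) {t : ℕ} :
    edgeCount T t = 0 ∨ edgeCount T t + 2 * t ≤ Fintype.card V + 1 := by
  rcases Nat.eq_zero_or_pos (edgeCount T t) with h0 | hpos
  · exact Or.inl h0
  right
  obtain ⟨r⟩ := hT.connected.nonempty
  have hpos' := hpos
  rw [edgeCount_eq hT r] at hpos'
  obtain ⟨x, hx⟩ := Finset.card_pos.1 hpos'
  rw [Finset.mem_filter] at hx
  have hxr := Finset.ne_of_mem_erase hx.1
  let P : Finset (V × V) := Finset.univ.filter fun e => T.Adj e.1 e.2 ∧ t ≤ sideCard T e.1 e.2 ∧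
    sideCard T e.1 e.2 + t ≤ Fintype.card V
  have hP : P.Nonempty := ⟨(x, par T r x), by
    simp only [P, Finset.mem_filter, Finset.mem_univ, true_and]
    rw [sideCard_par hT hxr]
    exact ⟨par_adj hT.connected hxr, hx.2⟩⟩
  obtain ⟨⟨u, v⟩, huv, hmin⟩ := Finset.exists_min_image P (fun e => sideCard T e.1 e.2) hP
  simp only [P, Finset.mem_filter, Finset.mem_univ, true_and, Prod.forall] at huv hmin
  obtain ⟨hadj, hu1, hu2⟩ := huv
  have d1 : T.dist u v = 1 := dist_eq_one_iff_adj.2 hadj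
  have hsv : side T v u = sub T u v := side_eq_sub hT hadj.symm (by rw [d1, T.dist_self])
  have hvc : (sub T u v).card + sideCard T u v = Fintype.card V := by
    rw [← hsv, add_comm]
    exact sideCard_add hT hadj
  rw [edgeCount_eq hT u] at hpos ⊢
  set E := (Finset.univ.erase u).filter fun x =>
      t ≤ (sub T u x).card ∧ (sub T u x).card + t ≤ Fintype.card V with hE
  obtain ⟨x₀, hx₀, hmin₀⟩ := Finset.exists_min_image E (fun x => (sub T u x).card)
    (Finset.card_pos.1 hpos)
  have hmem : ∀ x ∈ E, x ≠ u ∧ t ≤ (sub T u x).card ∧ (sub T u x).card + t ≤ Fintype.card V := by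
    intro x hx
    rw [hE, Finset.mem_filter] at hx
    exact ⟨Finset.ne_of_mem_erase hx.1, hx.2⟩
  have hsub : ∀ x ∈ E, x ∈ sub T u v := by
    intro x hx
    obtain ⟨hxu, h1, h2⟩ := hmem x hx
    by_contra hcon
    -- Otherwise the branch of `x` would be a proper part of the side of `u` and would contradict
    -- the choice of that side.
    have hdisj : sub T u x ⊂ side T u v := by
      refine (Finset.ssubset_iff_of_subset ?_).2 ⟨u, ?_, root_notMem_sub hT.connected hxu⟩
      · intro w hw
        rw [← side_compl hT hadj.symm, Finset.mem_compl, hsv]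
        intro hw'
        have := hT.connected.pos_dist_of_ne hxu.symm
        exact hcon (mem_sub_of_le hT hw' hw (by omega))
      · rw [mem_side, T.dist_self, d1]
        exact one_pos
    have h3 := Finset.card_lt_card hdisj
    have h4 := hmin x (par T u x) ⟨par_adj hT.connected hxu, by rwa [sideCard_par hT hxu],
      by rwa [sideCard_par hT hxu]⟩
    rw [sideCard_par hT hxu] at h4
    rw [sideCard] at h4
    omega
  have hss : E.erase x₀ ⊆ sub T u v \ sub T u x₀ := by
    intro x hx
    rw [Finset.mem_erase] at hx
    rw [Finset.mem_sdiff]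
    refine ⟨hsub x hx.2, fun h => ?_⟩
    have h1 := card_sub_lt hT.connected h hx.1
    have h2 := hmin₀ x hx.2
    omega
  have h1 := Finset.card_le_card hss
  rw [Finset.card_erase_of_mem hx₀, Finset.card_sdiff_of_subset
    (sub_subset hT.connected (hsub x₀ hx₀))] at h1
  have h2 := (hmem x₀ hx₀).2.1
  have h3 := Finset.card_le_card (sub_subset hT.connected (hsub x₀ hx₀))
  omega

/-- Rooted at `c`, the following sets are disjoint: the counted lower ends other than the lightest
one `x₀`, the at least `t` vertices below `x₀`, the root, and one leaf in each of the `deg c - 1`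
branches that do not contain `x₀`. Leaves are not counted since `t ≥ 2`. -/
theorem edgeCount_add_degree_le (hT : T.IsTree) (c : V) {t : ℕ} (ht : 2 ≤ t) :
    edgeCount T t = 0 ∨ edgeCount T t + t + T.degree c ≤ Fintype.card V + 1 := by
  rcases Nat.eq_zero_or_pos (edgeCount T t) with h0 | hpos
  · exact Or.inl h0
  right
  rw [edgeCount_eq hT c] at hpos ⊢
  set E := (Finset.univ.erase c).filter fun x =>
      t ≤ (sub T c x).card ∧ (sub T c x).card + t ≤ Fintype.card V with hE
  have hmem : ∀ x ∈ E, x ≠ c ∧ t ≤ (sub T c x).card := by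
    intro x hx
    rw [hE, Finset.mem_filter] at hx
    exact ⟨Finset.ne_of_mem_erase hx.1, hx.2.1⟩
  obtain ⟨x₀, hx₀, hmin₀⟩ := Finset.exists_min_image E (fun x => (sub T c x).card)
    (Finset.card_pos.1 hpos)
  obtain ⟨b₀, hb₀, hxb⟩ := exists_branch hT (hmem x₀ hx₀).1
  choose ℓ hℓ hℓ1 using exists_mem_sub_card_eq_one hT.connected c
  let Z := ((T.neighborFinset c).erase b₀).image ℓ
  have hZmem : ∀ z ∈ Z, ∃ b, T.Adj c b ∧ b ≠ b₀ ∧ z = ℓ b := by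
    intro z hz
    simp only [Z, Finset.mem_image, Finset.mem_erase, mem_neighborFinset] at hz
    obtain ⟨b, hb, rfl⟩ := hz
    exact ⟨b, hb.2, hb.1, rfl⟩
  have hZ : Z.card + 1 = T.degree c := by
    rw [Finset.card_image_of_injOn, Finset.card_erase_add_one (by simpa using hb₀),
      card_neighborFinset_eq_degree]
    intro b hb b' hb' h
    rw [Finset.mem_coe, Finset.mem_erase, mem_neighborFinset] at hb hb'
    exact eq_of_mem_sub_adj hT hb.2 hb'.2 (hℓ b) (h ▸ hℓ b')
  have hd1 : Disjoint (E.erase x₀) (sub T c x₀) := by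
    rw [Finset.disjoint_left]
    intro x hx h
    rw [Finset.mem_erase] at hx
    have h1 := card_sub_lt hT.connected h hx.1
    have h2 := hmin₀ x hx.2
    omega
  have hd2 : Disjoint (E.erase x₀ ∪ sub T c x₀) (insert c Z) := by
    rw [Finset.disjoint_left]
    intro x hx h
    rw [Finset.mem_insert] at h
    rw [Finset.mem_union, Finset.mem_erase] at hx
    rcases h with rfl | h
    · rcases hx with hx | hx
      · exact (hmem x hx.2).1 rfl
      · exact root_notMem_sub hT.connected (hmem x₀ hx₀).1 hx
    · obtain ⟨b, hb, hne, rfl⟩ := hZmem x h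
      rcases hx with hx | hx
      · have := (hmem _ hx.2).2
        rw [hℓ1] at this
        omega
      · exact hne (eq_of_mem_sub_adj hT hb hb₀ (hℓ b) (sub_subset hT.connected hxb hx))
  have hc : c ∉ Z := by
    intro h
    obtain ⟨b, hb, _, hcb⟩ := hZmem c h
    exact root_notMem_sub hT.connected hb.ne' (hcb ▸ hℓ b)
  have h1 := Finset.card_le_univ ((E.erase x₀ ∪ sub T c x₀) ∪ insert c Z)
  rw [Finset.card_union_of_disjoint hd2, Finset.card_union_of_disjoint hd1,
    Finset.card_insert_of_notMem hc, Finset.card_erase_of_mem hx₀] at h1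
  have := (hmem x₀ hx₀).2
  omega

/-- With a root outside `L`, neither the root nor a vertex of `L` is the lower end of a counted
edge. -/
theorem edgeCount_add_leaves_le (hT : T.IsTree) {L : Finset V} (hL : ∀ x ∈ L, T.degree x = 1)
    (hne : ∃ x, x ∉ L) {t : ℕ} (ht : 2 ≤ t) : edgeCount T t + L.card + 1 ≤ Fintype.card V := by
  obtain ⟨r, hr⟩ := hne
  rw [edgeCount_eq hT r]
  set E := (Finset.univ.erase r).filter fun x =>
      t ≤ (sub T r x).card ∧ (sub T r x).card + t ≤ Fintype.card V with hE
  have hd : Disjoint E (insert r L) := by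
    rw [Finset.disjoint_left]
    intro x hx h
    rw [hE, Finset.mem_filter] at hx
    have hxr := Finset.ne_of_mem_erase hx.1
    rw [Finset.mem_insert] at h
    rcases h with h | h
    · exact hxr h
    · have := hx.2.1
      rw [sub_leaf hT (hL x h) hxr, Finset.card_singleton] at this
      omega
  have h1 := Finset.card_le_univ (E ∪ insert r L)
  rw [Finset.card_union_of_disjoint hd, Finset.card_insert_of_notMem hr] at h1
  omega

end Counts

/-- The path has the largest distance sums and edge counts among the trees of its order. -/
theorem majorized_path {V : Type} [Fintype V] {T : SimpleGraph V} (hT : T.IsTree) {n : ℕ}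
    (hn : Fintype.card V = n) : Majorized T (doubleStarPath n 0 0) := by
  have hpos : 0 < n := hn ▸ Fintype.card_pos_iff.2 hT.connected.nonempty
  have hsum : ∀ α, distSum (wt α) (doubleStarPath n 0 0) = pathSum (wt α) n := by
    intro α
    rw [distSum_doubleStarPath hpos (wt_zero α)]
    simp
  refine ⟨fun α hα => ?_, fun α hα h => ?_, fun t ht => ?_⟩
  · rw [hsum]
    exact distSum_le_pathSum (wt_zero α) (wt_strictMono hα).monotone n V T hT hn
  · rw [hsum] at h
    obtain ⟨p, hp⟩ := exists_path_of_distSum_eq (wt_zero α) (wt_strictMono hα) hT hn h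
    have hinj : Function.Injective fun i : Fin n => p i := by
      intro i j hij
      have := hp i j i.isLt j.isLt
      simp only at hij
      rw [hij, T.dist_self] at this
      exact Fin.ext (by omega)
    have hsurj := ((Fintype.bijective_iff_injective_and_card _).2 ⟨hinj, by simp [hn]⟩).2
    refine nonempty_iso_caterpillar hT hinj ?_ (J := fun _ => ⟨0, hpos⟩) ?_ ?_
    · intro i j hij
      rw [← dist_eq_one_iff_adj, hp i j i.isLt j.isLt]
      omega
    · exact fun x hx => absurd (hsurj x) hx
    · intro i
      have : IsEmpty {x // x ∉ Set.range (fun i : Fin n => p i) ∧ (⟨0, hpos⟩ : Fin n) = i} :=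
        ⟨fun x => x.2.1 (hsurj x.1)⟩
      rw [Nat.card_of_isEmpty]
      simp
  · have h1 := edgeCount_add_le hT (t := t)
    have h2 := le_edgeCount_doubleStarPath (a := 0) (b := 0) hpos ht
    omega

end TreeIndices

namespace TreeIndices
open SimpleGraph Classical

/-! ### Recognition of double star paths -/

section EndCaterpillar

variable {V : Type} [Fintype V] {T : SimpleGraph V}

/-- A tree with a path to whose ends all other vertices are attached is a double star path. -/
theorem exists_iso_doubleStarPath (hT : T.IsTree) {k : ℕ} (hk : 2 ≤ k) {p : Fin k → V}
    (hp : Function.Injective p) (hadj : ∀ i j : Fin k, i.val + 1 = j.val → T.Adj (p i) (p j))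
    (hend : ∀ x, x ∉ Set.range p →
      T.Adj x (p ⟨0, by omega⟩) ∨ T.Adj x (p ⟨k - 1, by omega⟩)) :
    ∃ a b : ℕ, Nonempty (T ≃g doubleStarPath k a b) := by
  set J : V → Fin k := fun x =>
    if T.Adj x (p ⟨0, by omega⟩) then ⟨0, by omega⟩ else ⟨k - 1, by omega⟩ with hJdef
  have hJ : ∀ x, x ∉ Set.range p → T.Adj x (p (J x)) := by
    intro x hx
    simp only [hJdef]
    split_ifs with h
    · exact h
    · exact (hend x hx).resolve_left h
  refine ⟨Nat.card {x // x ∉ Set.range p ∧ J x = ⟨0, by omega⟩},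
    Nat.card {x // x ∉ Set.range p ∧ J x = ⟨k - 1, by omega⟩},
    nonempty_iso_caterpillar hT hp hadj hJ fun i => ?_⟩
  by_cases h0 : i.val = 0
  · have hi : i = ⟨0, by omega⟩ := Fin.ext h0
    rw [if_pos h0, if_neg (by omega), add_zero, hi]
  · by_cases h1 : i.val + 1 = k
    · have hi : i = ⟨k - 1, by omega⟩ := Fin.ext (by simp only; omega)
      rw [if_neg h0, if_pos h1, zero_add, hi]
    · rw [if_neg h0, if_neg h1]
      have : IsEmpty {x // x ∉ Set.range p ∧ J x = i} := by
        refine ⟨fun x => ?_⟩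
        have := x.2.2
        simp only [hJdef] at this
        have hv := congrArg Fin.val this
        split_ifs at hv <;> simp only at hv <;> omega
      rw [Nat.card_of_isEmpty]

theorem eq_or_swap_of_add_mul {a b c d : ℕ} (h : a + b = c + d) (h' : a * b = c * d) :
    (a = c ∧ b = d) ∨ (a = d ∧ b = c) := by
  have h1 : (a : ℤ) + b = c + d := by exact_mod_cast h
  have h2 : (a : ℤ) * b = c * d := by exact_mod_cast h'
  have h3 : ((a : ℤ) - c) * (a - d) = 0 := by
    have : (b : ℤ) = c + d - a := by omega
    rw [this] at h2
    linarith
  rcases mul_eq_zero.1 h3 with h | h <;> omega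

/-- For fixed `k` and `a + b`, the distance sum is a constant plus `2ab (g (k+1) - g 2)`. It
therefore determines the product `ab`, and with the sum the unordered pair `{a, b}`. -/
theorem nonempty_iso_doubleStarPath (hT : T.IsTree) {k a b : ℕ} (hk : 2 ≤ k) {p : Fin k → V}
    (hp : Function.Injective p) (hadj : ∀ i j : Fin k, i.val + 1 = j.val → T.Adj (p i) (p j))
    (hend : ∀ x, x ∉ Set.range p →
      T.Adj x (p ⟨0, by omega⟩) ∨ T.Adj x (p ⟨k - 1, by omega⟩))
    (hn : Fintype.card V = k + (a + b)) {g : ℕ → ℝ} (h0 : g 0 = 0) (hg : StrictMono g)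
    (heq : distSum g T = distSum g (doubleStarPath k a b)) :
    Nonempty (T ≃g doubleStarPath k a b) := by
  obtain ⟨c, d, ⟨e⟩⟩ := exists_iso_doubleStarPath hT hk hp hadj hend
  have hcard := Fintype.card_congr e.toEquiv
  rw [hn, card_doubleStarPath (by omega)] at hcard
  have hs : a + b = c + d := by omega
  rw [distSum_iso e, distSum_doubleStarPath (by omega) h0,
    distSum_doubleStarPath (by omega) h0] at heq
  have hlt : g 2 < g (k + 1) := hg (by omega)
  have hs' : (a : ℝ) + b = c + d := by exact_mod_cast hs
  have hm : (a : ℝ) * b = c * d := by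
    have : ((a : ℝ) * b - c * d) * (g (k + 1) - g 2) = 0 := by
      have h1 : (c : ℝ) = a + b - d := by linarith
      rw [h1] at heq ⊢
      linarith
    rcases mul_eq_zero.1 this with h | h <;> linarith
  rcases eq_or_swap_of_add_mul hs (by exact_mod_cast hm) with ⟨rfl, rfl⟩ | ⟨rfl, rfl⟩
  · exact ⟨e⟩
  · obtain ⟨e'⟩ := doubleStarPath_symm (k := k) (a := b) (b := a) (by omega)
    exact ⟨e.trans e'⟩

end EndCaterpillar

/-! ### The maximum for a given number of leaves -/

section Leaves

variable {V : Type} [Fintype V] {T : SimpleGraph V}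

/-- The contribution of a set of leaves to the distance sum, in terms of the tree without them. -/
theorem exists_foot (hT : T.IsTree) {L : Finset V} (hL : ∀ x ∈ L, T.degree x = 1)
    (hne : ∃ x, x ∉ L) : ∃ J : {x // x ∈ L} → {y // y ∉ L}, (∀ x, T.Adj x.1 (J x).1) ∧
      ∀ g : ℕ → ℝ, g 0 = 0 → distSum g T = distSum g (prune T L) +
        2 * ∑ x, ∑ y, g (1 + (prune T L).dist (J x) y) +
        (∑ x, ∑ y, g (2 + (prune T L).dist (J x) (J y)) - (L.card : ℝ) * g 2) := by
  have hex : ∀ x : {x // x ∈ L}, ∃ u, u ∉ L ∧ T.Adj x.1 u := by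
    rintro ⟨x, hx⟩
    obtain ⟨y, hy⟩ := hne
    have hxy : x ≠ y := fun h => hy (h ▸ hx)
    obtain ⟨u, hu, -⟩ := exists_adj_dist_eq hT.connected hxy
    -- Two adjacent leaves would each be one step farther from `y` than the other.
    refine ⟨u, fun h => ?_, hu⟩
    have h1 := dist_leaf hT (hL x hx) hu hxy.symm
    have h2 := dist_leaf hT (hL u h) hu.symm (fun e : y = u => hy (e ▸ h))
    omega
  choose u hu hadj using hex
  refine ⟨fun x => ⟨u x, hu x⟩, hadj, fun g h0 => ?_⟩
  have hd1 : ∀ (x : {x // x ∈ L}) (y : V), y ≠ x.1 → T.dist x.1 y = 1 + T.dist (u x) y :=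
    fun x y hy => dist_leaf hT (hL _ x.2) (hadj x) hy
  have hd2 : ∀ x y : {x // x ∈ L}, x ≠ y → T.dist x.1 y.1 = 2 + T.dist (u x) (u y) := by
    intro x y hxy
    rw [hd1 x y.1 (fun h => hxy (Subtype.ext h.symm)), T.dist_comm (u := u x),
      hd1 y (u x) (fun h => hu x (h ▸ y.2)), T.dist_comm (u := u y)]
    omega
  rw [distSum_split hT hL g, ← Finset.sum_coe_sort L, ← Finset.sum_coe_sort L]
  congr 1
  · congr 2
    refine Finset.sum_congr rfl fun x _ => Finset.sum_congr rfl fun y _ => ?_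
    rw [dist_prune hT hL, hd1 x y.1 (fun h => y.2 (h ▸ x.2))]
  · have hcard : (L.card : ℝ) * g 2 = ∑ x : {x // x ∈ L}, ∑ y : {x // x ∈ L},
        if x = y then g 2 else 0 := by
      simp
    rw [hcard, ← Finset.sum_sub_distrib]
    refine Finset.sum_congr rfl fun x _ => ?_
    rw [← Finset.sum_coe_sort L, ← Finset.sum_sub_distrib]
    refine Finset.sum_congr rfl fun y _ => ?_
    rw [dist_prune hT hL]
    by_cases hxy : x = y
    · subst hxy
      rw [if_pos rfl, T.dist_self, T.dist_self, h0, add_zero, sub_self]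
    · rw [if_neg hxy, hd2 x y hxy, sub_zero]

theorem sum_dist_succ_le (hT : T.IsTree) {g : ℕ → ℝ} (hg : Monotone g) (u : V) :
    ∑ y, g (1 + T.dist u y) ≤ hsum g (Fintype.card V) := by
  have := sum_levels_le (φ := fun y => T.dist u y) (g := fun m => g (1 + m))
    (fun x m hm => exists_dist_eq hT.connected u x m hm) (fun x y h => hg (by omega))
  refine this.trans (le_of_eq ?_)
  exact Finset.sum_congr rfl fun t _ => by rw [add_comm]

theorem mul_le_halves {x y q : ℕ} (h : x + y = q) : x * y ≤ (q / 2) * ((q + 1) / 2) := by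
  have h1 : q / 2 + (q + 1) / 2 = q := by omega
  have h2 : (q + 1) / 2 = q / 2 ∨ (q + 1) / 2 = q / 2 + 1 := by omega
  generalize q / 2 = s at *
  rcases h2 with h2 | h2 <;> rw [h2] at h1 ⊢ <;> subst h1 <;> zify at h ⊢
  · have : (y : ℤ) = s + s - x := by linarith
    rw [this]
    nlinarith [sq_nonneg ((x : ℤ) - s)]
  · have : (y : ℤ) = s + (s + 1) - x := by linarith
    rw [this]
    have : 0 ≤ ((x : ℤ) - s) * (x - s - 1) := by
      rcases le_or_gt (x : ℤ) s with h' | h'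
      · exact mul_nonneg_of_nonpos_of_nonpos (by linarith) (by linarith)
      · exact mul_nonneg (by linarith) (by linarith)
    nlinarith

/-- By Wiener's formula each of the `n - 1` edges contributes the product of the two parts into
which it splits the points, and this is largest for an even split. -/
theorem sum_dist_points_le (hT : T.IsTree) {ι : Type} [Fintype ι] (u : ι → V) :
    ∑ i, ∑ j, (T.dist (u i) (u j) : ℝ) ≤ 2 * (((Fintype.card V : ℝ) - 1) *
      (((Fintype.card ι / 2 : ℕ) : ℝ) * ((Fintype.card ι + 1) / 2 : ℕ))) := by
  rw [sum_dist_eq_edgeSum hT u]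
  have hc : (T.edgeFinset.card : ℝ) = (Fintype.card V : ℝ) - 1 := by
    have := card_edgeFinset_tree hT
    rw [← this]
    push_cast
    ring
  rw [← hc]
  refine mul_le_mul_of_nonneg_left (edgeSum_le fun x y hxy => ?_) zero_le_two
  have : (Finset.univ.filter fun i => u i ∈ side T x y).card +
      (Finset.univ.filter fun i => u i ∈ side T y x).card = Fintype.card ι := by
    rw [← side_compl hT hxy, ← Finset.card_univ,
      ← Finset.card_filter_add_card_filter_not (s := Finset.univ) fun i => u i ∈ side T x y]
    simp only [Finset.mem_compl]
  exact_mod_cast mul_le_halves this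

/-- Convexity: on `[0, m]` the weight lies below its chord. The inequality is linear in `d`, which
carries bounds for sums of distances over to sums of weights. -/
theorem wt_chord {α : ℝ} (hα : 0 ≤ α) {d m : ℕ} (h : d ≤ m) :
    (m : ℝ) * (wt α (2 + d) - wt α 2) ≤ d * (wt α (m + 2) - wt α 2) := by
  have h' : (d : ℝ) ≤ m := by exact_mod_cast h
  have key : 0 ≤ α * ((d : ℝ) * m * (m - d)) := by
    have := sub_nonneg.2 h'
    positivity
  simp only [wt]
  push_cast
  linarith

theorem sum_wt_leaves_le (hT : T.IsTree) {ι : Type} [Fintype ι] (u : ι → V)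
    (hV : 2 ≤ Fintype.card V) {α : ℝ} (hα : 0 ≤ α) :
    ∑ i, ∑ j, wt α (2 + T.dist (u i) (u j)) ≤ (Fintype.card ι : ℝ) * Fintype.card ι * wt α 2 +
      2 * ((((Fintype.card ι / 2 : ℕ) : ℝ) * ((Fintype.card ι + 1) / 2 : ℕ)) *
        (wt α (Fintype.card V + 1) - wt α 2)) := by
  obtain ⟨m, hm⟩ : ∃ m, Fintype.card V = m + 1 := ⟨Fintype.card V - 1, by omega⟩
  have h1 : ∑ i, ∑ j, (m : ℝ) * (wt α (2 + T.dist (u i) (u j)) - wt α 2) ≤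
      ∑ i, ∑ j, (T.dist (u i) (u j) : ℝ) * (wt α (m + 2) - wt α 2) := by
    refine Finset.sum_le_sum fun i _ => Finset.sum_le_sum fun j _ => wt_chord hα ?_
    have := lt_card_of_levels (φ := fun y => T.dist (u i) y)
      (fun x m hm => exists_dist_eq hT.connected (u i) x m hm) (u j)
    omega
  simp only [← Finset.sum_mul, ← Finset.mul_sum, Finset.sum_sub_distrib, Finset.sum_const,
    Finset.card_univ, nsmul_eq_mul] at h1
  have h2 := sum_dist_points_le hT u
  have h3 : 0 ≤ wt α (m + 2) - wt α 2 :=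
    sub_nonneg.2 ((wt_strictMono hα).monotone (by omega))
  have h4 := mul_le_mul_of_nonneg_right h2 h3
  have hm0 : (0 : ℝ) < m := by
    have : 0 < m := by omega
    exact_mod_cast this
  rw [hm] at h4 ⊢
  push_cast at h4 ⊢
  rw [add_sub_cancel_right] at h4
  refine le_of_mul_le_mul_left ?_ hm0
  rw [add_assoc, one_add_one_eq_two]
  linarith

/-- Among the trees with a given number of leaves, the balanced double star path has the largest
distance sums and edge counts. -/
theorem majorized_doubleStarPath (hT : T.IsTree) {L : Finset V} (hL : ∀ x ∈ L, T.degree x = 1)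
    {k q : ℕ} (hq : L.card = q) (hk : 2 ≤ k) (hn : Fintype.card V = k + q) :
    Majorized T (doubleStarPath k (q / 2) ((q + 1) / 2)) := by
  have hne : ∃ x, x ∉ L := by
    by_contra! h
    have : Finset.univ ⊆ L := fun x _ => h x
    have := Finset.card_le_card this
    rw [Finset.card_univ] at this
    omega
  have hq2 : q / 2 + (q + 1) / 2 = q := by omega
  have hq2' : (((q / 2 : ℕ) : ℝ)) + ((q + 1) / 2 : ℕ) = q := by exact_mod_cast hq2
  have hT' := isTree_prune hT hL hne
  have hk' : Fintype.card {x // x ∉ L} = k := by rw [card_prune]; omega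
  have hc : Fintype.card {x // x ∈ L} = q := by rw [Fintype.card_coe, hq]
  obtain ⟨J, hadj, hdist⟩ := exists_foot hT hL hne
  have hb1 : ∀ α, 0 ≤ α → distSum (wt α) (prune T L) ≤ pathSum (wt α) k := fun α hα =>
    distSum_le_pathSum (wt_zero α) (wt_strictMono hα).monotone k _ _ hT' hk'
  have hb2 : ∀ α, 0 ≤ α → ∀ x, ∑ y, wt α (1 + (prune T L).dist (J x) y) ≤ hsum (wt α) k := by
    intro α hα x
    have := sum_dist_succ_le hT' (wt_strictMono hα).monotone (J x)
    rwa [hk'] at this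
  have hb2' : ∀ α, 0 ≤ α →
      ∑ x, ∑ y, wt α (1 + (prune T L).dist (J x) y) ≤ (q : ℝ) * hsum (wt α) k := by
    intro α hα
    have := Finset.sum_le_sum fun x (_ : x ∈ Finset.univ) => hb2 α hα x
    rwa [Finset.sum_const, Finset.card_univ, hc, nsmul_eq_mul] at this
  have hb3 : ∀ α, 0 ≤ α → ∑ x, ∑ y, wt α (2 + (prune T L).dist (J x) (J y)) ≤
      (q : ℝ) * q * wt α 2 + 2 * ((((q / 2 : ℕ) : ℝ) * ((q + 1) / 2 : ℕ)) *
        (wt α (k + 1) - wt α 2)) := by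
    intro α hα
    have := sum_wt_leaves_le hT' J (by omega) hα
    rwa [hk', hc] at this
  have hH : ∀ α, distSum (wt α) (doubleStarPath k (q / 2) ((q + 1) / 2)) =
      pathSum (wt α) k + 2 * (q * hsum (wt α) k) + ((q : ℝ) * q * wt α 2 +
        2 * ((((q / 2 : ℕ) : ℝ) * ((q + 1) / 2 : ℕ)) * (wt α (k + 1) - wt α 2)) -
          (q : ℝ) * wt α 2) := by
    intro α
    rw [distSum_doubleStarPath (by omega) (wt_zero α), ← hq2']
    ring
  refine ⟨fun α hα => ?_, fun α hα heq => ?_, fun t ht => ?_⟩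
  · rw [hH, hdist _ (wt_zero α), hq]
    linarith [hb1 α hα, hb2' α hα, hb3 α hα]
  · have heq' := heq
    rw [hH, hdist _ (wt_zero α), hq] at heq
    have h1 := hb1 α hα
    have h2 := hb2' α hα
    have h3 := hb3 α hα
    -- Each of the three parts is bounded separately, so equality of the totals makes all three
    -- bounds sharp. The first one turns the pruned tree into a path.
    obtain ⟨p, hp⟩ := exists_path_of_distSum_eq (wt_zero α) (wt_strictMono hα) hT' hk'
      (by linarith)
    have hJ : ∀ x, ∑ y, wt α (1 + (prune T L).dist (J x) y) = hsum (wt α) k := by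
      have h4 : ∑ x, ∑ y, wt α (1 + (prune T L).dist (J x) y) =
          ∑ x : {x // x ∈ L}, hsum (wt α) k := by
        rw [Finset.sum_const, Finset.card_univ, hc, nsmul_eq_mul]
        linarith
      intro x
      exact (Finset.sum_eq_sum_iff_of_le fun x _ => hb2 α hα x).1 h4 x (Finset.mem_univ x)
    have hinj : Function.Injective fun i : Fin k => p i := by
      intro i j hij
      have := hp i j i.isLt j.isLt
      simp only at hij
      rw [hij, (prune T L).dist_self] at this
      exact Fin.ext (by omega)
    have hbij := (Fintype.bijective_iff_injective_and_card _).2 ⟨hinj, by simp [hk']⟩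
    -- A foot inside the path would give a strictly smaller sum, by strict convexity of `hsum`.
    have hends : ∀ x, J x = p 0 ∨ J x = p (k - 1) := by
      intro x
      obtain ⟨j, hj⟩ := hbij.2 (J x)
      simp only at hj
      have h5 := hJ x
      rw [← hj, ← Function.Bijective.sum_comp hbij
        (fun y => wt α (1 + (prune T L).dist (p j) y))] at h5
      have h6 : ∑ i : Fin k, wt α (1 + (prune T L).dist (p j) (p i)) =
          ∑ i ∈ Finset.range k, wt α (1 + ((i - j.val) + (j.val - i))) := by
        rw [← Fin.sum_univ_eq_sum_range (fun i => wt α (1 + ((i - j.val) + (j.val - i))))]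
        refine Finset.sum_congr rfl fun i _ => ?_
        rw [hp _ _ j.isLt i.isLt, add_comm (j.val - i.val)]
      rw [h6, sum_range_dist_succ _ j.isLt] at h5
      by_contra! hcon
      have hj0 : j.val ≠ 0 := fun h => hcon.1 (by rw [← hj, h])
      have hj1 : j.val ≠ k - 1 := fun h => hcon.2 (by rw [← hj, h])
      have hjk := j.isLt
      have := hsum_add_lt (wt_strictMono hα) (x := 1) (y := k) (u := j.val + 1)
        (v := k - j.val) (by omega) (by omega) (by omega)
      rw [hsum_one] at this
      linarith
    refine nonempty_iso_doubleStarPath hT hk (p := fun i => (p i).1)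
      (fun i j h => hinj (Subtype.ext h)) ?_ ?_ (by omega) (wt_zero α) (wt_strictMono hα) heq'
    · intro i j hij
      rw [← dist_eq_one_iff_adj, ← dist_prune hT hL, hp i j i.isLt j.isLt]
      omega
    · intro x hx
      have hxL : x ∈ L := by
        by_contra h
        obtain ⟨i, hi⟩ := hbij.2 ⟨x, h⟩
        exact hx ⟨i, congrArg Subtype.val hi⟩
      have := hadj ⟨x, hxL⟩
      rcases hends ⟨x, hxL⟩ with h | h <;> rw [h] at this
      · exact Or.inl this
      · exact Or.inr this
  -- The count of the double star path is the smaller of the bounds `n + 1 - 2t` and `k - 1`; the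
  -- near equality of the two ends is what excludes intermediate values.
  · have h1 := edgeCount_add_le hT (t := t)
    have h2 := edgeCount_add_leaves_le hT hL hne ht
    have h3 := le_edgeCount_doubleStarPath (k := k) (a := q / 2) (b := (q + 1) / 2)
      (by omega) ht
    omega

end Leaves

end TreeIndices

namespace TreeIndices
open SimpleGraph Classical

/-! ### The maximum for a given degree -/

section Degree

variable {V : Type} [Fintype V] {T : SimpleGraph V}

theorem degree_prune {L : Finset V} (c : {x // x ∉ L}) (h : ∀ y ∈ L, ¬ T.Adj c.1 y) :
    (prune T L).degree c = T.degree c.1 := by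
  rw [← card_neighborFinset_eq_degree, ← card_neighborFinset_eq_degree]
  refine Finset.card_bij (fun y _ => y.1) ?_ (fun _ _ _ _ e => Subtype.ext e) ?_
  · intro y hy
    rw [mem_neighborFinset] at hy ⊢
    exact hy
  · intro y hy
    rw [mem_neighborFinset] at hy
    exact ⟨⟨y, fun hL => h y hL hy⟩, by rw [mem_neighborFinset]; exact hy, rfl⟩

theorem dist_ne_of_adj (hT : T.IsTree) {x y : V} (h : T.Adj x y) (c : V) :
    T.dist c x ≠ T.dist c y := by
  by_cases hc : c ∈ side T x y
  · have := mem_side.1 hc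
    omega
  · have h1 : c ∈ side T y x := by
      rw [← side_compl hT h, Finset.mem_compl]
      exact hc
    have := mem_side.1 h1
    omega

theorem dist_eq_two_of_adj (hT : T.IsTree) {c x y : V} (hx : T.Adj c x) (hy : T.Adj c y)
    (hxy : x ≠ y) : T.dist x y = 2 := by
  have h1 : T.dist x y ≤ T.dist x c + T.dist c y := hT.connected.dist_triangle
  rw [dist_eq_one_iff_adj.2 hx.symm, dist_eq_one_iff_adj.2 hy] at h1
  have h2 := hT.connected.pos_dist_of_ne hxy
  have h3 : T.dist x y ≠ 1 := by
    intro h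
    refine dist_ne_of_adj hT (dist_eq_one_iff_adj.1 h) c ?_
    rw [dist_eq_one_iff_adj.2 hx, dist_eq_one_iff_adj.2 hy]
  omega

/-- A geodesic misses all but two of the neighbours of a vertex. -/
theorem dist_add_degree_le (hT : T.IsTree) (c u v : V) :
    T.dist u v + T.degree c ≤ Fintype.card V + 1 := by
  obtain ⟨p, -, -, hp⟩ := exists_geodesic hT.connected (u := u) (v := v) rfl
  set m := T.dist u v
  have hinj : Set.InjOn p (Finset.range (m + 1)) := by
    intro i hi j hj hij
    simp only [Finset.coe_range, Set.mem_Iio] at hi hj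
    have := hp i j (by omega) (by omega)
    rw [hij, T.dist_self] at this
    omega
  set P := (Finset.range (m + 1)).image p with hP
  have hPcard : P.card = m + 1 := by
    rw [hP, Finset.card_image_of_injOn hinj, Finset.card_range]
  have hint : (P ∩ T.neighborFinset c).card ≤ 2 := by
    by_contra! h
    obtain ⟨x, y, z, hx, hy, hz, hxy, hxz, hyz⟩ := Finset.two_lt_card_iff.1 h
    simp only [hP, Finset.mem_inter, Finset.mem_image, Finset.mem_range,
      mem_neighborFinset] at hx hy hz
    obtain ⟨⟨i, hi, rfl⟩, hx⟩ := hx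
    obtain ⟨⟨j, hj, rfl⟩, hy⟩ := hy
    obtain ⟨⟨l, hl, rfl⟩, hz⟩ := hz
    -- Three neighbours of `c` are pairwise at distance `2`, which is impossible for three points of
    -- a geodesic.
    have h1 := dist_eq_two_of_adj hT hx hy hxy
    have h2 := dist_eq_two_of_adj hT hx hz hxz
    have h3 := dist_eq_two_of_adj hT hy hz hyz
    rw [hp _ _ (by omega) (by omega)] at h1 h2 h3
    omega
  have h1 := Finset.card_union_add_card_inter P (T.neighborFinset c)
  have h2 := Finset.card_le_univ (P ∪ T.neighborFinset c)
  rw [card_neighborFinset_eq_degree, hPcard] at h1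
  omega

/-- If there are more than `T.degree c + 1` vertices, then there is a leaf away from `c`. -/
theorem exists_far_leaf (hT : T.IsTree) {c : V} (h : T.degree c + 1 < Fintype.card V) :
    ∃ v, T.degree v = 1 ∧ v ≠ c ∧ ¬ T.Adj c v := by
  obtain ⟨v, -, hv⟩ := Finset.exists_max_image Finset.univ (fun y => T.dist c y)
    ⟨c, Finset.mem_univ c⟩
  have hfar : ∃ y, 2 ≤ T.dist c y := by
    by_contra! hcon
    have : Finset.univ ⊆ insert c (T.neighborFinset c) := by
      intro y _
      rw [Finset.mem_insert, mem_neighborFinset, ← dist_eq_one_iff_adj]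
      have := hcon y
      rcases Nat.eq_zero_or_pos (T.dist c y) with h0 | h0
      · exact Or.inl ((hT.connected.dist_eq_zero_iff).1 h0).symm
      · exact Or.inr (by omega)
    have := Finset.card_le_card this
    have h2 := Finset.card_insert_le c (T.neighborFinset c)
    rw [card_neighborFinset_eq_degree] at h2
    rw [Finset.card_univ] at this
    omega
  obtain ⟨y, hy⟩ := hfar
  have hv2 : 2 ≤ T.dist c v := hy.trans (hv y (Finset.mem_univ y))
  have hvc : v ≠ c := by
    rintro rfl
    rw [T.dist_self] at hv2
    omega
  refine ⟨v, ?_, hvc, fun hadj => ?_⟩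
  · rw [← card_neighborFinset_eq_degree, Finset.card_eq_one]
    refine ⟨par T c v, Finset.ext fun w => ?_⟩
    rw [mem_neighborFinset, Finset.mem_singleton]
    constructor
    · intro hw
      refine eq_par hT hw ?_
      have h1 := dist_ne_of_adj hT hw c
      have h2 := hv w (Finset.mem_univ w)
      have h3 := hw.diff_dist_adj (u := c)
      omega
    · rintro rfl
      exact par_adj hT.connected hvc
  · rw [dist_eq_one_iff_adj.2 hadj] at hv2
    omega

theorem sum_range_min {g : ℕ → ℝ} (h0 : g 0 = 0) (k d : ℕ) :
    ∑ m ∈ Finset.range (k + 2 + (d + 1)), g (min m (k + 2)) =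
      hsum g (k + 1) + (d + 1) * g (k + 2) := by
  rw [Finset.sum_range_add, ← sum_range_eq_hsum h0 (k + 1)]
  congr 1
  · refine Finset.sum_congr rfl fun m hm => ?_
    rw [Finset.mem_range] at hm
    rw [min_eq_left (by omega)]
  · rw [Finset.sum_congr rfl fun m _ => by rw [min_eq_right (by omega : k + 2 ≤ k + 2 + m)]]
    simp

theorem monotone_min {g : ℕ → ℝ} (hg : Monotone g) (M : ℕ) : Monotone fun m => g (min m M) :=
  fun _ _ h => hg (min_le_min_right M h)

theorem sum_min_dist (hT : T.IsTree) {c : V} {d k : ℕ} (hc : T.degree c = d + 2)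
    (hn : Fintype.card V = d + 2 + (k + 1)) (v : V) (g : ℕ → ℝ) :
    ∑ y, g (T.dist v y) = ∑ y, g (min (T.dist v y) (k + 2)) := by
  refine Finset.sum_congr rfl fun y _ => ?_
  have := dist_add_degree_le hT c v y
  rw [min_eq_left (by omega)]

/-- No distance exceeds `n + 1 - deg c = k + 2`, so the level estimate may be applied to the weight
`g (min m (k + 2))`. The first `k + 2` levels are then best taken as singletons, with all other
vertices at the cap. -/
theorem sum_dist_le_of_degree (hT : T.IsTree) {c : V} {d k : ℕ} (hc : T.degree c = d + 2)
    (hn : Fintype.card V = d + 2 + (k + 1)) (v : V) {g : ℕ → ℝ} (h0 : g 0 = 0)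
    (hg : Monotone g) : ∑ y, g (T.dist v y) ≤ hsum g (k + 1) + (d + 1) * g (k + 2) := by
  rw [sum_min_dist hT hc hn, ← sum_range_min h0]
  have := sum_levels_le (φ := fun y => T.dist v y) (g := fun m => g (min m (k + 2)))
    (fun x m hm => exists_dist_eq hT.connected v x m hm) (monotone_min hg _)
  rwa [show k + 2 + (d + 1) = Fintype.card V by omega]

theorem distSum_doubleStarPath_one {g : ℕ → ℝ} (h0 : g 0 = 0) {k : ℕ} (hk : 0 < k) (d : ℕ) :
    distSum g (doubleStarPath (k + 1) 1 (d + 1)) = distSum g (doubleStarPath k 1 (d + 1)) +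
      2 * (hsum g (k + 1) + (d + 1) * g (k + 2)) := by
  rw [distSum_doubleStarPath (by omega) h0, distSum_doubleStarPath hk h0, pathSum_succ h0,
    hsum_succ]
  push_cast
  ring

theorem nonempty_iso_star (hT : T.IsTree) {c : V} {m : ℕ} (hc : T.degree c = m)
    (hn : Fintype.card V = m + 1) (a : Fin 1 → ℕ) (ha : a 0 = m) :
    Nonempty (T ≃g caterpillar a) := by
  have hall : ∀ x, x ≠ c → T.Adj x c := by
    have : insert c (T.neighborFinset c) = Finset.univ := by
      rw [← Finset.card_eq_iff_eq_univ, Finset.card_insert_of_notMem (by simp),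
        card_neighborFinset_eq_degree]
      omega
    intro x hx
    have h := Finset.mem_univ x
    rw [← this, Finset.mem_insert, mem_neighborFinset] at h
    exact (h.resolve_left hx).symm
  refine nonempty_iso_caterpillar hT (p := fun _ => c) (J := fun _ => 0)
    (Function.injective_of_subsingleton _) (fun i j h => absurd h (by omega)) (fun x hx => ?_)
    (fun i => ?_)
  · exact hall x fun h => hx ⟨0, h.symm⟩
  · rw [Subsingleton.elim i 0, ha, Nat.card_eq_fintype_card, Fintype.card_subtype]
    have : (Finset.univ.filter fun x => x ∉ Set.range (fun _ : Fin 1 => c) ∧ (0 : Fin 1) = 0) =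
        Finset.univ.erase c := by
      ext x
      simp [eq_comm]
    rw [this, Finset.card_erase_of_mem (Finset.mem_univ c), Finset.card_univ]
    omega

/-- A leaf that is neither `c` nor adjacent to `c` can be deleted without changing the degree of
`c`; each deletion shortens the path of the extremal tree by one vertex. -/
theorem distSum_le_of_degree {g : ℕ → ℝ} (h0 : g 0 = 0) (hg : Monotone g) (d k : ℕ) :
    ∀ (V : Type) [Fintype V] (T : SimpleGraph V), T.IsTree → ∀ c : V, T.degree c = d + 2 →
      Fintype.card V = d + 2 + (k + 1) →
      distSum g T ≤ distSum g (doubleStarPath (k + 1) 1 (d + 1)) := by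
  induction k with
  | zero =>
    intro V _ T hT c hc hn
    -- Here `c` is adjacent to all other vertices. The path of the extremal tree has a single
    -- vertex, which carries both groups of pendent vertices.
    obtain ⟨e⟩ := nonempty_iso_star hT hc hn
      (fun i : Fin 1 => (if i.val = 0 then 1 else 0) + (if i.val + 1 = 1 then d + 1 else 0))
      (by simp; omega)
    exact (distSum_iso e g).le
  | succ k ih =>
    intro V _ T hT c hc hn
    obtain ⟨v, hv, hvc, hadj⟩ := exists_far_leaf hT (c := c) (by omega)
    have hL : ∀ x ∈ ({v} : Finset V), T.degree x = 1 := fun x hx => by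
      rw [Finset.mem_singleton.1 hx, hv]
    have hcv : c ∉ ({v} : Finset V) := fun h => hvc (Finset.mem_singleton.1 h).symm
    have h1 := ih _ (prune T {v}) (isTree_prune hT hL ⟨c, hcv⟩) ⟨c, hcv⟩
      (by
        rw [degree_prune _ fun y hy => by rw [Finset.mem_singleton.1 hy]; exact hadj]
        exact hc)
      (by rw [card_prune, Finset.card_singleton]; omega)
    have h2 := sum_dist_le_of_degree hT hc hn v h0 hg
    rw [distSum_leaf hT hv h0, distSum_doubleStarPath_one h0 (by omega)]
    linarith

/-- Equality forces one vertex at each distance below `k + 2` from `v` and all remaining ones at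
distance `k + 2`. The latter then share their parent, and `v` is the single pendent vertex at the
other end. -/
theorem nonempty_iso_of_sum_dist_eq (hT : T.IsTree) {c : V} {d k : ℕ} (hk : 1 ≤ k)
    (hc : T.degree c = d + 2) (hn : Fintype.card V = d + 2 + (k + 1)) {v : V} {g : ℕ → ℝ}
    (h0 : g 0 = 0) (hg : StrictMono g)
    (heq : ∑ y, g (T.dist v y) = hsum g (k + 1) + (d + 1) * g (k + 2))
    (hsum : distSum g T = distSum g (doubleStarPath (k + 1) 1 (d + 1))) :
    Nonempty (T ≃g doubleStarPath (k + 1) 1 (d + 1)) := by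
  have hle : ∀ y, T.dist v y ≤ k + 2 := by
    intro y
    have := dist_add_degree_le hT c v y
    omega
  have hlev : ∀ t, t < k + 2 →
      (Finset.univ.filter fun y => t + 1 ≤ T.dist v y).card = Fintype.card V - (t + 1) := by
    intro t ht
    refine card_level_eq (φ := fun y => T.dist v y) (g := fun m => g (min m (k + 2)))
      (fun x m hm => exists_dist_eq hT.connected v x m hm) (monotone_min hg.monotone _) ?_
      (by omega) ?_
    · rw [← sum_min_dist hT hc hn, heq, ← sum_range_min h0,
        show k + 2 + (d + 1) = Fintype.card V by omega]
    · rw [min_eq_left (by omega), min_eq_left (by omega)]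
      exact hg (by omega)
  have huniq : ∀ x y, T.dist v x = T.dist v y → T.dist v x < k + 2 → x = y := by
    intro x y hxy hlt
    by_contra hne
    obtain ⟨t, ht⟩ : ∃ t, T.dist v x = t + 1 := by
      refine ⟨T.dist v x - 1, ?_⟩
      have : T.dist v x ≠ 0 := by
        intro h
        have h1 := (hT.connected.dist_eq_zero_iff).1 h
        have h2 := (hT.connected.dist_eq_zero_iff).1 (hxy ▸ h)
        exact hne (h1.symm.trans h2)
      omega
    have h1 := hlev t (by omega)
    have h2 := hlev (t + 1) (by omega)
    have h3 : (Finset.univ.filter fun y => t + 1 + 1 ≤ T.dist v y) ∪ {x, y} ⊆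
        Finset.univ.filter fun y => t + 1 ≤ T.dist v y := by
      intro z hz
      simp only [Finset.mem_union, Finset.mem_filter, Finset.mem_univ, true_and,
        Finset.mem_insert, Finset.mem_singleton] at hz ⊢
      rcases hz with hz | rfl | rfl <;> omega
    have h4 := Finset.card_le_card h3
    rw [Finset.card_union_of_disjoint, Finset.card_pair hne] at h4
    · omega
    · rw [Finset.disjoint_left]
      intro z hz hz'
      simp only [Finset.mem_filter, Finset.mem_univ, true_and,
        Finset.mem_insert, Finset.mem_singleton] at hz hz'
      rcases hz' with rfl | rfl <;> omega
  obtain ⟨y, hy⟩ : ∃ y, T.dist v y = k + 2 := by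
    have h1 := hlev (k + 1) (by omega)
    have h2 : 0 < (Finset.univ.filter fun y => k + 1 + 1 ≤ T.dist v y).card := by omega
    obtain ⟨y, hy⟩ := Finset.card_pos.1 h2
    rw [Finset.mem_filter] at hy
    exact ⟨y, le_antisymm (hle y) hy.2⟩
  obtain ⟨p, hp0, -, hp⟩ := exists_geodesic hT.connected hy
  have hdp : ∀ i, i ≤ k + 2 → T.dist v (p i) = i := by
    intro i hi
    rw [← hp0, hp 0 i (by omega) hi]
    omega
  refine nonempty_iso_doubleStarPath hT (p := fun i : Fin (k + 1) => p (i + 1)) (by omega)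
    ?_ ?_ ?_ (by omega) h0 hg hsum
  · intro i j hij
    have := congrArg (T.dist v) hij
    simp only at this
    rw [hdp _ (by omega), hdp _ (by omega)] at this
    exact Fin.ext (by omega)
  · intro i j hij
    rw [← dist_eq_one_iff_adj, hp _ _ (by omega) (by omega)]
    omega
  · intro x hx
    by_cases hxv : x = v
    · left
      rw [← dist_eq_one_iff_adj, hxv, hdp _ (by omega)]
    · right
      have hpar := dist_par hT.connected hxv
      have hx2 : T.dist v x = k + 2 := by
        by_contra hne
        have h1 := hle x
        refine hx ⟨⟨T.dist v x - 1, by omega⟩, ?_⟩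
        refine huniq _ _ ?_ ?_
        · simp only
          rw [hdp _ (by omega)]
          omega
        · simp only
          rw [hdp _ (by omega)]
          omega
      have h2 : par T v x = p (k + 1) := by
        refine huniq _ _ ?_ (by omega)
        rw [hdp _ (by omega)]
        omega
      have := par_adj hT.connected hxv
      rw [h2] at this
      exact this

/-- Among the trees with a vertex of degree `D`, the double star path with `D - 1` leaves at one
end has the largest distance sums and edge counts. -/
theorem majorized_of_degree (hT : T.IsTree) {c : V} {D k : ℕ} (hD : 2 ≤ D)
    (hc : T.degree c = D) (hk : 2 ≤ k) (hn : Fintype.card V = k + D) :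
    Majorized T (doubleStarPath k 1 (D - 1)) := by
  obtain ⟨d, rfl⟩ : ∃ d, D = d + 2 := ⟨D - 2, by omega⟩
  obtain ⟨k, rfl⟩ : ∃ j, k = j + 1 := ⟨k - 1, by omega⟩
  rw [show d + 2 - 1 = d + 1 by omega]
  have hn' : Fintype.card V = d + 2 + (k + 1) := by omega
  refine ⟨fun α hα => ?_, fun α hα heq => ?_, fun t ht => ?_⟩
  · exact distSum_le_of_degree (wt_zero α) (wt_strictMono hα).monotone d k V T hT c hc hn'
  · obtain ⟨v, hv, hvc, hadj⟩ := exists_far_leaf hT (c := c) (by omega)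
    have hL : ∀ x ∈ ({v} : Finset V), T.degree x = 1 := fun x hx => by
      rw [Finset.mem_singleton.1 hx, hv]
    have hcv : c ∉ ({v} : Finset V) := fun h => hvc (Finset.mem_singleton.1 h).symm
    obtain ⟨j, rfl⟩ : ∃ j, k = j + 1 := ⟨k - 1, by omega⟩
    have h1 := distSum_le_of_degree (wt_zero α) (wt_strictMono hα).monotone d j _ (prune T {v})
      (isTree_prune hT hL ⟨c, hcv⟩) ⟨c, hcv⟩
      (by
        rw [degree_prune _ fun y hy => by rw [Finset.mem_singleton.1 hy]; exact hadj]
        exact hc)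
      (by rw [card_prune, Finset.card_singleton]; omega)
    have h2 := sum_dist_le_of_degree hT hc hn' v (wt_zero α) (wt_strictMono hα).monotone
    refine nonempty_iso_of_sum_dist_eq hT (v := v) (by omega) hc hn' (wt_zero α)
      (wt_strictMono hα) ?_ heq
    rw [distSum_leaf hT hv (wt_zero α), distSum_doubleStarPath_one (wt_zero α) (by omega)] at heq
    linarith
  · have h1 := edgeCount_add_le hT (t := t)
    have h2 := edgeCount_add_degree_le hT c ht
    have h3 := le_edgeCount_doubleStarPath (k := k + 1) (a := 1) (b := d + 1)
      (by omega) ht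
    omega

end Degree

end TreeIndices

namespace TreeIndices
open SimpleGraph Classical

/-! ### The minimum for a given path -/

section Spine

/-- A sequence with steps `±1` and no local maximum decreases and then increases. -/
theorem exists_valley {f : ℕ → ℕ} (m : ℕ)
    (hstep : ∀ i < m, f (i + 1) = f i + 1 ∨ f i = f (i + 1) + 1)
    (hmax : ∀ i, i + 1 < m → ¬ (f (i + 1) = f i + 1 ∧ f (i + 1) = f (i + 2) + 1)) :
    ∃ j ≤ m, ∀ i ≤ m, f i = f j + ((i - j) + (j - i)) := by
  induction m with
  | zero => exact ⟨0, le_rfl, fun i hi => by rw [Nat.le_zero.1 hi]; omega⟩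
  | succ m ih =>
    obtain ⟨j, hj, h⟩ := ih (fun i hi => hstep i (by omega)) (fun i hi => hmax i (by omega))
    rcases hstep m (by omega) with h1 | h1
    · refine ⟨j, by omega, fun i hi => ?_⟩
      rcases Nat.lt_or_ge m i with h2 | h2
      · have : i = m + 1 := by omega
        rw [this, h1, h m le_rfl]
        omega
      · exact h i h2
    · have hjm : j = m := by
        by_contra hne
        obtain ⟨l, rfl⟩ : ∃ l, m = l + 1 := ⟨m - 1, by omega⟩
        refine hmax l (by omega) ⟨?_, h1⟩
        rw [h l (by omega), h (l + 1) le_rfl]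
        omega
      subst hjm
      refine ⟨j + 1, le_rfl, fun i hi => ?_⟩
      rcases Nat.lt_or_ge j i with h2 | h2
      · have : i = j + 1 := by omega
        rw [this]
        omega
      · rw [h i h2, h1]
        omega

theorem injOn_of_dist {V : Type} {T : SimpleGraph V} {k : ℕ} {p : ℕ → V}
    (hp : ∀ i j, i < k → j < k → T.dist (p i) (p j) = (i - j) + (j - i)) :
    Function.Injective fun i : Fin k => p i := by
  intro i j hij
  have := hp i j i.isLt j.isLt
  simp only at hij
  rw [hij, T.dist_self] at this
  exact Fin.ext (by omega)

variable {V : Type} [Fintype V] {T : SimpleGraph V}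

theorem wt_add_two_sub {α : ℝ} (hα : 0 ≤ α) (m : ℕ) :
    wt α (m + 1) + (wt α 2 - wt α 1) ≤ wt α (m + 2) := by
  rw [show m + 2 = (m + 1) + 1 by ring, wt_succ α (m + 1), show (2 : ℕ) = 1 + 1 by rfl,
    wt_succ α 1]
  have : 0 ≤ α * m := by positivity
  push_cast
  linarith

variable {k : ℕ} {p : ℕ → V}

/-- The distances from a vertex to the vertices of a path. -/
theorem exists_foot_path (hT : T.IsTree) (hk : 0 < k)
    (hp : ∀ i j, i < k → j < k → T.dist (p i) (p j) = (i - j) + (j - i)) (x : V) :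
    ∃ j < k, ∀ i < k, T.dist x (p i) = T.dist x (p j) + ((i - j) + (j - i)) := by
  have hadj : ∀ i, i + 1 < k → T.Adj (p i) (p (i + 1)) := fun i hi => by
    rw [← dist_eq_one_iff_adj, hp _ _ (by omega) hi]
    omega
  obtain ⟨j, hj, h⟩ := exists_valley (f := fun i => T.dist x (p i)) (k - 1)
    (fun i hi => by
      have h1 := dist_ne_of_adj hT (hadj i (by omega)) x
      have h2 := (hadj i (by omega)).diff_dist_adj (u := x)
      omega)
    -- At a local maximum the path vertex would have two different neighbours nearer to `x`.
    (fun i hi h => by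
      have := closer_unique hT (hadj i (by omega)).symm (hadj (i + 1) (by omega)) h.1 h.2
      have h2 := hp i (i + 1 + 1) (by omega) (by omega)
      rw [← this, T.dist_self] at h2
      omega)
  exact ⟨j, by omega, fun i hi => h i (by omega)⟩

/-- The distances grow by `|i - j|` from the foot `j`, so by convexity of `hsum` a central foot is
best. A vertex not adjacent to the path has each of the `k` distances at least one larger, and each
such step costs at least `wt α 2 - wt α 1`. -/
theorem le_sum_dist_path (hT : T.IsTree) {s : ℕ} (hs : s = (k - 1) / 2) (hk : 0 < k)
    (hp : ∀ i j, i < k → j < k → T.dist (p i) (p j) = (i - j) + (j - i)) {α : ℝ} (hα : 0 ≤ α)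
    {x : V} (hx : ∀ i < k, x ≠ p i) :
    hsum (wt α) (s + 1) + hsum (wt α) (k - s) - wt α 1 +
      (if ∃ i < k, T.Adj x (p i) then 0 else (k : ℝ) * (wt α 2 - wt α 1)) ≤
      ∑ i ∈ Finset.range k, wt α (T.dist x (p i)) := by
  obtain ⟨j, hj, h⟩ := exists_foot_path hT hk hp x
  have hg := wt_strictMono hα
  have hC : hsum (wt α) (s + 1) + hsum (wt α) (k - s) - wt α 1 ≤
      ∑ i ∈ Finset.range k, wt α (1 + ((i - j) + (j - i))) := by
    rw [sum_range_dist_succ _ hj]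
    rcases le_total (j + 1) (k - j) with h1 | h1
    · have := hsum_add_le hg (x := j + 1) (y := k - j) (u := s + 1) (v := k - s) (by omega)
        (by omega) (by omega)
      linarith
    · have := hsum_add_le hg (x := k - j) (y := j + 1) (u := s + 1) (v := k - s) (by omega)
        (by omega) (by omega)
      linarith
  have hpos := hT.connected.pos_dist_of_ne (hx j hj)
  split_ifs with hadj
  · rw [add_zero]
    refine hC.trans (Finset.sum_le_sum fun i hi => hg.monotone ?_)
    rw [h i (Finset.mem_range.1 hi)]
    omega
  · have h2 : 2 ≤ T.dist x (p j) := by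
      by_contra hlt
      exact hadj ⟨j, hj, dist_eq_one_iff_adj.1 (by omega)⟩
    have : (k : ℝ) * (wt α 2 - wt α 1) = ∑ i ∈ Finset.range k, (wt α 2 - wt α 1) := by
      rw [Finset.sum_const, Finset.card_range, nsmul_eq_mul]
    rw [this]
    refine (add_le_add_left hC _).trans ?_
    rw [← Finset.sum_add_distrib]
    refine Finset.sum_le_sum fun i hi => ?_
    rw [h i (Finset.mem_range.1 hi), add_comm 1]
    exact (wt_add_two_sub hα _).trans (hg.monotone (by omega))

theorem foot_central (hT : T.IsTree) {s : ℕ} (hs : s = (k - 1) / 2)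
    (hp : ∀ i j, i < k → j < k → T.dist (p i) (p j) = (i - j) + (j - i)) {α : ℝ} (hα : 0 ≤ α)
    {x : V} {j : ℕ} (hj : j < k) (hadj : T.Adj x (p j)) (hx : ∀ i < k, x ≠ p i)
    (heq : ∑ i ∈ Finset.range k, wt α (T.dist x (p i)) =
      hsum (wt α) (s + 1) + hsum (wt α) (k - s) - wt α 1) : j = s ∨ j = k - 1 - s := by
  have hg := wt_strictMono hα
  obtain ⟨l, hl, h⟩ := exists_foot_path hT (by omega) hp x
  have h1 := dist_eq_one_iff_adj.2 hadj
  have hpos := hT.connected.pos_dist_of_ne (hx l hl)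
  have hjl : j = l := by
    have := h j hj
    omega
  subst hjl
  have h2 : ∑ i ∈ Finset.range k, wt α (T.dist x (p i)) =
      ∑ i ∈ Finset.range k, wt α (1 + ((i - j) + (j - i))) :=
    Finset.sum_congr rfl fun i hi => by rw [h i (Finset.mem_range.1 hi), h1]
  rw [h2, sum_range_dist_succ _ hj] at heq
  by_contra! hcon
  rcases le_total (j + 1) (k - j) with h3 | h3
  · have := hsum_add_lt hg (x := j + 1) (y := k - j) (u := s + 1) (v := k - s) (by omega)
      (by omega) (by omega)
    linarith
  · have := hsum_add_lt hg (x := k - j) (y := j + 1) (u := s + 1) (v := k - s) (by omega)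
      (by omega) (by omega)
    linarith

/-- An off-path neighbour of a path vertex has that vertex as its parent. -/
theorem par_eq_of_adj_path (hT : T.IsTree)
    (hp : ∀ i j, i < k → j < k → T.dist (p i) (p j) = (i - j) + (j - i))
    {x : V} (hx : ∀ i < k, x ≠ p i) {j : ℕ} (hj : j < k) (hadj : T.Adj x (p j)) :
    p j = par T (p 0) x := by
  refine eq_par hT hadj ?_
  have h1 := dist_ne_of_adj hT hadj (p 0)
  have h2 := hadj.diff_dist_adj (u := p 0)
  by_contra hne
  have h3 : T.dist (p 0) (p j) = T.dist (p 0) x + 1 := by omega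
  have hj0 := hp 0 j (by omega) hj
  obtain ⟨i, rfl⟩ : ∃ i, j = i + 1 := ⟨j - 1, by omega⟩
  have h4 : T.Adj (p (i + 1)) (p i) := by
    rw [← dist_eq_one_iff_adj, hp _ _ hj (by omega)]
    omega
  refine hx i (by omega) (closer_unique hT hadj.symm h4 h3 ?_)
  rw [hj0, hp 0 i (by omega) (by omega)]
  omega

/-- Vertices that are attached to different vertices of a path are not close to each other. -/
theorem three_le_dist_of_adj_path (hT : T.IsTree)
    (hp : ∀ i j, i < k → j < k → T.dist (p i) (p j) = (i - j) + (j - i))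
    {x y : V} (hx : ∀ i < k, x ≠ p i) (hy : ∀ i < k, y ≠ p i) {i j : ℕ} (hi : i < k) (hj : j < k)
    (hij : i ≠ j) (hxi : T.Adj x (p i)) (hyj : T.Adj y (p j)) : 3 ≤ T.dist x y := by
  obtain ⟨l, hl, h⟩ := exists_foot_path hT (by omega) hp y
  have h1 := dist_eq_one_iff_adj.2 hyj
  have h2 := hT.connected.pos_dist_of_ne (hy l hl)
  have hlj : l = j := by
    have := h j hj
    omega
  subst hlj
  obtain ⟨m, hm, hmi, hml⟩ : ∃ m < k, (m = i + 1 ∨ i = m + 1) ∧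
      (i - l) + (l - i) = (m - l) + (l - m) + 1 := by
    rcases Nat.lt_or_ge i l with h3 | h3
    · exact ⟨i + 1, by omega, by omega, by omega⟩
    · exact ⟨i - 1, by omega, by omega, by omega⟩
  have h3 : T.Adj (p i) (p m) := by
    rw [← dist_eq_one_iff_adj, hp _ _ hi hm]
    omega
  have h4 := dist_ne_of_adj hT hxi y
  have h5 := hxi.diff_dist_adj (u := y)
  have h6 := h i hi
  have h7 := h m hm
  have h8 : T.dist y (p i) ≠ T.dist y x + 1 := fun h8 =>
    hx m hm (closer_unique hT hxi.symm h3 h8 (by omega))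
  rw [T.dist_comm]
  omega

/-- The edge between path vertices `i - 1` and `i` has at least `i` and `k - i` vertices on its
sides, from the path alone. -/
theorem le_edgeCount_of_path (hT : T.IsTree)
    (hp : ∀ i j, i < k → j < k → T.dist (p i) (p j) = (i - j) + (j - i)) {t : ℕ} (ht : 1 ≤ t) :
    k + 1 - 2 * t ≤ edgeCount T t := by
  have hinj := injOn_of_dist hp
  have hinj' : ∀ i j, i < k → j < k → p i = p j → i = j := fun i j hi hj h =>
    congrArg Fin.val (@hinj ⟨i, hi⟩ ⟨j, hj⟩ h)
  have himg : ∀ s : Finset ℕ, (∀ i ∈ s, i < k) → (s.image p).card = s.card := fun s hs =>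
    Finset.card_image_of_injOn fun i hi j hj h => hinj' i j (hs i hi) (hs j hj) h
  have h1 : (Finset.Ico t (k + 1 - t)).card = k + 1 - 2 * t := by
    rw [Nat.card_Ico]
    omega
  rw [edgeCount_eq hT (p 0), ← h1, ← himg _ fun i hi => by rw [Finset.mem_Ico] at hi; omega]
  refine Finset.card_le_card fun x hx => ?_
  obtain ⟨i, hi, rfl⟩ := Finset.mem_image.1 hx
  rw [Finset.mem_Ico] at hi
  rw [Finset.mem_filter, Finset.mem_erase]
  refine ⟨⟨fun h => ?_, Finset.mem_univ _⟩, ?_, ?_⟩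
  · have := hinj' i 0 (by omega) (by omega) h
    omega
  · have : (Finset.Ico i k).image p ⊆ sub T (p 0) (p i) := by
      intro y hy
      obtain ⟨j, hj, rfl⟩ := Finset.mem_image.1 hy
      rw [Finset.mem_Ico] at hj
      rw [mem_sub, hp _ _ (by omega) (by omega), hp _ _ (by omega) (by omega),
        hp _ _ (by omega) (by omega)]
      omega
    have := Finset.card_le_card this
    rw [himg _ fun j hj => (Finset.mem_Ico.1 hj).2, Nat.card_Ico] at this
    omega
  · have : Disjoint ((Finset.range i).image p) (sub T (p 0) (p i)) := by
      rw [Finset.disjoint_left]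
      intro y hy
      obtain ⟨j, hj, rfl⟩ := Finset.mem_image.1 hy
      rw [Finset.mem_range] at hj
      rw [mem_sub, hp _ _ (by omega) (by omega), hp _ _ (by omega) (by omega),
        hp _ _ (by omega) (by omega)]
      omega
    have h2 := Finset.card_union_of_disjoint this
    have h3 := Finset.card_le_univ ((Finset.range i).image p ∪ sub T (p 0) (p i))
    rw [himg _ fun j hj => by rw [Finset.mem_range] at hj; omega, Finset.card_range] at h2
    omega

/-- The distance sum, split along a path. -/
theorem distSum_path_split
    (hp : ∀ i j, i < k → j < k → T.dist (p i) (p j) = (i - j) + (j - i)) (g : ℕ → ℝ)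
    {O : Finset V} (hO : ∀ x, x ∈ O ↔ ∀ i < k, x ≠ p i) :
    distSum g T = pathSum g k + 2 * ∑ x ∈ O, ∑ i ∈ Finset.range k, g (T.dist x (p i)) +
      ∑ x ∈ O, ∑ y ∈ O, g (T.dist x y) := by
  have hinj := injOn_of_dist hp
  have hOc : Oᶜ = (Finset.range k).image p := by
    ext x
    rw [Finset.mem_compl, hO, Finset.mem_image]
    push Not
    simp only [Finset.mem_range, eq_comm]
  have hsum : ∀ f : V → ℝ, ∑ x, f x = ∑ x ∈ O, f x + ∑ i ∈ Finset.range k, f (p i) := by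
    intro f
    rw [← Finset.sum_add_sum_compl O f, hOc, Finset.sum_image]
    intro i hi j hj h
    simp only [Finset.coe_range, Set.mem_Iio] at hi hj
    exact congrArg Fin.val (@hinj ⟨i, hi⟩ ⟨j, hj⟩ h)
  have h1 : ∑ i ∈ Finset.range k, ∑ j ∈ Finset.range k, g (T.dist (p i) (p j)) = pathSum g k := by
    rw [pathSum]
    refine Finset.sum_congr rfl fun i hi => Finset.sum_congr rfl fun j hj => ?_
    rw [hp _ _ (Finset.mem_range.1 hi) (Finset.mem_range.1 hj)]
  have h2 : ∑ i ∈ Finset.range k, ∑ y ∈ O, g (T.dist (p i) y) =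
      ∑ x ∈ O, ∑ i ∈ Finset.range k, g (T.dist x (p i)) := by
    rw [Finset.sum_comm]
    simp only [T.dist_comm]
  rw [distSum, hsum]
  simp only [hsum, Finset.sum_add_distrib]
  rw [h1, h2]
  ring

theorem sum_sum_ne {V : Type} (O : Finset V) (c : ℝ) :
    ∑ x ∈ O, ∑ y ∈ O, (if x = y then 0 else c) = (O.card : ℝ) * ((O.card : ℝ) - 1) * c := by
  have : ∀ x ∈ O, ∑ y ∈ O, (if x = y then 0 else c) = (O.card - 1) * c := by
    intro x hx
    rw [Finset.sum_congr rfl fun y _ => (by split_ifs <;> ring :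
      (if x = y then 0 else c) = c - if x = y then c else 0),
      Finset.sum_sub_distrib, Finset.sum_const, Finset.sum_ite_eq, if_pos hx, nsmul_eq_mul]
    ring
  rw [Finset.sum_congr rfl this, Finset.sum_const, nsmul_eq_mul]
  ring

/-- Distinct vertices weigh at least `wt α 2` unless they are adjacent; in that case one is the
parent of the other and the deficit is charged to the child. -/
theorem le_wt_dist (hT : T.IsTree) {α : ℝ} (hα : 0 ≤ α) (r x y : V) :
    (if x = y then 0 else wt α 2) - ((if y = par T r x then wt α 2 - wt α 1 else 0) +
      (if x = par T r y then wt α 2 - wt α 1 else 0)) ≤ wt α (T.dist x y) := by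
  have hg := wt_strictMono hα
  have h12 : wt α 1 < wt α 2 := hg (by omega)
  by_cases hxy : x = y
  · subst hxy
    rw [if_pos rfl, T.dist_self, wt_zero]
    split_ifs <;> linarith
  · rw [if_neg hxy]
    have hpos := hT.connected.pos_dist_of_ne hxy
    rcases Nat.lt_or_ge 1 (T.dist x y) with h | h
    · have : wt α 2 ≤ wt α (T.dist x y) := hg.monotone h
      split_ifs <;> linarith
    · have h1 : T.dist x y = 1 := by omega
      have hadj := dist_eq_one_iff_adj.1 h1
      rw [h1]
      have h2 := dist_ne_of_adj hT hadj r
      have h3 := hadj.diff_dist_adj (u := r)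
      rcases (by omega : T.dist r x = T.dist r y + 1 ∨ T.dist r y = T.dist r x + 1) with h4 | h4
      · rw [if_pos (eq_par hT hadj h4)]
        split_ifs <;> linarith
      · rw [if_pos (eq_par hT hadj.symm h4)]
        split_ifs <;> linarith

/-- Among the trees with a given path, the central caterpillar has the smallest distance sums and
edge counts. -/
theorem majorized_centralCaterpillar (hT : T.IsTree) {n : ℕ} (hn : Fintype.card V = n)
    (hk : 2 ≤ k) (hp : ∀ i j, i < k → j < k → T.dist (p i) (p j) = (i - j) + (j - i)) :
    Majorized (centralCaterpillar n k ((k + 1) / 2)) T := by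
  obtain ⟨s, hs⟩ : ∃ s, s = (k - 1) / 2 := ⟨_, rfl⟩
  have hsk : (k + 1) / 2 = s + 1 := by omega
  have hinj := injOn_of_dist hp
  set O : Finset V := Finset.univ.filter fun x => ∀ i < k, x ≠ p i with hOdef
  have hO : ∀ x, x ∈ O ↔ ∀ i < k, x ≠ p i := fun x => by simp [hOdef]
  have hOcard : O.card + k = n := by
    have h1 : Oᶜ = Finset.univ.image fun i : Fin k => p i := by
      ext x
      rw [Finset.mem_compl, hO]
      push Not
      constructor
      · rintro ⟨i, hi, rfl⟩
        exact Finset.mem_image.2 ⟨⟨i, hi⟩, Finset.mem_univ _, rfl⟩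
      · intro h
        obtain ⟨i, -, rfl⟩ := Finset.mem_image.1 h
        exact ⟨i, i.isLt, rfl⟩
    have h2 : (Finset.univ.image fun i : Fin k => p i).card = k := by
      rw [Finset.card_image_of_injective _ hinj, Finset.card_univ, Fintype.card_fin]
    rw [← hn, ← Finset.card_add_card_compl O, h1, h2]
  have hkn : k ≤ n := by omega
  have hnk : n - k = O.card := by omega
  have hOr : ∀ x ∈ O, x ≠ p 0 := fun x hx => (hO x).1 hx 0 (by omega)
  -- The vertices of `N` are those that pay: each is charged at most one adjacency inside `O`, the
  -- one with its parent.
  set N : Finset V := O.filter fun x => ¬ ∃ i < k, T.Adj x (p i) with hN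
  -- off-path vertices whose parent is off the path are not adjacent to the path
  have hparN : ∀ x ∈ O, par T (p 0) x ∈ O → x ∈ N := by
    intro x hx hpx
    rw [hN, Finset.mem_filter]
    refine ⟨hx, ?_⟩
    rintro ⟨i, hi, hadj⟩
    have := par_eq_of_adj_path hT hp ((hO x).1 hx) hi hadj
    exact (hO _).1 hpx i hi this.symm
  have hdel : ∀ δ : ℝ, 0 ≤ δ →
      ∑ x ∈ O, ∑ y ∈ O, (if y = par T (p 0) x then δ else 0) ≤ N.card * δ := by
    intro δ hδ
    have : (N.card : ℝ) * δ = ∑ x ∈ O, if x ∈ N then δ else 0 := by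
      rw [← Finset.sum_filter, Finset.sum_const, nsmul_eq_mul]
      congr 3
      ext x
      simp only [hN, Finset.mem_filter]
      tauto
    rw [this]
    refine Finset.sum_le_sum fun x hx => ?_
    rw [Finset.sum_ite_eq' O (par T (p 0) x)]
    split_ifs with h1 h2
    · exact le_rfl
    · exact absurd (hparN x hx h1) h2
    · exact hδ
    · exact le_rfl
  have hH : ∀ α, distSum (wt α) (centralCaterpillar n k ((k + 1) / 2)) =
      pathSum (wt α) k + 2 * ((O.card : ℝ) * (hsum (wt α) (s + 1) + hsum (wt α) (k - s) -
        wt α 1)) + (O.card : ℝ) * ((O.card : ℝ) - 1) * wt α 2 := by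
    intro α
    rw [hsk, distSum_centralCaterpillar (by omega) (wt_zero α), hnk]
  have hA : ∀ α, 0 ≤ α → (O.card : ℝ) * (hsum (wt α) (s + 1) + hsum (wt α) (k - s) - wt α 1) +
      N.card * ((k : ℝ) * (wt α 2 - wt α 1)) ≤
      ∑ x ∈ O, ∑ i ∈ Finset.range k, wt α (T.dist x (p i)) := by
    intro α hα
    have h1 := Finset.sum_le_sum fun x (hx : x ∈ O) =>
      le_sum_dist_path hT hs (by omega) hp hα ((hO x).1 hx)
    refine le_trans (le_of_eq ?_) h1
    rw [Finset.sum_add_distrib, Finset.sum_const, nsmul_eq_mul, Finset.sum_ite, Finset.sum_const,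
      Finset.sum_const, nsmul_eq_mul, nsmul_eq_mul, mul_zero, zero_add]
  have hB : ∀ α, 0 ≤ α → (O.card : ℝ) * ((O.card : ℝ) - 1) * wt α 2 -
      2 * (N.card * (wt α 2 - wt α 1)) ≤ ∑ x ∈ O, ∑ y ∈ O, wt α (T.dist x y) := by
    intro α hα
    have h12 : wt α 1 < wt α 2 := wt_strictMono hα (by omega)
    have h1 := Finset.sum_le_sum fun x (_ : x ∈ O) => Finset.sum_le_sum fun y (_ : y ∈ O) =>
      le_wt_dist hT hα (p 0) x y 
    have h2 := hdel (wt α 2 - wt α 1) (by linarith)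
    have h3 : ∑ x ∈ O, ∑ y ∈ O, (if x = par T (p 0) y then wt α 2 - wt α 1 else 0) ≤
        N.card * (wt α 2 - wt α 1) := by
      rw [Finset.sum_comm]
      exact h2
    have h4 : ∑ x ∈ O, ∑ y ∈ O, (if x = y then 0 else wt α 2) =
        (O.card : ℝ) * ((O.card : ℝ) - 1) * wt α 2 :=
          sum_sum_ne O _
    simp only [Finset.sum_sub_distrib, Finset.sum_add_distrib] at h1
    linarith
  -- Per vertex of `N`, the surplus `k (wt α 2 - wt α 1)` towards the path exceeds the charge
  -- because `k ≥ 2`, and enough is left to force `N = ∅` in case of equality.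
  have hkN : ∀ α, 0 ≤ α → (N.card : ℝ) * (wt α 2 - wt α 1) ≤
      N.card * ((k : ℝ) * (wt α 2 - wt α 1)) - N.card * (wt α 2 - wt α 1) := by
    intro α hα
    have h12 : wt α 1 < wt α 2 := wt_strictMono hα (by omega)
    have hk2 : (2 : ℝ) ≤ k := by exact_mod_cast hk
    have h1 : 0 ≤ (N.card : ℝ) * (wt α 2 - wt α 1) :=
      mul_nonneg (Nat.cast_nonneg _) (by linarith)
    have := mul_nonneg h1 (by linarith : 0 ≤ (k : ℝ) - 2)
    linarith
  have hN0 : ∀ α, 0 ≤ α → 0 ≤ (N.card : ℝ) * (wt α 2 - wt α 1) := fun α hα =>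
    mul_nonneg (Nat.cast_nonneg _) (sub_nonneg.2 ((wt_strictMono hα).monotone (by omega)))
  refine ⟨fun α hα => ?_, fun α hα heq => ?_, fun t ht => ?_⟩
  · rw [hH, distSum_path_split hp _ hO]
    linarith [hA α hα, hB α hα, hkN α hα, hN0 α hα]
  · rw [hH, distSum_path_split hp _ hO] at heq
    have hg := wt_strictMono hα
    have h12 : wt α 1 < wt α 2 := hg (by omega)
    have h1 := hA α hα
    have h2 := hB α hα
    have h3 := hkN α hα
    have h4 := hN0 α hα
    have hNe : N = ∅ := by
      have h5 : (N.card : ℝ) * (wt α 2 - wt α 1) = 0 := by linarith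
      rcases mul_eq_zero.1 h5 with h | h
      · exact Finset.card_eq_zero.1 (by exact_mod_cast h)
      · linarith
    have hadj : ∀ x ∈ O, ∃ i < k, T.Adj x (p i) := by
      intro x hx
      by_contra h
      have : x ∈ N := by
        rw [hN, Finset.mem_filter]
        exact ⟨hx, h⟩
      rw [hNe] at this
      exact Finset.notMem_empty x this
    rw [hNe, Finset.card_empty] at h1 h2
    have hAeq : ∀ x ∈ O, ∑ i ∈ Finset.range k, wt α (T.dist x (p i)) =
        hsum (wt α) (s + 1) + hsum (wt α) (k - s) - wt α 1 := by
      have h5 : ∑ x ∈ O, (hsum (wt α) (s + 1) + hsum (wt α) (k - s) - wt α 1) =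
          ∑ x ∈ O, ∑ i ∈ Finset.range k, wt α (T.dist x (p i)) := by
        rw [Finset.sum_const, nsmul_eq_mul]
        push_cast at h1 h2
        linarith
      intro x hx
      refine ((Finset.sum_eq_sum_iff_of_le fun y hy => ?_).1 h5 x hx).symm
      have := le_sum_dist_path hT hs (by omega) hp hα ((hO y).1 hy)
      rwa [if_pos (hadj y hy), add_zero] at this
    have hBeq : ∀ x ∈ O, ∀ y ∈ O, x ≠ y → T.dist x y ≤ 2 := by
      have hge : ∀ x ∈ O, ∀ y ∈ O, (if x = y then 0 else wt α 2) ≤ wt α (T.dist x y) := by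
        intro x hx y hy
        have := le_wt_dist hT hα (p 0) x y
        have e1 : x ≠ par T (p 0) y := by
          intro h
          have := hparN y hy (h ▸ hx)
          rw [hNe] at this
          exact Finset.notMem_empty _ this
        have e2 : y ≠ par T (p 0) x := by
          intro h
          have := hparN x hx (h ▸ hy)
          rw [hNe] at this
          exact Finset.notMem_empty _ this
        rwa [if_neg e1, if_neg e2, add_zero, sub_zero] at this
      intro x hx y hy hxy
      by_contra! hlt
      have h5 : ∑ x ∈ O, ∑ y ∈ O, (if x = y then 0 else wt α 2) <
          ∑ x ∈ O, ∑ y ∈ O, wt α (T.dist x y) := by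
        refine Finset.sum_lt_sum (fun u hu => Finset.sum_le_sum fun v hv => hge u hu v hv)
          ⟨x, hx, Finset.sum_lt_sum (fun v hv => hge x hx v hv) ⟨y, hy, ?_⟩⟩
        rw [if_neg hxy]
        exact hg hlt
      have h6 : ∑ x ∈ O, ∑ y ∈ O, (if x = y then 0 else wt α 2) =
          (O.card : ℝ) * ((O.card : ℝ) - 1) * wt α 2 :=
          sum_sum_ne O _
      push_cast at h1 h2
      linarith
    -- all feet coincide, and the common foot is central
    have hfoot : ∃ j, (j = s ∨ j = k - 1 - s) ∧ ∀ x ∈ O, T.Adj x (p j) := by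
      rcases O.eq_empty_or_nonempty with he | ⟨x₀, hx₀⟩
      · exact ⟨s, Or.inl rfl, fun x hx => by simp [he] at hx⟩
      · obtain ⟨j, hj, hj'⟩ := hadj x₀ hx₀
        refine ⟨j, foot_central hT hs hp hα hj hj' ((hO _).1 hx₀) (hAeq x₀ hx₀), fun x hx => ?_⟩
        by_cases hxx : x = x₀
        · rw [hxx]
          exact hj'
        · obtain ⟨i, hi, hi'⟩ := hadj x hx
          by_cases hij : i = j
          · rw [← hij]
            exact hi'
          · exfalso
            have := three_le_dist_of_adj_path hT hp ((hO x).1 hx) ((hO x₀).1 hx₀) hi hj hij hi' hj'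
            have := hBeq x hx x₀ hx₀ hxx
            omega
    obtain ⟨j, hj, hjO⟩ := hfoot
    have hiso : ∀ p' : Fin k → V, Function.Injective p' →
        (∀ i j : Fin k, i.val + 1 = j.val → T.Adj (p' i) (p' j)) →
        (∀ x, x ∉ Set.range p' ↔ x ∈ O) → (∀ x ∈ O, T.Adj x (p' ⟨s, by omega⟩)) →
        Nonempty (T ≃g centralCaterpillar n k ((k + 1) / 2)) := by
      intro p' h1 h2 h3 h4
      refine nonempty_iso_caterpillar hT h1 h2 (J := fun _ => ⟨s, by omega⟩)
        (fun x hx => h4 x ((h3 x).1 hx)) fun i => ?_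
      by_cases hi : i.val + 1 = (k + 1) / 2
      · have hi' : (⟨s, by omega⟩ : Fin k) = i := Fin.ext (by simp only; omega)
        rw [if_pos hi, hi', hnk, Nat.card_eq_fintype_card, Fintype.card_subtype]
        congr 1
        ext x
        rw [Finset.mem_filter, h3]
        simp
      · have : IsEmpty {x // x ∉ Set.range p' ∧ (⟨s, by omega⟩ : Fin k) = i} :=
          ⟨fun x => hi (by rw [← x.2.2]; simp only; omega)⟩
        rw [if_neg hi, Nat.card_of_isEmpty]
    have hadjp : ∀ i j, i < k → j < k → i + 1 = j ∨ j + 1 = i → T.Adj (p i) (p j) := by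
      intro i j hi hj h
      rw [← dist_eq_one_iff_adj, hp i j hi hj]
      omega
    have hTiso : Nonempty (T ≃g centralCaterpillar n k ((k + 1) / 2)) := by
      rcases hj with rfl | rfl
      · refine hiso (fun i => p i) hinj (fun i j h => hadjp _ _ i.isLt j.isLt (Or.inl h)) ?_ hjO
        intro x
        rw [hO]
        simp only [Set.mem_range, not_exists]
        exact ⟨fun h i hi e => h ⟨i, hi⟩ e.symm, fun h i e => h i i.isLt e.symm⟩
      -- If the common foot is the other central vertex, the path is read backwards.
      · refine hiso (fun i => p (k - 1 - i)) (fun i j h => ?_)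
          (fun i j h => hadjp _ _ (by omega) (by omega) (by omega)) ?_ hjO
        · have := congrArg Fin.val (@hinj ⟨k - 1 - i, by omega⟩ ⟨k - 1 - j, by omega⟩ h)
          simp only at this
          exact Fin.ext (by omega)
        · intro x
          rw [hO]
          simp only [Set.mem_range, not_exists]
          refine ⟨fun h i hi e => h ⟨k - 1 - i, by omega⟩ ?_, fun h i e => h _ (by omega) e.symm⟩
          simp only
          rw [show k - 1 - (k - 1 - i) = i by omega, e]
    exact hTiso.map fun e => e.symm
  · exact (edgeCount_centralCaterpillar_le (by omega) hkn ht).trans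
      (le_edgeCount_of_path hT hp (by omega))

end Spine

end TreeIndices

namespace TreeIndices
open SimpleGraph Classical

/-! ### Starlike trees -/

section Starlike

variable {q : ℕ} {l : Fin q → ℕ}

/-- The distance function of a starlike tree. -/
def starDist (l : Fin q → ℕ) : Option (Σ i : Fin q, Fin (l i)) →
    Option (Σ i : Fin q, Fin (l i)) → ℕ
  | none, none => 0
  | none, some p => p.2.val + 1
  | some p, none => p.2.val + 1
  | some p, some r => if p.1 = r.1 then (p.2.val - r.2.val) + (r.2.val - p.2.val)
      else p.2.val + r.2.val + 2

theorem starlike_dist_aux (x y : Option (Σ i : Fin q, Fin (l i))) :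
    (starlike l).Reachable x y ∧ (starlike l).dist x y = starDist l x y := by
  refine dist_eq_of_recursion (φ := starDist l x) ?_ ?_ ?_ y
  · rcases x with _ | p
    · rfl
    · simp [starDist]
  · rintro (_ | v) (_ | w) h
    · exact h.elim
    · have h : w.2.val = 0 := h
      rcases x with _ | p
      · simp [starDist]
      · simp only [starDist]
        split_ifs <;> omega
    · have h : v.2.val = 0 := h
      rcases x with _ | p
      · simp only [starDist]
        omega
      · simp only [starDist]
        split_ifs <;> omega
    · have h : v.1 = w.1 ∧ (v.2.val + 1 = w.2.val ∨ w.2.val + 1 = v.2.val) := h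
      rcases x with _ | p
      · simp only [starDist]
        omega
      · simp only [starDist, h.1]
        split_ifs <;> omega
  · rintro (_ | ⟨i, a⟩) hv
    · rcases x with _ | ⟨j, b⟩
      · exact absurd rfl hv
      · refine ⟨some ⟨j, ⟨0, b.pos⟩⟩, rfl, ?_⟩
        simp [starDist]
    · have hdown : ∃ w, (starlike l).Adj (some ⟨i, a⟩) w ∧ ((a.val = 0 ∧ w = none) ∨
          (∃ h : a.val - 1 < l i, 0 < a.val ∧ w = some ⟨i, ⟨a.val - 1, h⟩⟩)) := by
        rcases Nat.eq_zero_or_pos a.val with h0 | h0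
        · exact ⟨none, h0, Or.inl ⟨h0, rfl⟩⟩
        · have : a.val - 1 < l i := by omega
          refine ⟨some ⟨i, ⟨a.val - 1, this⟩⟩, ⟨rfl, ?_⟩, Or.inr ⟨this, h0, rfl⟩⟩
          simp only
          omega
      obtain ⟨w, hw, hw'⟩ := hdown
      rcases x with _ | ⟨j, b⟩
      · refine ⟨w, hw, ?_⟩
        rcases hw' with ⟨h0, rfl⟩ | ⟨h, h0, rfl⟩
        · simp only [starDist]
          omega
        · simp only [starDist]
          omega
      · by_cases hij : j = i
        · subst hij
          rcases lt_trichotomy a.val b.val with hlt | heq | hgt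
          · refine ⟨some ⟨j, ⟨a.val + 1, by omega⟩⟩, ⟨rfl, by simp⟩, ?_⟩
            simp only [starDist, if_true]
            omega
          · exact absurd (by rw [Fin.ext heq]) hv
          · refine ⟨w, hw, ?_⟩
            rcases hw' with ⟨h0, rfl⟩ | ⟨h, h0, rfl⟩
            · omega
            · simp only [starDist, if_true]
              omega
        · refine ⟨w, hw, ?_⟩
          rcases hw' with ⟨h0, rfl⟩ | ⟨h, h0, rfl⟩
          · simp only [starDist, if_neg hij]
            omega
          · simp only [starDist, if_neg hij]
            omega

theorem starlike_dist (x y : Option (Σ i : Fin q, Fin (l i))) :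
    (starlike l).dist x y = starDist l x y := (starlike_dist_aux x y).2

theorem isTree_starlike (l : Fin q → ℕ) : (starlike l).IsTree := by
  have hconn : (starlike l).Connected :=
    ⟨fun x y => (starlike_dist_aux x y).1⟩
  refine isTree_of_parent hconn none (fun x => match x with
    | none => none
    | some p => if p.2.val = 0 then none else
        some ⟨p.1, ⟨p.2.val - 1, lt_of_le_of_lt (Nat.sub_le _ _) p.2.isLt⟩⟩) ?_
  have hup : ∀ (i : Fin q) (a b : Fin (l i)), a.val + 1 = b.val →
      (if b.val = 0 then none else some ⟨i, ⟨b.val - 1, lt_of_le_of_lt (Nat.sub_le _ _) b.isLt⟩⟩ :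
        Option (Σ i : Fin q, Fin (l i))) = some ⟨i, a⟩ := by
    intro i a b h
    rw [if_neg (by omega)]
    congr 2
    exact Fin.ext (by simp only; omega)
  rintro (_ | ⟨i, a⟩) (_ | ⟨j, b⟩) h
  · exact h.elim
  · have h : b.val = 0 := h
    exact Or.inr ⟨by simp, by simp [h]⟩
  · have h : a.val = 0 := h
    exact Or.inl ⟨by simp, by simp [h]⟩
  · have h : i = j ∧ (a.val + 1 = b.val ∨ b.val + 1 = a.val) := h
    obtain ⟨rfl, h⟩ := h
    rcases h with h | h
    · exact Or.inr ⟨by simp, hup i a b h⟩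
    · exact Or.inl ⟨by simp, hup i b a h⟩

theorem card_starlike (l : Fin q → ℕ) :
    Fintype.card (Option (Σ i : Fin q, Fin (l i))) = ∑ i, l i + 1 := by
  rw [Fintype.card_option, Fintype.card_sigma]
  simp

theorem degree_starlike_eq_one_iff (hl : ∀ i, 1 ≤ l i) (hq : 2 ≤ q)
    (v : Option (Σ i : Fin q, Fin (l i))) : (starlike l).degree v = 1 ↔
      ∃ i, v = some ⟨i, ⟨l i - 1, Nat.sub_lt (hl i) one_pos⟩⟩ := by
  constructor
  · intro h
    rcases v with _ | ⟨i, a⟩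
    · have hadj : ∀ i, (starlike l).Adj none (some ⟨i, ⟨0, hl i⟩⟩) := fun i => by
        simp [starlike]
      have := eq_of_degree_one h (hadj ⟨0, by omega⟩) (hadj ⟨1, by omega⟩)
      simp at this
    · refine ⟨i, ?_⟩
      by_contra hne
      have ha : a.val + 1 < l i := by
        by_contra hcon
        refine hne ?_
        congr 2
        exact Fin.ext (by simp only; omega)
      have h1 : (starlike l).Adj (some ⟨i, a⟩) (some ⟨i, ⟨a.val + 1, ha⟩⟩) := ⟨rfl, by simp⟩
      rcases Nat.eq_zero_or_pos a.val with h0 | h0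
      · have := eq_of_degree_one h h1 (b := none) h0
        simp at this
      · have := eq_of_degree_one h h1 (b := some ⟨i, ⟨a.val - 1, by omega⟩⟩)
          ⟨rfl, by simp only; omega⟩
        simp at this
        omega
  · rintro ⟨i, rfl⟩
    rw [degree_eq_one_iff_existsUnique_adj]
    by_cases h1 : l i = 1
    · refine ⟨none, show l i - 1 = 0 by omega, ?_⟩
      rintro (_ | ⟨j, b⟩) h
      · rfl
      · obtain ⟨rfl, h⟩ : i = j ∧ (l i - 1 + 1 = b.val ∨ b.val + 1 = l i - 1) := h
        omega
    · have := hl i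
      refine ⟨some ⟨i, ⟨l i - 2, by omega⟩⟩, ⟨rfl, by simp only; omega⟩, ?_⟩
      rintro (_ | ⟨j, b⟩) h
      · have h : l i - 1 = 0 := h
        omega
      · obtain ⟨rfl, h⟩ : i = j ∧ (l i - 1 + 1 = b.val ∨ b.val + 1 = l i - 1) := h
        congr 2
        exact Fin.ext (by simp only; omega)

theorem card_leaves_starlike (hl : ∀ i, 1 ≤ l i) (hq : 2 ≤ q) :
    (Finset.univ.filter fun v => (starlike l).degree v = 1).card = q := by
  have : (Finset.univ.filter fun v => (starlike l).degree v = 1) =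
      Finset.univ.image fun i : Fin q =>
        (some ⟨i, ⟨l i - 1, Nat.sub_lt (hl i) one_pos⟩⟩ : Option (Σ i : Fin q, Fin (l i))) := by
    ext v
    rw [Finset.mem_filter, degree_starlike_eq_one_iff hl hq]
    simp [eq_comm]
  rw [this, Finset.card_image_of_injective, Finset.card_univ, Fintype.card_fin]
  intro i j h
  simp only [Option.some.injEq, Sigma.mk.injEq] at h
  exact h.1

theorem card_sub_starlike_le (i : Fin q) (a : Fin (l i)) :
    (sub (starlike l) none (some ⟨i, a⟩)).card ≤ l i - a := by
  rw [← Nat.card_Ico]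
  have hmem : ∀ y ∈ sub (starlike l) none (some ⟨i, a⟩), ∃ b : Fin (l i), a ≤ b ∧
      y = some ⟨i, b⟩ := by
    rintro (_ | ⟨j, b⟩) hy
    · rw [mem_sub, starlike_dist, starlike_dist, starlike_dist] at hy
      simp only [starDist] at hy
      omega
    · rw [mem_sub, starlike_dist, starlike_dist, starlike_dist] at hy
      simp only [starDist] at hy
      by_cases hij : i = j
      · subst hij
        rw [if_pos rfl] at hy
        exact ⟨b, Fin.le_def.2 (by omega), rfl⟩
      · rw [if_neg hij] at hy
        omega
  refine Finset.card_le_card_of_injOn (fun y => y.elim 0 fun p => p.2.val) ?_ ?_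
  · intro y hy
    obtain ⟨b, hb, rfl⟩ := hmem y hy
    simp only [Option.elim, Finset.coe_Ico, Set.mem_Ico]
    exact ⟨hb, b.isLt⟩
  · intro y hy z hz h
    obtain ⟨b, hb, rfl⟩ := hmem y hy
    obtain ⟨b', hb', rfl⟩ := hmem z hz
    simp only [Option.elim] at h
    rw [Fin.ext h]

/-- Rooted at the centre, the vertex number `a` of a leg has at most `l i - a` vertices below it, so
a leg has at most `l i + 1 - t` counted edges. -/
theorem edgeCount_starlike_le (l : Fin q → ℕ) {t : ℕ} (ht : 1 ≤ t) :
    edgeCount (starlike l) t ≤ ∑ i, (l i + 1 - t) := by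
  rw [edgeCount_eq (isTree_starlike l) none]
  have h1 : ∀ i, l i + 1 - t = (Finset.univ.filter fun a : Fin (l i) => a.val + t ≤ l i).card := by
    intro i
    have : (Finset.univ.filter fun a : Fin (l i) => a.val + t ≤ l i) =
        Finset.univ.filter fun a : Fin (l i) => a.val < l i + 1 - t := by
      ext a
      simp only [Finset.mem_filter, Finset.mem_univ, true_and]
      omega
    rw [this, Fin.card_filter_val_lt]
    omega
  rw [Finset.sum_congr rfl fun i _ => h1 i, ← Finset.card_sigma]
  refine Finset.card_le_card_of_surjOn some ?_
  rintro (_ | ⟨i, a⟩) hx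
  · simp at hx
  · rw [Finset.mem_coe, Finset.mem_filter] at hx
    have := card_sub_starlike_le i a
    refine ⟨⟨i, a⟩, ?_, rfl⟩
    simp only [Finset.coe_sigma, Set.mem_sigma_iff, Finset.coe_filter, Finset.mem_univ, true_and,
      Finset.coe_univ, Set.mem_univ, Set.mem_ofPred_eq]
    have := a.isLt
    omega

/-- The contribution of a pair of legs to the distance sum. -/
noncomputable def legSum (g : ℕ → ℝ) (a b : ℕ) : ℝ :=
  ∑ x ∈ Finset.range a, ∑ y ∈ Finset.range b, g (x + y + 2)

theorem legSum_succ (g : ℕ → ℝ) (a b : ℕ) :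
    legSum g (a + 1) b = legSum g a b + ∑ y ∈ Finset.range b, g (a + y + 2) :=
  Finset.sum_range_succ _ _

theorem legSum_comm (g : ℕ → ℝ) (a b : ℕ) : legSum g a b = legSum g b a := by
  rw [legSum, Finset.sum_comm, legSum]
  refine Finset.sum_congr rfl fun x _ => Finset.sum_congr rfl fun y _ => ?_
  rw [add_comm y]

theorem distSum_starlike (l : Fin q → ℕ) {g : ℕ → ℝ} (h0 : g 0 = 0) :
    distSum g (starlike l) = 2 * ∑ i, hsum g (l i) +
      ∑ i, ∑ j, if i = j then pathSum g (l i) else legSum g (l i) (l j) := by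
  simp only [distSum, starlike_dist, Fintype.sum_option, Fintype.sum_sigma, starDist, h0, zero_add]
  have h1 : ∀ i, ∑ a : Fin (l i), g (a.val + 1) = hsum g (l i) := fun i =>
    Fin.sum_univ_eq_sum_range (fun a => g (a + 1)) (l i)
  have h2 : ∀ i j, ∑ a : Fin (l i), ∑ b : Fin (l j),
      g (if i = j then (a.val - b.val) + (b.val - a.val) else a.val + b.val + 2) =
      if i = j then pathSum g (l i) else legSum g (l i) (l j) := by
    intro i j
    split_ifs with h
    · subst h
      rw [pathSum, ← Fin.sum_univ_eq_sum_range
        (fun a => ∑ b ∈ Finset.range (l i), g ((a - b) + (b - a)))]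
      exact Finset.sum_congr rfl fun a _ =>
        Fin.sum_univ_eq_sum_range (fun b => g ((a.val - b) + (b - a.val))) (l i)
    · rw [legSum, ← Fin.sum_univ_eq_sum_range
        (fun a => ∑ b ∈ Finset.range (l j), g (a + b + 2))]
      exact Finset.sum_congr rfl fun a _ =>
        Fin.sum_univ_eq_sum_range (fun b => g (a.val + b + 2)) (l j)
  simp only [Finset.sum_add_distrib, h1]
  rw [two_mul, add_assoc]
  congr 2
  refine Finset.sum_congr rfl fun i _ => ?_
  rw [Finset.sum_comm]
  exact Finset.sum_congr rfl fun j _ => h2 i j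

theorem sum_sum_symm {ι : Type} [Fintype ι] [DecidableEq ι] (c : ι → ι → ℝ) (hc : ∀ i j, c i j = c j i) (k : ι) :
    ∑ i, ∑ j, c i j = c k k + 2 * ∑ j ∈ Finset.univ.erase k, c k j +
      ∑ i ∈ Finset.univ.erase k, ∑ j ∈ Finset.univ.erase k, c i j := by
  have h : ∀ f : ι → ℝ, ∑ i, f i = f k + ∑ i ∈ Finset.univ.erase k, f i := fun f =>
    (Finset.add_sum_erase _ f (Finset.mem_univ k)).symm
  rw [h, h]
  have h2 : ∑ i ∈ Finset.univ.erase k, ∑ j, c i j = ∑ i ∈ Finset.univ.erase k, c k i +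
      ∑ i ∈ Finset.univ.erase k, ∑ j ∈ Finset.univ.erase k, c i j := by
    rw [← Finset.sum_add_distrib]
    exact Finset.sum_congr rfl fun i _ => by rw [h, hc i k]
  rw [h2]
  ring

/-- Lengthening a leg of a starlike tree. -/
theorem distSum_starlike_update (l : Fin q → ℕ) (k : Fin q) {g : ℕ → ℝ} (h0 : g 0 = 0) :
    distSum g (starlike (Function.update l k (l k + 1))) = distSum g (starlike l) +
      2 * (hsum g (l k + 1) + ∑ j ∈ Finset.univ.erase k,
        ∑ y ∈ Finset.range (l j), g (l k + y + 2)) := by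
  have hsymm : ∀ (l : Fin q → ℕ) (i j : Fin q),
      (if i = j then pathSum g (l i) else legSum g (l i) (l j)) =
      if j = i then pathSum g (l j) else legSum g (l j) (l i) := by
    intro l i j
    by_cases h : i = j
    · subst h
      rfl
    · rw [if_neg h, if_neg (Ne.symm h), legSum_comm]
  rw [distSum_starlike _ h0, distSum_starlike _ h0, sum_sum_symm _ (hsymm _) k,
    sum_sum_symm _ (hsymm l) k, ← Finset.add_sum_erase _ _ (Finset.mem_univ k),
    ← Finset.add_sum_erase _ (fun i => hsum g (l i)) (Finset.mem_univ k)]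
  have hne : ∀ j ∈ Finset.univ.erase k, Function.update l k (l k + 1) j = l j := fun j hj =>
    Function.update_of_ne (Finset.ne_of_mem_erase hj) _ _
  have h1 : ∑ i ∈ Finset.univ.erase k, hsum g (Function.update l k (l k + 1) i) =
      ∑ i ∈ Finset.univ.erase k, hsum g (l i) :=
    Finset.sum_congr rfl fun i hi => by rw [hne i hi]
  have h2 : (∑ i ∈ Finset.univ.erase k, ∑ j ∈ Finset.univ.erase k,
      if i = j then pathSum g (Function.update l k (l k + 1) i)
        else legSum g (Function.update l k (l k + 1) i) (Function.update l k (l k + 1) j)) =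
      ∑ i ∈ Finset.univ.erase k, ∑ j ∈ Finset.univ.erase k,
        if i = j then pathSum g (l i) else legSum g (l i) (l j) :=
    Finset.sum_congr rfl fun i hi => Finset.sum_congr rfl fun j hj => by rw [hne i hi, hne j hj]
  have h3 : (∑ j ∈ Finset.univ.erase k, if k = j then pathSum g (Function.update l k (l k + 1) k)
        else legSum g (Function.update l k (l k + 1) k) (Function.update l k (l k + 1) j)) =
      (∑ j ∈ Finset.univ.erase k, if k = j then pathSum g (l k) else legSum g (l k) (l j)) +
        ∑ j ∈ Finset.univ.erase k, ∑ y ∈ Finset.range (l j), g (l k + y + 2) := by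
    rw [← Finset.sum_add_distrib]
    refine Finset.sum_congr rfl fun j hj => ?_
    have hkj : k ≠ j := (Finset.ne_of_mem_erase hj).symm
    rw [if_neg hkj, if_neg hkj, hne j hj, Function.update_self, legSum_succ]
  rw [h1, h2, h3, if_pos rfl, if_pos rfl, Function.update_self, pathSum_succ h0, hsum_succ]
  ring

end Starlike

/-! ### Recognition of starlike trees -/

section Recognition

variable {V : Type} [Fintype V] {T : SimpleGraph V}

theorem eq_of_mem_sub_of_dist_eq (hT : T.IsTree) {r x y z : V} (hx : z ∈ sub T r x)
    (hy : z ∈ sub T r y) (h : T.dist r x = T.dist r y) : x = y := by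
  have h1 := mem_sub.1 (mem_sub_of_le hT hx hy h.le)
  exact (hT.connected.dist_eq_zero_iff).1 (by omega)

/-- A tree in which exactly one of the vertices `z i` lies below each vertex other than the root
`c` is starlike. -/
theorem nonempty_iso_starlike (hT : T.IsTree) {q : ℕ} (c : V) (z : Fin q → V)
    (hex : ∀ x, x ≠ c → ∃ i, z i ∈ sub T c x)
    (huniq : ∀ x, x ≠ c → ∀ i j, z i ∈ sub T c x → z j ∈ sub T c x → i = j)
    {l : Fin q → ℕ} (hl : ∀ i, T.dist c (z i) = l i) : Nonempty (T ≃g starlike l) := by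
  have hgeo := fun i => exists_geodesic hT.connected (hl i)
  choose p hp0 hpl hp using hgeo
  have hd : ∀ i a, a ≤ l i → T.dist c (p i a) = a := by
    intro i a ha
    conv_lhs => rw [← hp0 i]
    rw [hp i 0 a (by omega) ha]
    omega
  have hmem : ∀ i a, a ≤ l i → z i ∈ sub T c (p i a) := by
    intro i a ha
    rw [mem_sub, hl, hd i a ha]
    conv_rhs => rw [← hpl i]
    rw [hp i a (l i) ha le_rfl]
    omega
  have hpc : ∀ i a, a ≤ l i → 0 < a → p i a ≠ c := by
    intro i a ha h0 h
    have := hd i a ha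
    rw [h, T.dist_self] at this
    omega
  let f : Option (Σ i : Fin q, Fin (l i)) → V := fun x => x.elim c fun r => p r.1 (r.2.val + 1)
  have hf : Function.Bijective f := by
    constructor
    · rintro (_ | ⟨i, a⟩) (_ | ⟨j, b⟩) h
      · rfl
      · exact absurd h.symm (hpc j (b.val + 1) b.isLt (by omega))
      · exact absurd h (hpc i (a.val + 1) a.isLt (by omega))
      · have h : p i (a.val + 1) = p j (b.val + 1) := h
        have h1 := hmem i (a.val + 1) a.isLt
        rw [h] at h1
        obtain rfl := huniq _ (hpc j (b.val + 1) b.isLt (by omega)) i j h1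
          (hmem j (b.val + 1) b.isLt)
        have h2 := hd i (a.val + 1) a.isLt
        rw [h, hd i (b.val + 1) b.isLt] at h2
        have : a = b := Fin.ext (by omega)
        rw [this]
    · intro x
      by_cases hx : x = c
      · exact ⟨none, hx.symm⟩
      · obtain ⟨i, hi⟩ := hex x hx
        have h1 := mem_sub.1 hi
        have h2 := hT.connected.pos_dist_of_ne (Ne.symm hx)
        rw [hl] at h1
        refine ⟨some ⟨i, ⟨T.dist c x - 1, by omega⟩⟩, ?_⟩
        change p i (T.dist c x - 1 + 1) = x
        refine eq_of_mem_sub_of_dist_eq hT (hmem i _ (by omega)) hi ?_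
        rw [hd i _ (by omega)]
        omega
  obtain ⟨φ⟩ := nonempty_iso_of_bijective (isTree_starlike l) hT f hf (by
    have h0 : ∀ i (a : Fin (l i)), a.val = 0 → T.Adj c (p i (a.val + 1)) := by
      intro i a ha
      rw [← dist_eq_one_iff_adj, hd i _ a.isLt]
      omega
    rintro (_ | ⟨i, a⟩) (_ | ⟨j, b⟩) h
    · exact h.elim
    · exact h0 j b h
    · exact (h0 i a h).symm
    · obtain ⟨rfl, h⟩ : i = j ∧ (a.val + 1 = b.val ∨ b.val + 1 = a.val) := h
      change T.Adj (p i (a.val + 1)) (p i (b.val + 1))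
      rw [← dist_eq_one_iff_adj, hp i _ _ a.isLt b.isLt]
      omega)
  exact ⟨φ.symm⟩

end Recognition

end TreeIndices

namespace TreeIndices
open SimpleGraph Classical

/-! ### Even distributions -/

section Balanced

/-- `N` distributed over `q` places as evenly as possible. -/
abbrev balanced (q N : ℕ) : Fin q → ℕ := fun i => N / q + if i.val < N % q then 1 else 0

theorem sum_ite_val_lt {q r : ℕ} (h : r ≤ q) : ∑ i : Fin q, (if i.val < r then 1 else 0) = r := by
  rw [Finset.sum_boole, Fin.card_filter_val_lt, min_eq_right h]
  rfl

theorem sum_balanced {q : ℕ} (hq : 0 < q) (N : ℕ) : ∑ i, balanced q N i = N := by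
  rw [Finset.sum_add_distrib, sum_ite_val_lt (Nat.mod_lt N hq).le, Finset.sum_const,
    Finset.card_univ, Fintype.card_fin, smul_eq_mul, Nat.div_add_mod]

/-- Leg lengths differ by at most one, so either every leg is at least `t - 1` long and no
subtraction is truncated, or every leg contributes `0`. -/
theorem edgeCount_balanced_le {q : ℕ} (hq : 0 < q) (N : ℕ) {t : ℕ} (ht : 1 ≤ t) :
    edgeCount (starlike (balanced q N)) t ≤ N - q * (t - 1) := by
  refine (edgeCount_starlike_le _ ht).trans ?_
  rcases Nat.lt_or_ge (N / q + 1) t with h | h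
  · rw [Finset.sum_eq_zero fun i _ => ?_]
    · exact Nat.zero_le _
    · simp only [balanced]
      split_ifs <;> omega
  · have h1 : ∑ i, (balanced q N i + 1 - t) + q * (t - 1) = N := by
      conv_rhs => rw [← sum_balanced hq N]
      have : q * (t - 1) = ∑ _i : Fin q, (t - 1) := by simp
      rw [this, ← Finset.sum_add_distrib]
      refine Finset.sum_congr rfl fun i _ => ?_
      simp only [balanced]
      omega
    omega

theorem exists_perm_balanced {q N : ℕ} (hq : 0 < q) {l : Fin q → ℕ}
    (hl : ∀ i, l i = N / q ∨ l i = N / q + 1) (hsum : ∑ i, l i = N) :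
    ∃ σ : Equiv.Perm (Fin q), ∀ i, l (σ i) = balanced q N i := by
  have h1 : ∑ i, l i = q * (N / q) + (Finset.univ.filter fun i => l i = N / q + 1).card := by
    rw [Finset.card_filter]
    have : q * (N / q) = ∑ _i : Fin q, N / q := by simp
    rw [this, ← Finset.sum_add_distrib]
    refine Finset.sum_congr rfl fun i _ => ?_
    rcases hl i with h | h <;> simp [h]
  have h2 : (Finset.univ.filter fun i => l i = N / q + 1).card = N % q := by
    have := Nat.div_add_mod N q
    omega
  have h3 : Fintype.card {i : Fin q // i.val < N % q} = Fintype.card {i // l i = N / q + 1} := by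
    rw [Fintype.card_subtype, Fintype.card_subtype, h2, Fin.card_filter_val_lt,
      min_eq_right (Nat.mod_lt N hq).le]
  let e := Fintype.equivOfCardEq h3
  refine ⟨e.extendSubtype, fun i => ?_⟩
  by_cases h : i.val < N % q
  · rw [e.extendSubtype_mem i h]
    simp [balanced, h]
  · have := e.extendSubtype_not_mem i h
    rw [(hl _).resolve_right this]
    simp [balanced, h]

end Balanced

/-! ### Centroids and lower bounds for edge counts -/

section Centroid

variable {V : Type} [Fintype V] {T : SimpleGraph V}

/-- The leaves of a graph. -/
noncomputable def leaves (T : SimpleGraph V) : Finset V :=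
  Finset.univ.filter fun v => T.degree v = 1

theorem mem_leaves {v : V} : v ∈ leaves T ↔ T.degree v = 1 := by
  simp [leaves]

/-- A vertex with the smallest total distance works: passing from `c` to a neighbour `b` changes the
total by the difference of the two sides of the edge, so the side of `b` cannot be the larger one.
-/
theorem exists_centroid (hT : T.IsTree) :
    ∃ c, ∀ x, x ≠ c → 2 * (sub T c x).card ≤ Fintype.card V := by
  obtain ⟨v⟩ := hT.connected.nonempty
  obtain ⟨c, -, hc⟩ := Finset.exists_min_image Finset.univ (fun c => ∑ y, T.dist c y)
    ⟨v, Finset.mem_univ v⟩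
  refine ⟨c, fun x hx => ?_⟩
  obtain ⟨b, hb, hxb⟩ := exists_branch hT hx
  have h1 := Finset.card_le_card (sub_subset hT.connected hxb)
  have hside : side T b c = sub T c b := by
    refine side_eq_sub hT hb.symm ?_
    rw [dist_eq_one_iff_adj.2 hb, T.dist_self]
  have h2 : ∑ y, T.dist c y + (side T c b).card = ∑ y, T.dist b y + (side T b c).card := by
    rw [Finset.card_eq_sum_ones, Finset.card_eq_sum_ones, ← Finset.sum_filter_add_sum_filter_not
      Finset.univ (fun y => y ∈ side T b c), ← Finset.sum_filter_add_sum_filter_not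
      Finset.univ (fun y => y ∈ side T b c) (fun y => T.dist b y)]
    have e1 : (Finset.univ.filter fun y => y ∈ side T b c) = side T b c := by simp
    have e2 : (Finset.univ.filter fun y => ¬ y ∈ side T b c) = side T c b := by
      rw [← side_compl hT hb.symm]
      ext y
      simp
    rw [e1, e2]
    have e3 : ∑ y ∈ side T b c, T.dist c y = ∑ y ∈ side T b c, T.dist b y +
        ∑ y ∈ side T b c, 1 := by
      rw [← Finset.sum_add_distrib]
      refine Finset.sum_congr rfl fun y hy => ?_
      rw [T.dist_comm (u := c), T.dist_comm (u := b), (mem_side_iff hT hb.symm).1 hy]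
    have e4 : ∑ y ∈ side T c b, T.dist b y = ∑ y ∈ side T c b, T.dist c y +
        ∑ y ∈ side T c b, 1 := by
      rw [← Finset.sum_add_distrib]
      refine Finset.sum_congr rfl fun y hy => ?_
      rw [T.dist_comm (u := c), T.dist_comm (u := b), (mem_side_iff hT hb).1 hy]
    rw [e3, e4]
    ring
  have h3 := hc b (Finset.mem_univ b)
  have h4 := sideCard_add hT hb
  simp only [sideCard] at h4
  rw [← hside] at h1
  omega

theorem degree_eq_one_of_card_sub (hT : T.IsTree) {c z : V} (hz : z ≠ c)
    (h : (sub T c z).card = 1) : T.degree z = 1 := by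
  rw [degree_eq_one_iff_existsUnique_adj]
  refine ⟨par T c z, par_adj hT.connected hz, fun w hw => ?_⟩
  have h1 := dist_ne_of_adj hT hw c
  have h2 := hw.diff_dist_adj (u := c)
  refine eq_par hT hw ?_
  by_contra hne
  have h3 : w ∈ sub T c z := by
    rw [mem_sub, dist_eq_one_iff_adj.2 hw]
    omega
  exact hw.ne (Finset.card_le_one.1 h.le z self_mem_sub w h3)

theorem exists_leaf_mem_sub (hT : T.IsTree) {c x : V} (hx : x ≠ c) :
    ∃ z ∈ (leaves T).erase c, z ∈ sub T c x := by
  obtain ⟨z, hz, hz1⟩ := exists_mem_sub_card_eq_one hT.connected c x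
  have hzc : z ≠ c := fun h => root_notMem_sub hT.connected hx (h ▸ hz)
  exact ⟨z, Finset.mem_erase.2 ⟨hzc, mem_leaves.2 (degree_eq_one_of_card_sub hT hzc hz1)⟩, hz⟩

theorem mem_sub_or_mem_sub (hT : T.IsTree) {c x y z : V} (hx : z ∈ sub T c x)
    (hy : z ∈ sub T c y) : y ∈ sub T c x ∨ x ∈ sub T c y := by
  rcases le_total (T.dist c x) (T.dist c y) with h | h
  · exact Or.inl (mem_sub_of_le hT hx hy h)
  · exact Or.inr (mem_sub_of_le hT hy hx h)

theorem eq_of_card_sub_eq (hT : T.IsTree) {c x y z : V} (hx : z ∈ sub T c x)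
    (hy : z ∈ sub T c y) (h : (sub T c x).card = (sub T c y).card) : x = y := by
  by_contra hne
  rcases mem_sub_or_mem_sub hT hx hy with h1 | h1
  · have := card_sub_lt hT.connected h1 (Ne.symm hne)
    omega
  · have := card_sub_lt hT.connected h1 hne
    omega

/-- The vertices above `z` whose branches have at most `t` vertices. -/
noncomputable def chain (T : SimpleGraph V) (c z : V) (t : ℕ) : Finset V :=
  (Finset.univ.erase c).filter fun x => (sub T c x).card ≤ t ∧ z ∈ sub T c x

theorem image_chain_subset (c z : V) (t : ℕ) :
    (chain T c z t).image (fun x => (sub T c x).card) ⊆ Finset.Icc 1 t := by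
  intro m hm
  obtain ⟨x, hx, rfl⟩ := Finset.mem_image.1 hm
  rw [chain, Finset.mem_filter] at hx
  rw [Finset.mem_Icc]
  exact ⟨Finset.card_pos.2 ⟨x, self_mem_sub⟩, hx.2.1⟩

theorem card_image_chain (hT : T.IsTree) (c z : V) (t : ℕ) :
    ((chain T c z t).image fun x => (sub T c x).card).card = (chain T c z t).card := by
  refine Finset.card_image_of_injOn fun x hx y hy h => ?_
  rw [Finset.mem_coe, chain, Finset.mem_filter] at hx hy
  exact eq_of_card_sub_eq hT hx.2.2 hy.2.2 h

/-- Branches containing `z` are nested, so those with at most `t` vertices have different sizes in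
`1, …, t`. -/
theorem card_chain_le (hT : T.IsTree) (c z : V) (t : ℕ) : (chain T c z t).card ≤ t := by
  rw [← card_image_chain hT]
  exact (Finset.card_le_card (image_chain_subset c z t)).trans (by simp)

theorem sum_card_chain (c : V) (t : ℕ) : ∑ z ∈ (leaves T).erase c, (chain T c z t).card =
    ∑ x ∈ (Finset.univ.erase c).filter (fun x => (sub T c x).card ≤ t),
      (((leaves T).erase c).filter fun z => z ∈ sub T c x).card := by
  simp only [chain, Finset.card_filter]
  rw [Finset.sum_comm' (t' := Finset.univ.erase c) (s' := fun _ => (leaves T).erase c)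
    (by simp), Finset.sum_filter]
  refine Finset.sum_congr rfl fun x _ => ?_
  split_ifs with h
  · exact Finset.sum_congr rfl fun z _ => by simp [h]
  · exact Finset.sum_eq_zero fun z _ => by simp [h]

/-- Double counting of pairs of a small branch and a leaf in it: every branch contains a leaf. -/
theorem card_small_le_sum (hT : T.IsTree) (c : V) (t : ℕ) :
    ((Finset.univ.erase c).filter fun x => (sub T c x).card ≤ t).card ≤
      ∑ z ∈ (leaves T).erase c, (chain T c z t).card := by
  rw [sum_card_chain, Finset.card_eq_sum_ones]
  refine Finset.sum_le_sum fun x hx => ?_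
  obtain ⟨z, hz, hzx⟩ := exists_leaf_mem_sub hT
    (Finset.ne_of_mem_erase (Finset.mem_filter.1 hx).1)
  exact Finset.card_pos.2 ⟨z, Finset.mem_filter.2 ⟨hz, hzx⟩⟩

theorem sum_card_chain_le (hT : T.IsTree) (c : V) {q : ℕ} (hq : (leaves T).card ≤ q) (t : ℕ) :
    ∑ z ∈ (leaves T).erase c, (chain T c z t).card ≤ q * t := by
  refine (Finset.sum_le_card_nsmul _ _ t fun z _ => card_chain_le hT c z t).trans ?_
  rw [smul_eq_mul]
  exact Nat.mul_le_mul_right t ((Finset.card_erase_le).trans hq)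

/-- With a centroid as root the lower side of every edge is a smallest one, so `μ` is the size of
the branch. -/
theorem edgeCount_add_card_small (hT : T.IsTree) {c : V}
    (hc : ∀ x, x ≠ c → 2 * (sub T c x).card ≤ Fintype.card V) {t : ℕ} (ht : 1 ≤ t) :
    edgeCount T t + ((Finset.univ.erase c).filter fun x => (sub T c x).card ≤ t - 1).card + 1 =
      Fintype.card V := by
  have h1 : edgeCount T t =
      ((Finset.univ.erase c).filter fun x => ¬ (sub T c x).card ≤ t - 1).card := by
    rw [edgeCount_eq hT c]
    congr 1
    refine Finset.filter_congr fun x hx => ?_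
    have := hc x (Finset.ne_of_mem_erase hx)
    omega
  rw [h1, add_comm (Finset.card _), Finset.card_filter_add_card_filter_not,
    Finset.card_erase_of_mem (Finset.mem_univ c), Finset.card_univ]
  have : 0 < Fintype.card V := Fintype.card_pos_iff.2 ⟨c⟩
  omega

theorem le_edgeCount_of_leaves (hT : T.IsTree) {q : ℕ} (hq : (leaves T).card ≤ q) {t : ℕ}
    (ht : 1 ≤ t) : Fintype.card V - 1 - q * (t - 1) ≤ edgeCount T t := by
  obtain ⟨c, hc⟩ := exists_centroid hT
  have h1 := edgeCount_add_card_small hT hc ht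
  have h2 := (card_small_le_sum hT c (t - 1)).trans (sum_card_chain_le hT c hq (t - 1))
  omega

/-- A tree with the edge counts of a balanced starlike tree is balanced starlike. -/
theorem nonempty_iso_balanced (hT : T.IsTree) {q N : ℕ} (hq : 0 < q)
    (hL : (leaves T).card ≤ q) (hn : Fintype.card V = N + 1) (hqN : q ≤ N)
    (hle : ∀ t, 1 ≤ t → edgeCount T t ≤ N - q * (t - 1)) :
    Nonempty (T ≃g starlike (balanced q N)) := by
  obtain ⟨c, hc⟩ := exists_centroid hT
  obtain ⟨s, hs⟩ : ∃ s, s = N / q := ⟨_, rfl⟩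
  have hs1 : 1 ≤ s := hs ▸ (Nat.one_le_div_iff hq).2 hqN
  have hdm := Nat.div_add_mod N q
  rw [← hs] at hdm
  have hmod := Nat.mod_lt N hq
  set Z := (leaves T).erase c with hZ
  have hZq : Z.card ≤ q := Finset.card_erase_le.trans hL
  -- all branches have at most `s + 1` vertices
  have hmax : ∀ x, x ≠ c → (sub T c x).card ≤ s + 1 := by
    have h1 := hle (s + 2) (by omega)
    have h2 := edgeCount_add_card_small hT hc (t := s + 2) (by omega)
    have h3 : q * (s + 2 - 1) = q * s + q := by
      rw [show s + 2 - 1 = s + 1 by omega, mul_add, mul_one]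
    have h4 : ((Finset.univ.erase c).filter fun x => (sub T c x).card ≤ s + 2 - 1).card =
        (Finset.univ.erase c).card := by
      rw [Finset.card_erase_of_mem (Finset.mem_univ c), Finset.card_univ]
      omega
    intro x hx
    exact Finset.card_filter_eq_iff.1 h4 x (Finset.mem_erase.2 ⟨hx, Finset.mem_univ x⟩)
  have hsmall : q * s ≤ ((Finset.univ.erase c).filter fun x => (sub T c x).card ≤ s).card := by
    have h1 := hle (s + 1) (by omega)
    have h2 := edgeCount_add_card_small hT hc (t := s + 1) (by omega)
    rw [Nat.add_sub_cancel] at h1 h2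
    omega
  have hsum := card_small_le_sum hT c s
  have hsum' := sum_card_chain_le hT c hL s
  -- every chain has a vertex of each size up to `s`
  have hchain : ∀ z ∈ Z, (chain T c z s).card = s := by
    have h1 : ∑ z ∈ Z, (chain T c z s).card = ∑ z ∈ Z, s := by
      refine le_antisymm (Finset.sum_le_sum fun z _ => card_chain_le hT c z s) ?_
      rw [Finset.sum_const, smul_eq_mul]
      exact (Nat.mul_le_mul_right s hZq).trans (hsmall.trans hsum)
    exact (Finset.sum_eq_sum_iff_of_le fun z _ => card_chain_le hT c z s).1 h1
  have hZcard : Z.card = q := by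
    refine le_antisymm hZq ?_
    have h1 : q * s ≤ Z.card * s := by
      refine (hsmall.trans hsum).trans ?_
      rw [Finset.sum_congr rfl hchain, Finset.sum_const, smul_eq_mul]
    exact Nat.le_of_mul_le_mul_right h1 hs1
  have hsize : ∀ z ∈ Z, ∃ x, x ≠ c ∧ z ∈ sub T c x ∧ (sub T c x).card = s := by
    intro z hz
    have h1 : (chain T c z s).image (fun x => (sub T c x).card) = Finset.Icc 1 s := by
      refine Finset.eq_of_subset_of_card_le (image_chain_subset c z s) ?_
      rw [card_image_chain hT, hchain z hz]
      simp
    have h2 : s ∈ Finset.Icc 1 s := Finset.mem_Icc.2 ⟨hs1, le_rfl⟩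
    rw [← h1, Finset.mem_image] at h2
    obtain ⟨x, hx, hxs⟩ := h2
    rw [chain, Finset.mem_filter] at hx
    exact ⟨x, Finset.ne_of_mem_erase hx.1, hx.2.2, hxs⟩
  -- below each vertex there is only one leaf
  have huniq_small : ∀ x, x ≠ c → (sub T c x).card ≤ s → ∀ z ∈ Z, ∀ z' ∈ Z, z ∈ sub T c x →
      z' ∈ sub T c x → z = z' := by
    intro x hx hxs z hz z' hz' h h'
    have h1 : ∀ x ∈ (Finset.univ.erase c).filter (fun x => (sub T c x).card ≤ s),
        1 ≤ (Z.filter fun z => z ∈ sub T c x).card := by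
      intro x hx
      obtain ⟨z, hz, hzx⟩ := exists_leaf_mem_sub hT
        (Finset.ne_of_mem_erase (Finset.mem_filter.1 hx).1)
      exact Finset.card_pos.2 ⟨z, Finset.mem_filter.2 ⟨hz, hzx⟩⟩
    have h2 : ∑ x ∈ (Finset.univ.erase c).filter (fun x => (sub T c x).card ≤ s), 1 =
        ∑ x ∈ (Finset.univ.erase c).filter (fun x => (sub T c x).card ≤ s),
          (Z.filter fun z => z ∈ sub T c x).card := by
      rw [hZ, ← sum_card_chain, ← Finset.card_eq_sum_ones]
      omega
    have h3 := (Finset.sum_eq_sum_iff_of_le h1).1 h2 x (Finset.mem_filter.2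
      ⟨Finset.mem_erase.2 ⟨hx, Finset.mem_univ x⟩, hxs⟩)
    exact Finset.card_le_one.1 h3.symm.le z (Finset.mem_filter.2 ⟨hz, h⟩) z'
      (Finset.mem_filter.2 ⟨hz', h'⟩)
  have huniq : ∀ x, x ≠ c → ∀ z ∈ Z, ∀ z' ∈ Z, z ∈ sub T c x → z' ∈ sub T c x → z = z' := by
    intro x hx z hz z' hz' h h'
    rcases Nat.lt_or_ge s (sub T c x).card with hlt | hge
    · have hxs : (sub T c x).card = s + 1 := le_antisymm (hmax x hx) hlt
      obtain ⟨y, hyc, hzy, hys⟩ := hsize z hz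
      have hyx : y ∈ sub T c x := by
        rcases mem_sub_or_mem_sub hT h hzy with h1 | h1
        · exact h1
        · have := Finset.card_le_card (sub_subset hT.connected h1)
          omega
      have hne : y ≠ x := by
        rintro rfl
        omega
      have hxy : x ∉ sub T c y := by
        intro h1
        have := card_sub_lt hT.connected h1 hne.symm
        omega
      -- A branch of the largest size `s + 1` consists of its top and a branch of size `s`, so it
      -- has no leaf beyond those of the small branch.
      have heq : insert x (sub T c y) = sub T c x := by
        refine Finset.eq_of_subset_of_card_le ?_ ?_
        · exact Finset.insert_subset self_mem_sub (sub_subset hT.connected hyx)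
        · rw [Finset.card_insert_of_notMem hxy]
          omega
      have hz'y : z' ∈ sub T c y := by
        rw [← heq, Finset.mem_insert] at h'
        refine h'.resolve_left ?_
        rintro rfl
        have := sub_leaf hT (mem_leaves.1 (Finset.mem_of_mem_erase hz'))
          (Finset.ne_of_mem_erase hz')
        rw [this, Finset.card_singleton] at hxs
        omega
      exact huniq_small y hyc hys.le z hz z' hz' hzy hz'y
    · exact huniq_small x hx hge z hz z' hz' h h'
  have hdist : ∀ z ∈ Z, T.dist c z = s ∨ T.dist c z = s + 1 := by
    intro z hz
    -- The distance from the root counts ancestors, and since no branch exceeds `s + 1` they all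
    -- belong to this chain.
    have h1 : T.dist c z = (chain T c z (s + 1)).card := by
      rw [← card_ancestors hT, chain]
      congr 1
      refine Finset.filter_congr fun x hx => ?_
      have := hmax x (Finset.ne_of_mem_erase hx)
      tauto
    have h2 := card_chain_le hT c z (s + 1)
    have h3 : (chain T c z s).card ≤ (chain T c z (s + 1)).card := by
      refine Finset.card_le_card fun x hx => ?_
      rw [chain, Finset.mem_filter] at hx ⊢
      exact ⟨hx.1, by omega, hx.2.2⟩
    have h4 := hchain z hz
    omega
  have e : Fin q ≃ Z := (Fintype.equivFinOfCardEq (by rw [Fintype.card_coe, hZcard])).symm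
  have hiso : ∀ (σ : Equiv.Perm (Fin q)) (l : Fin q → ℕ),
      (∀ i, T.dist c (e (σ i)) = l i) → Nonempty (T ≃g starlike l) := by
    intro σ l hl
    refine nonempty_iso_starlike hT c (fun i => (e (σ i)).1) ?_ ?_ hl
    · intro x hx
      obtain ⟨z, hz, hzx⟩ := exists_leaf_mem_sub hT hx
      exact ⟨σ.symm (e.symm ⟨z, hz⟩), by simpa using hzx⟩
    · intro x hx i j hi hj
      have := huniq x hx _ (e (σ i)).2 _ (e (σ j)).2 hi hj
      exact σ.injective (e.injective (Subtype.ext this))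
  obtain ⟨φ⟩ := hiso 1 (fun i => T.dist c (e i)) fun i => rfl
  have hcard := Fintype.card_congr φ.toEquiv
  rw [card_starlike, hn] at hcard
  obtain ⟨σ, hσ⟩ := exists_perm_balanced hq (N := N) (l := fun i => T.dist c (e i))
    (fun i => by rw [← hs]; exact hdist _ (e i).2) (by omega)
  exact hiso σ _ hσ

end Centroid

end TreeIndices

namespace TreeIndices
open SimpleGraph Classical

/-! ### Packing vertices into levels over a longest path -/

section Packing

/-- Twice the number of pairs of distinct edges of a path of length `d`. -/
noncomputable def quad (d : ℕ) : ℝ := (d : ℝ) * (d - 1)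

theorem quad_zero : quad 0 = 0 := by simp [quad]

theorem quad_succ (d : ℕ) : quad (d + 1) = quad d + 2 * d := by
  simp only [quad]
  push_cast
  ring

theorem quad_monotone : Monotone quad :=
  monotone_nat_of_le_succ fun d => by
    rw [quad_succ]
    have : (0 : ℝ) ≤ d := Nat.cast_nonneg d
    linarith

theorem wt_eq_quad (α : ℝ) (d : ℕ) : wt α d = wt 0 d + α / 2 * quad d := by
  simp only [wt, quad]
  ring

theorem distSum_wt_eq {V : Type} [Fintype V] (T : SimpleGraph V) (α : ℝ) :
    distSum (wt α) T = distSum (wt 0) T + α / 2 * distSum quad T := by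
  simp only [distSum, Finset.mul_sum, ← Finset.sum_add_distrib, ← wt_eq_quad]

/-- The least value of `quad a + quad b` for `a + b = D + 2 * h`. -/
noncomputable def mid (D h : ℕ) : ℝ := quad (D / 2 + h) + quad ((D + 1) / 2 + h)

theorem mid_le {a b D h : ℕ} (hab : a + b = D + 2 * h) : mid D h ≤ quad a + quad b := by
  have h1 := mul_le_halves hab
  rw [show (D + 2 * h) / 2 = D / 2 + h by omega,
    show (D + 2 * h + 1) / 2 = (D + 1) / 2 + h by omega] at h1
  have h2 : (a : ℝ) * b ≤ ((D / 2 + h : ℕ) : ℝ) * ((D + 1) / 2 + h : ℕ) := by exact_mod_cast h1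
  have h3 : ((D / 2 + h : ℕ) : ℝ) + ((D + 1) / 2 + h : ℕ) = a + b := by
    have : D / 2 + h + ((D + 1) / 2 + h) = a + b := by omega
    exact_mod_cast this
  simp only [mid, quad]
  generalize ((D / 2 + h : ℕ) : ℝ) = x at *
  generalize (((D + 1) / 2 + h : ℕ) : ℝ) = y at *
  have h4 : y = a + b - x := by linarith
  subst h4
  linarith

theorem mid_mono {D D' h h' : ℕ} (hD : D ≤ D') (hh : h ≤ h') : mid D h ≤ mid D' h' :=
  add_le_add (quad_monotone (by omega)) (quad_monotone (by omega))

theorem mid_le_two_mul {D h : ℕ} (hh : h ≤ D / 2) : mid D h ≤ 2 * quad D := by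
  rw [two_mul]
  exact add_le_add (quad_monotone (by omega)) (quad_monotone (by omega))

/-- If each level above the ground has at most `c` elements, then the heights are at least those of
the arrangement that fills the levels one after another. -/
theorem sum_packing_le {V : Type} {φ : ℕ → ℝ} (hφ : Monotone φ) {c : ℕ} {h : V → ℕ} (N : ℕ) :
    ∀ O : Finset V, O.card = N → (∀ y ∈ O, 1 ≤ h y) →
      (∀ m, (O.filter fun y => h y = m).card ≤ c) →
      ∑ i ∈ Finset.range N, φ (1 + i / c) ≤ ∑ y ∈ O, φ (h y) := by
  induction N with
  | zero =>
    intro O hO _ _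
    rw [Finset.card_eq_zero.1 hO]
    simp
  | succ N ih =>
    intro O hO h1 hc
    obtain ⟨y, hy, hmax⟩ := Finset.exists_max_image O h (Finset.card_pos.1 (by omega))
    have h2 := ih (O.erase y) (by rw [Finset.card_erase_of_mem hy]; omega)
      (fun z hz => h1 z (Finset.mem_of_mem_erase hz))
      (fun m => (Finset.card_le_card
        (Finset.filter_subset_filter _ (Finset.erase_subset y O))).trans (hc m))
    -- The levels up to that of the highest element `y` hold at most `c` elements each, so `y` is at
    -- least as high as the last position `1 + N / c` of the packing.
    have h3 : O.card ≤ c * (Finset.Icc 1 (h y)).card :=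
      Finset.card_le_mul_card_image_of_maps_to
        (fun z hz => Finset.mem_Icc.2 ⟨h1 z hz, hmax z hz⟩) c fun m _ => hc m
    rw [Nat.card_Icc, Nat.add_sub_cancel, hO] at h3
    have h4 : N / c < h y := Nat.div_lt_of_lt_mul (by omega)
    rw [Finset.sum_range_succ, ← Finset.sum_erase_add O _ hy]
    exact add_le_add h2 (hφ (by omega))

/-- The packing fills `s` complete levels and puts `e` elements on the next one. -/
theorem sum_packing_eq (φ : ℕ → ℝ) {c : ℕ} (hc : 0 < c) (s : ℕ) {e : ℕ} (he : e ≤ c) :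
    ∑ i ∈ Finset.range (c * s + e), φ (1 + i / c) =
      c * ∑ y ∈ Finset.range s, φ (y + 1) + e * φ (s + 1) := by
  have h1 : ∀ s, ∀ e ≤ c, ∑ i ∈ Finset.range e, φ (1 + (c * s + i) / c) = e * φ (s + 1) := by
    intro s e he
    rw [Finset.sum_congr rfl fun i hi => by
      rw [Nat.mul_add_div hc, Nat.div_eq_of_lt ((Finset.mem_range.1 hi).trans_le he), add_zero,
        add_comm], Finset.sum_const, Finset.card_range, nsmul_eq_mul]
  rw [Finset.sum_range_add, h1 s e he]
  congr 1
  induction s with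
  | zero => simp
  | succ s ih =>
    rw [mul_add, mul_one, Finset.sum_range_add, ih, h1 s c le_rfl, Finset.sum_range_succ]
    ring

/-- A lower bound for the contribution to the distance sum of the two ends of a longest path of
length `D` in a tree with `N + 1` vertices and at most `c + 2` leaves. -/
noncomputable def endBound (c N D : ℕ) : ℝ :=
  2 * hsum quad D - quad D + ∑ i ∈ Finset.range (N - D), mid D (1 + i / c)

/-- Lengthening the path moves `D' - D` vertices from the packing onto it. By `hN` their heights
were at most `D / 2`, so each contributed at most `2 * quad D`, while each new path vertex brings at
least that much. -/
theorem endBound_le {c N D D' : ℕ} (hDD : D ≤ D') (hD' : D' ≤ N)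
    (hN : N - D ≤ c * (D / 2)) : endBound c N D ≤ endBound c N D' := by
  have h1 : 2 * hsum quad D - quad D + (D' - D : ℕ) * (2 * quad D) ≤
      2 * hsum quad D' - quad D' := by
    obtain ⟨e, rfl⟩ := Nat.exists_eq_add_of_le hDD
    rw [Nat.add_sub_cancel_left]
    clear hDD hD'
    induction e with
    | zero => simp
    | succ e ih =>
      rw [← add_assoc, hsum_succ]
      have h2 : quad D ≤ quad (D + e) := quad_monotone (by omega)
      have h3 : quad D ≤ quad (D + e + 1) := quad_monotone (by omega)
      push_cast
      linarith
  have h2 : ∑ i ∈ Finset.range (N - D), mid D (1 + i / c) ≤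
      ∑ i ∈ Finset.range (N - D'), mid D' (1 + i / c) + (D' - D : ℕ) * (2 * quad D) := by
    rw [show N - D = N - D' + (D' - D) by omega, Finset.sum_range_add]
    refine add_le_add (Finset.sum_le_sum fun i _ => mid_mono hDD le_rfl) ?_
    refine (Finset.sum_le_card_nsmul (Finset.range (D' - D)) _ (2 * quad D) fun i hi => ?_).trans_eq
      (by rw [Finset.card_range, nsmul_eq_mul])
    refine mid_le_two_mul ?_
    have : (N - D' + i) / c < D / 2 := by
      rw [Finset.mem_range] at hi
      refine Nat.div_lt_of_lt_mul ?_
      omega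
    omega
  simp only [endBound]
  linarith

end Packing

/-! ### The contribution of the ends of a longest path -/

section Ends

variable {V : Type} [Fintype V] {T : SimpleGraph V}

/-- A vertex that becomes a leaf was adjacent to a deleted leaf, and a leaf has only one neighbour,
so new leaves can be matched with deleted ones. -/
theorem card_leaves_prune_le {L : Finset V} (hL : ∀ x ∈ L, T.degree x = 1) :
    (leaves (prune T L)).card ≤ (leaves T).card := by
  have hex : ∀ y : {x // x ∉ L}, ∃ x, (prune T L).degree y = 1 → T.degree y.1 ≠ 1 →
      x ∈ L ∧ T.Adj y.1 x := by
    intro y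
    by_cases h : ∃ x ∈ L, T.Adj y.1 x
    · obtain ⟨x, hx⟩ := h
      exact ⟨x, fun _ _ => hx⟩
    · push Not at h
      exact ⟨y.1, fun hy hy' => absurd (by rw [← degree_prune y h, hy]) hy'⟩
  choose f hfL using hex
  refine Finset.card_le_card_of_injOn (fun y => if T.degree y.1 = 1 then y.1 else f y) ?_ ?_
  · intro y hy
    rw [Finset.mem_coe, mem_leaves] at hy
    simp only
    rw [Finset.mem_coe, mem_leaves]
    by_cases h : T.degree y.1 = 1
    · rw [if_pos h]
      exact h
    · rw [if_neg h]
      exact hL _ (hfL y hy h).1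
  · intro y hy z hz h
    rw [Finset.mem_coe, mem_leaves] at hy hz
    simp only at h
    split_ifs at h with h1 h2 h2
    · exact Subtype.ext h
    · exact absurd (h ▸ (hfL z hz h2).1) y.2
    · exact absurd (h ▸ (hfL y hy h1).1) z.2
    · have e1 := (hfL y hy h1).2
      rw [h] at e1
      exact Subtype.ext (eq_of_degree_one (hL _ (hfL z hz h2).1) e1.symm (hfL z hz h2).2.symm)

theorem degree_eq_one_of_farthest (hT : T.IsTree) {c v : V} (hvc : v ≠ c)
    (hv : ∀ y, T.dist c y ≤ T.dist c v) : T.degree v = 1 := by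
  rw [degree_eq_one_iff_existsUnique_adj]
  refine ⟨par T c v, par_adj hT.connected hvc, fun w hw => eq_par hT hw ?_⟩
  have h1 := dist_ne_of_adj hT hw c
  have h2 := hv w
  have h3 := hw.diff_dist_adj (u := c)
  omega

theorem distSum_two_leaves (hT : T.IsTree) {v w : V} (hvw : v ≠ w) (hv : T.degree v = 1)
    (hw : T.degree w = 1) {g : ℕ → ℝ} (h0 : g 0 = 0) :
    distSum g T = distSum g (prune T {v, w}) +
      2 * (∑ y, (g (T.dist v y) + g (T.dist w y)) - g (T.dist v w)) := by
  have hL : ∀ x ∈ ({v, w} : Finset V), T.degree x = 1 := by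
    intro x hx
    rw [Finset.mem_insert, Finset.mem_singleton] at hx
    rcases hx with rfl | rfl <;> assumption
  have h1 : ∀ f : V → ℝ, ∑ y : {y // y ∉ ({v, w} : Finset V)}, f y = ∑ y, f y - f v - f w := by
    intro f
    rw [← sum_notMem_eq, ← Finset.sum_add_sum_compl ({v, w} : Finset V) f, Finset.sum_pair hvw]
    ring
  rw [distSum_split hT hL, Finset.sum_pair hvw, Finset.sum_pair hvw, Finset.sum_pair hvw,
    Finset.sum_pair hvw, h1 fun y => g (T.dist v y), h1 fun y => g (T.dist w y),
    Finset.sum_add_distrib, T.dist_self, T.dist_self, h0, T.dist_comm (u := w) (v := v)]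
  ring

theorem exists_diameter_ends (hT : T.IsTree) :
    ∃ v w, ∀ x y, T.dist x y ≤ T.dist v w := by
  obtain ⟨a⟩ := hT.connected.nonempty
  obtain ⟨⟨v, w⟩, -, h⟩ := Finset.exists_max_image (Finset.univ : Finset (V × V))
    (fun x => T.dist x.1 x.2) ⟨(a, a), Finset.mem_univ _⟩
  exact ⟨v, w, fun x y => h (x, y) (Finset.mem_univ _)⟩

/-- The distances from the ends of a geodesic, in terms of the height over it. -/
theorem exists_height (hT : T.IsTree) (v w y : V) :
    ∃ h, T.dist v y + T.dist w y = T.dist v w + 2 * h := by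
  obtain ⟨p, hp0, hpm, hp⟩ := exists_geodesic hT.connected (u := v) (v := w) rfl
  obtain ⟨j, hj, h⟩ := exists_foot_path hT (k := T.dist v w + 1) (by omega)
    (fun i j hi hj => hp i j (by omega) (by omega)) y
  refine ⟨T.dist y (p j), ?_⟩
  have h1 := h 0 (by omega)
  have h2 := h (T.dist v w) (by omega)
  rw [hp0, T.dist_comm] at h1
  rw [hpm, T.dist_comm] at h2
  omega

/-- The vertices at height `0` are exactly those of the geodesic, on which each end sees the
distances `0, …, D`. -/
theorem sum_geodesic (hT : T.IsTree) (v w : V) (g : ℕ → ℝ) (h0 : g 0 = 0) {O : Finset V}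
    (hO : ∀ y, y ∈ O ↔ T.dist v y + T.dist w y ≠ T.dist v w) :
    ∑ y, (g (T.dist v y) + g (T.dist w y)) = 2 * hsum g (T.dist v w) +
      ∑ y ∈ O, (g (T.dist v y) + g (T.dist w y)) ∧
      O.card + (T.dist v w + 1) = Fintype.card V := by
  obtain ⟨p, hp0, hpm, hp⟩ := exists_geodesic hT.connected (u := v) (v := w) rfl
  set D := T.dist v w with hD
  have hp' : ∀ i j, i < D + 1 → j < D + 1 → T.dist (p i) (p j) = (i - j) + (j - i) :=
    fun i j hi hj => hp i j (by omega) (by omega)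
  have hinj := injOn_of_dist hp'
  have hinj' : Set.InjOn p (Finset.range (D + 1)) := by
    intro i hi j hj h
    simp only [Finset.coe_range, Set.mem_Iio] at hi hj
    exact congrArg Fin.val (@hinj ⟨i, hi⟩ ⟨j, hj⟩ h)
  have hv : ∀ i, i ≤ D → T.dist v (p i) = i ∧ T.dist w (p i) = D - i := by
    intro i hi
    rw [← hp0, ← hpm, hp 0 i (by omega) hi, hp D i le_rfl hi]
    omega
  have hOc : Oᶜ = (Finset.range (D + 1)).image p := by
    ext y
    rw [Finset.mem_compl, hO, not_not, Finset.mem_image]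
    constructor
    · intro hy
      obtain ⟨j, hj, h⟩ := exists_foot_path hT (k := D + 1) (by omega) hp' y
      refine ⟨j, Finset.mem_range.2 hj, ?_⟩
      have h1 := h 0 (by omega)
      have h2 := h D (by omega)
      rw [hp0, T.dist_comm] at h1
      rw [hpm, T.dist_comm] at h2
      exact ((hT.connected.dist_eq_zero_iff).1 (by omega)).symm
    · rintro ⟨i, hi, rfl⟩
      rw [Finset.mem_range] at hi
      have := hv i (by omega)
      omega
  constructor
  · rw [← Finset.sum_add_sum_compl O, hOc, Finset.sum_image hinj', add_comm]
    congr 1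
    rw [Finset.sum_congr rfl fun i hi => by
      rw [(hv i (by rw [Finset.mem_range] at hi; omega)).1,
        (hv i (by rw [Finset.mem_range] at hi; omega)).2], Finset.sum_add_distrib, two_mul]
    congr 1
    · exact sum_range_eq_hsum h0 D
    · rw [← sum_range_eq_hsum h0 D, ← Finset.sum_range_reflect]
      refine Finset.sum_congr rfl fun i hi => ?_
      rw [Finset.mem_range] at hi
      congr 1
      omega
  · rw [← Finset.card_add_card_compl O, hOc, Finset.card_image_of_injOn hinj', Finset.card_range]

/-- The vertices at a given positive height over a geodesic have different leaves beyond them. -/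
theorem card_height_le (hT : T.IsTree) {v w : V} (hvw : v ≠ w) (hv : T.degree v = 1)
    (hw : T.degree w = 1) {m : ℕ} (hm : 1 ≤ m) :
    (Finset.univ.filter fun y => T.dist v y + T.dist w y = T.dist v w + 2 * m).card + 2 ≤
      (leaves T).card := by
  set E := Finset.univ.filter fun y => T.dist v y + T.dist w y = T.dist v w + 2 * m with hE
  have hEv : ∀ y ∈ E, y ≠ v ∧ w ∉ sub T v y := by
    intro y hy
    rw [hE, Finset.mem_filter] at hy
    constructor
    · rintro rfl
      have := hy.2
      rw [T.dist_self, T.dist_comm] at this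
      omega
    · intro h
      rw [mem_sub, T.dist_comm (u := y)] at h
      omega
  have hex : ∀ y ∈ E, ∃ z ∈ (leaves T).erase v, z ∈ sub T v y := fun y hy =>
    exists_leaf_mem_sub hT (hEv y hy).1
  choose! f hfL hf using hex
  have h1 : E.card ≤ (((leaves T).erase v).erase w).card := by
    refine Finset.card_le_card_of_injOn f ?_ ?_
    · intro y hy
      refine Finset.mem_erase.2 ⟨fun h => (hEv y hy).2 (h ▸ hf y hy), hfL y hy⟩
    -- Since `w` is not below `y`, a proper descendant of `y` is farther than `y` from both ends and
    -- thus lies higher over the geodesic.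
    · have key : ∀ y ∈ E, ∀ y' ∈ E, y' ∈ sub T v y → y' = y := by
        intro y hy y' hy' h
        have hyv := (hEv y hy).1
        have h2 : y' ∈ side T y (par T v y) := by
          rw [side_par hT hyv]
          exact h
        have h3 : w ∈ side T (par T v y) y := by
          rw [← side_compl hT (par_adj hT.connected hyv), Finset.mem_compl, side_par hT hyv]
          exact (hEv y hy).2
        have h4 := dist_crossing hT (par_adj hT.connected hyv) (mem_side.1 h2) (mem_side.1 h3)
        have h5 := (mem_side_iff hT (par_adj hT.connected hyv).symm).1 h3
        have h6 := mem_sub.1 h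
        rw [hE, Finset.mem_filter] at hy hy'
        have h7 := hy.2
        have h8 := hy'.2
        rw [T.dist_comm (u := w) (v := y'), h4, T.dist_comm (u := y'), h6,
          T.dist_comm (u := par T v y)] at h8
        exact ((hT.connected.dist_eq_zero_iff).1 (by omega)).symm
      intro y hy y' hy' h
      have h2 := hf y' hy'
      rw [← h] at h2
      rcases mem_sub_or_mem_sub hT (hf y hy) h2 with h3 | h3
      · exact (key y hy y' hy' h3).symm
      · exact key y' hy' y hy h3
  rw [Finset.card_erase_of_mem (Finset.mem_erase.2 ⟨hvw.symm, mem_leaves.2 hw⟩),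
    Finset.card_erase_of_mem (mem_leaves.2 hv)] at h1
  have h2 : ({v, w} : Finset V).card ≤ (leaves T).card := by
    refine Finset.card_le_card fun x hx => ?_
    rw [Finset.mem_insert, Finset.mem_singleton] at hx
    rcases hx with rfl | rfl <;> exact mem_leaves.2 (by assumption)
  rw [Finset.card_pair hvw] at h2
  omega

/-- A lower bound for the contribution of the ends of a longest path to the distance sum. -/
theorem endBound_le_sum (hT : T.IsTree) {c N : ℕ} (hL : (leaves T).card ≤ c + 2)
    (hn : Fintype.card V = N + 1) {v w : V} (hvw : v ≠ w) (hmax : ∀ x y, T.dist x y ≤ T.dist v w) :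
    endBound c N (T.dist v w) ≤
      ∑ y, (quad (T.dist v y) + quad (T.dist w y)) - quad (T.dist v w) ∧
      T.dist v w ≤ N ∧ N ≤ T.dist v w + c * (T.dist v w / 2) := by
  have hv : T.degree v = 1 := degree_eq_one_of_farthest hT hvw fun y =>
    (hmax w y).trans_eq T.dist_comm
  have hw : T.degree w = 1 := degree_eq_one_of_farthest hT hvw.symm fun y => hmax v y
  set O : Finset V := Finset.univ.filter fun y => T.dist v y + T.dist w y ≠ T.dist v w with hOdef
  have hO : ∀ y, y ∈ O ↔ T.dist v y + T.dist w y ≠ T.dist v w := fun y => by simp [hOdef]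
  obtain ⟨hsum, hcard⟩ := sum_geodesic hT v w quad quad_zero hO
  have hex := exists_height hT v w
  choose h hh using hex
  have h1 : ∀ y ∈ O, 1 ≤ h y := by
    intro y hy
    have e1 := (hO y).1 hy
    have e2 := hh y
    omega
  have hlev : ∀ m, (O.filter fun y => h y = m).card ≤ c := by
    intro m
    rcases Nat.eq_zero_or_pos m with rfl | hm
    · rw [Finset.card_eq_zero.2 (Finset.filter_eq_empty_iff.2 fun y hy => by
        have := h1 y hy
        omega)]
      exact Nat.zero_le c
    · have e1 := card_height_le hT hvw hv hw hm
      have e2 : (O.filter fun y => h y = m).card ≤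
          (Finset.univ.filter fun y => T.dist v y + T.dist w y = T.dist v w + 2 * m).card := by
        refine Finset.card_le_card fun y hy => ?_
        rw [Finset.mem_filter] at hy ⊢
        exact ⟨Finset.mem_univ y, by rw [hh y, hy.2]⟩
      omega
  refine ⟨?_, by omega, ?_⟩
  · have e1 := sum_packing_le (φ := mid (T.dist v w)) (fun _ _ e => mid_mono le_rfl e) _ O rfl h1
      hlev
    have e2 : ∑ y ∈ O, mid (T.dist v w) (h y) ≤
        ∑ y ∈ O, (quad (T.dist v y) + quad (T.dist w y)) :=
      Finset.sum_le_sum fun y _ => mid_le (hh y)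
    rw [hsum, endBound, show N - T.dist v w = O.card by omega]
    linarith
  -- Since neither distance from the two ends exceeds `D`, heights are at most `D / 2`.
  · have e1 : O.card ≤ c * (Finset.Icc 1 (T.dist v w / 2)).card := by
      refine Finset.card_le_mul_card_image_of_maps_to (f := h) (fun y hy => ?_) c fun m _ => hlev m
      have e2 := hmax v y
      have e3 := hmax w y
      have e4 := hh y
      exact Finset.mem_Icc.2 ⟨h1 y hy, by omega⟩
    rw [Nat.card_Icc, Nat.add_sub_cancel] at e1
    omega

end Ends

end TreeIndices

namespace TreeIndices
open SimpleGraph Classical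

/-! ### Minimality of the balanced starlike tree for squared distances -/

section BalancedSum

theorem div_mod_of_eq {q N s r : ℕ} (hr : r < q) (hN : N = q * s + r) :
    N / q = s ∧ N % q = r :=
  (Nat.div_mod_unique (by omega)).2 ⟨by omega, hr⟩

theorem balanced_succ {q : ℕ} (N : ℕ) {r : ℕ} (hr : N % q = r) (hrq : r < q) :
    balanced q (N + 1) =
      Function.update (balanced q N) ⟨r, hrq⟩ (balanced q N ⟨r, hrq⟩ + 1) := by
  obtain ⟨s, hs⟩ : ∃ s, s = N / q := ⟨_, rfl⟩
  have hN : N = q * s + r := by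
    rw [hs, ← hr, Nat.div_add_mod]
  funext i
  rcases Nat.lt_or_ge (r + 1) q with h | h
  · obtain ⟨h1, h2⟩ := div_mod_of_eq h (show N + 1 = q * s + (r + 1) by omega)
    by_cases hi : i = ⟨r, hrq⟩
    · subst hi
      simp only [balanced, Function.update_self, h1, h2, ← hs, hr]
      rw [if_pos (by omega), if_neg (by omega)]
    · have : i.val ≠ r := fun h => hi (Fin.ext h)
      rw [Function.update_of_ne hi]
      simp only [balanced, h1, h2, ← hs, hr]
      congr 1
      split_ifs <;> omega
  · have hq : q = r + 1 := by omega
    obtain ⟨h1, h2⟩ := div_mod_of_eq (show 0 < q by omega)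
      (show N + 1 = q * (s + 1) + 0 by rw [mul_add, mul_one]; omega)
    by_cases hi : i = ⟨r, hrq⟩
    · subst hi
      simp only [balanced, Function.update_self, h1, h2, ← hs, hr]
      rw [if_neg (by omega), if_neg (by omega)]
    · have : i.val ≠ r := fun h => hi (Fin.ext h)
      rw [Function.update_of_ne hi]
      simp only [balanced, h1, h2, ← hs, hr]
      rw [if_neg (by omega), if_pos (by omega)]

/-- The new vertex prolongs a leg of length `s`. The other legs contribute their first `s` vertices
each, and the `r` longer ones one more vertex at distance `2s + 2`. -/
theorem distSum_balanced_succ {q N s r : ℕ} (hr : r < q) (hN : N = q * s + r) {g : ℕ → ℝ}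
    (h0 : g 0 = 0) : distSum g (starlike (balanced q (N + 1))) =
      distSum g (starlike (balanced q N)) + 2 * (hsum g (s + 1) +
        (q - 1) * ∑ y ∈ Finset.range s, g (s + y + 2) + r * g (2 * s + 2)) := by
  obtain ⟨h1, h2⟩ := div_mod_of_eq hr hN
  rw [balanced_succ N h2 hr, distSum_starlike_update _ _ h0]
  have hk : balanced q N ⟨r, hr⟩ = s := by
    simp only [balanced, h1, h2]
    rw [if_neg (by omega), add_zero]
  have h3 : ∀ j : Fin q, ∑ y ∈ Finset.range (balanced q N j), g (s + y + 2) =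
      ∑ y ∈ Finset.range s, g (s + y + 2) + (if j.val < r then 1 else 0) * g (2 * s + 2) := by
    intro j
    simp only [balanced, h1, h2]
    split_ifs
    · rw [Finset.sum_range_succ, one_mul, two_mul]
    · rw [add_zero, zero_mul, add_zero]
  have h4 : ∑ j : Fin q, (if j.val < r then (1 : ℝ) else 0) = r := by
    have := sum_ite_val_lt hr.le
    exact_mod_cast congrArg (Nat.cast : ℕ → ℝ) this
  have h5 := Finset.add_sum_erase Finset.univ
    (fun j => ∑ y ∈ Finset.range (balanced q N j), g (s + y + 2)) (Finset.mem_univ ⟨r, hr⟩)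
  simp only [h3, Finset.sum_add_distrib, ← Finset.sum_mul, h4, Finset.sum_const, Finset.card_univ,
    Fintype.card_fin, nsmul_eq_mul] at h5
  rw [if_neg (lt_irrefl r)] at h5
  rw [hk]
  simp only [h3, Finset.sum_add_distrib, ← Finset.sum_mul, Finset.sum_const, nsmul_eq_mul] at h5 ⊢
  linarith

/-- Two successive prolongations of legs add exactly the packing bound, with `D` the diameter of the
new tree. This `D` is also the least length of a longest path over which the remaining vertices fit
at all. -/
theorem distSum_balanced_add_two {c N : ℕ} (hc : 0 < c) :
    ∃ D, distSum quad (starlike (balanced (c + 2) (N + 2))) =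
      distSum quad (starlike (balanced (c + 2) N)) + 2 * endBound c (N + 2) D ∧
      N + 2 - D ≤ c * (D / 2) ∧ ∀ D', N + 2 ≤ D' + c * (D' / 2) → D ≤ D' := by
  have hdm := Nat.div_add_mod N (c + 2)
  have hmod := Nat.mod_lt N (show 0 < c + 2 by omega)
  generalize N / (c + 2) = s at hdm
  generalize N % (c + 2) = r at hdm hmod
  rcases Nat.lt_or_ge (r + 1) (c + 2) with h | h
  · have h1 := distSum_balanced_succ hmod hdm.symm quad_zero
    have h2 := distSum_balanced_succ (N := N + 1) (s := s) h (by omega) quad_zero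
    have hexp : (c + 2) * s = c * s + 2 * s := add_mul _ _ _
    -- Two legs of length `s` are prolonged.
    refine ⟨2 * s + 2, ?_, ?_, fun D' hD' => ?_⟩
    · have h3 := hsum_add quad (s + 1) (s + 1)
      have h4 : ∀ y, mid (2 * s + 2) (y + 1) = 2 * quad (s + y + 2) := by
        intro y
        rw [mid, show (2 * s + 2) / 2 + (y + 1) = s + y + 2 by omega,
          show (2 * s + 2 + 1) / 2 + (y + 1) = s + y + 2 by omega, two_mul]
      rw [Finset.sum_range_succ, show s + 1 + (s + 1) = 2 * s + 2 by ring,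
        show s + 1 + s + 1 = 2 * s + 2 by ring,
        Finset.sum_congr rfl fun t _ => by rw [show s + 1 + t + 1 = s + t + 2 by ring]] at h3
      rw [h2, h1, endBound, show N + 2 - (2 * s + 2) = c * s + r by omega,
        sum_packing_eq _ hc s (by omega), h3, h4, show s + s + 2 = 2 * s + 2 by ring]
      simp only [h4, ← Finset.mul_sum]
      push_cast
      ring
    · rw [show (2 * s + 2) / 2 = s + 1 by omega, mul_add, mul_one]
      omega
    · by_contra hlt
      have : c * (D' / 2) ≤ c * s := Nat.mul_le_mul_left c (by omega)
      omega
  · have hr : r = c + 1 := by omega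
    subst hr
    have h1 := distSum_balanced_succ hmod hdm.symm quad_zero
    have h2 := distSum_balanced_succ (q := c + 2) (N := N + 1) (s := s + 1) (r := 0) (by omega)
      (by rw [mul_add, mul_one]; omega) quad_zero
    have hexp : (c + 2) * s = c * s + 2 * s := add_mul _ _ _
    -- The last leg of length `s` is prolonged, and then one of length `s + 1`.
    refine ⟨2 * s + 3, ?_, ?_, fun D' hD' => ?_⟩
    · have h3 := hsum_add quad (s + 1) (s + 1)
      have h3' := hsum_add quad (s + 2) (s + 1)
      have h4 : ∀ y, mid (2 * s + 3) (y + 1) = quad (s + y + 2) + quad (s + 1 + y + 2) := by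
        intro y
        rw [mid, show (2 * s + 3) / 2 + (y + 1) = s + y + 2 by omega,
          show (2 * s + 3 + 1) / 2 + (y + 1) = s + 1 + y + 2 by omega]
      have h5 := hsum_succ quad (2 * s + 2)
      rw [show s + 1 + (s + 1) = 2 * s + 2 by ring,
        Finset.sum_congr rfl fun t _ => by rw [show s + 1 + t + 1 = s + t + 2 by ring]] at h3
      rw [show s + 2 + (s + 1) = 2 * s + 2 + 1 by ring,
        Finset.sum_congr rfl fun t _ => by rw [show s + 2 + t + 1 = s + 1 + t + 2 by ring]] at h3'
      have h6 : ∑ y ∈ Finset.range (s + 1), quad (s + y + 2) =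
          ∑ y ∈ Finset.range s, quad (s + y + 2) + quad (2 * s + 2) := by
        rw [Finset.sum_range_succ, show s + s + 2 = 2 * s + 2 by ring]
      have h7 := sum_packing_eq (mid (2 * s + 3)) hc (s + 1) (e := 0) (by omega)
      simp only [h4, Finset.sum_add_distrib] at h7
      rw [h2, h1, endBound, show N + 2 - (2 * s + 3) = c * (s + 1) + 0 by
        rw [mul_add, mul_one]; omega, h7, h6]
      rw [h6] at h3
      rw [show s + 1 + 1 = s + 2 by ring, show 2 * s + 3 = 2 * s + 2 + 1 by ring]
      push_cast
      linarith
    · rw [show (2 * s + 3) / 2 = s + 1 by omega, mul_add, mul_one]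
      omega
    · by_contra hlt
      have : c * (D' / 2) ≤ c * (s + 1) := Nat.mul_le_mul_left c (by omega)
      rw [mul_add, mul_one] at this
      omega

theorem quad_nonneg (d : ℕ) : 0 ≤ quad d := by
  rw [← quad_zero]
  exact quad_monotone (Nat.zero_le d)

/-- Among the trees with a given number of leaves, the balanced starlike tree has the smallest sum
of the squared distances, up to the sum of the distances. -/
theorem distSum_quad_balanced_le {c : ℕ} (hc : 0 < c) (N : ℕ) :
    ∀ (V : Type) [Fintype V] (T : SimpleGraph V), T.IsTree → (leaves T).card ≤ c + 2 →
      Fintype.card V = N + 1 → distSum quad (starlike (balanced (c + 2) N)) ≤ distSum quad T := by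
  induction N using Nat.strong_induction_on with
  | _ N ih =>
    intro V _ T hT hL hn
    have hpos : 0 ≤ distSum quad T :=
      Finset.sum_nonneg fun _ _ => Finset.sum_nonneg fun _ _ => quad_nonneg _
    have hzero : distSum quad (starlike (balanced (c + 2) 0)) = 0 := by
      rw [distSum_starlike _ quad_zero]
      simp [balanced, hsum, pathSum, legSum]
    rcases N with _ | _ | N
    · rw [hzero]
      exact hpos
    · rw [distSum_balanced_succ (s := 0) (r := 0) (by omega) (by omega) quad_zero, hzero]
      simpa [hsum, quad] using hpos
    · obtain ⟨D, hD, hND, hDmin⟩ := distSum_balanced_add_two (N := N) hc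
      obtain ⟨v, w, hmax⟩ := exists_diameter_ends hT
      have hvw : v ≠ w := by
        rintro rfl
        have hsub : ∀ x : V, x = v := fun x => by
          have := hmax x v
          rw [T.dist_self] at this
          exact (hT.connected.dist_eq_zero_iff).1 (by omega)
        have := Fintype.card_le_one_iff.2 fun a b => (hsub a).trans (hsub b).symm
        omega
      obtain ⟨h1, h2, h3⟩ := endBound_le_sum hT hL hn hvw hmax
      -- The longest path of `T` is at least as long as that of the balanced tree, and the bound
      -- grows with this length.
      have h4 := endBound_le (hDmin _ h3) h2 hND
      have hv : T.degree v = 1 := degree_eq_one_of_farthest hT hvw fun y =>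
        (hmax w y).trans_eq T.dist_comm
      have hw : T.degree w = 1 := degree_eq_one_of_farthest hT hvw.symm fun y => hmax v y
      have hL' : ∀ x ∈ ({v, w} : Finset V), T.degree x = 1 := by
        intro x hx
        rw [Finset.mem_insert, Finset.mem_singleton] at hx
        rcases hx with rfl | rfl <;> assumption
      have hpair := Finset.card_pair hvw
      have hne : ∃ x, x ∉ ({v, w} : Finset V) := by
        by_contra! h
        have := Finset.card_le_card (show Finset.univ ⊆ ({v, w} : Finset V) from fun x _ => h x)
        rw [Finset.card_univ] at this
        omega
      have h5 := ih N (by omega) _ (prune T {v, w}) (isTree_prune hT hL' hne)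
        ((card_leaves_prune_le hL').trans hL) (by rw [card_prune]; omega)
      rw [hD, distSum_two_leaves hT hvw hv hw quad_zero]
      linarith

end BalancedSum

/-! ### Majorization of the balanced starlike tree -/

section Majorization

variable {V W : Type} [Fintype V] [Fintype W] {T : SimpleGraph V} {H : SimpleGraph W}

/-- The sum of the distances is determined by the edge counts, in a monotone way. -/
theorem distSum_zero_le_of_edgeCount (hT : T.IsTree) (hH : H.IsTree)
    (hn : Fintype.card V = Fintype.card W) (h : ∀ t, 2 ≤ t → edgeCount H t ≤ edgeCount T t) :
    distSum (wt 0) H ≤ distSum (wt 0) T ∧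
      (distSum (wt 0) H = distSum (wt 0) T → ∀ t, 1 ≤ t → edgeCount T t = edgeCount H t) := by
  have h1 := edgeSum_mu_sub hH hT hn.symm
    (fun m => (m : ℝ) * ((Fintype.card V : ℝ) - m))
  have h2 := distSum_wt_zero hT
  have h3 := distSum_wt_zero hH
  rw [← hn] at h3
  have hterm : ∀ t ∈ Finset.Ico 1 (Fintype.card V / 2),
      0 < ((t + 1 : ℕ) : ℝ) * ((Fintype.card V : ℝ) - (t + 1 : ℕ)) -
        (t : ℝ) * ((Fintype.card V : ℝ) - t) ∧
      (0 : ℝ) ≤ (edgeCount T (t + 1) : ℝ) - edgeCount H (t + 1) := by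
    intro t ht
    rw [Finset.mem_Ico] at ht
    refine ⟨sub_pos.2 (mul_lt_mul_of_lt_half (by omega) (by omega)), sub_nonneg.2 ?_⟩
    exact_mod_cast h (t + 1) (by omega)
  have hnn := Finset.sum_nonneg fun t ht => mul_nonneg (hterm t ht).1.le (hterm t ht).2
  refine ⟨by linarith, fun heq t ht => ?_⟩
  have h4 := (Finset.sum_eq_zero_iff_of_nonneg fun t ht =>
    mul_nonneg (hterm t ht).1.le (hterm t ht).2).1 (by linarith)
  have hbig : ∀ {U : Type} [Fintype U] {G : SimpleGraph U}, G.IsTree →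
      Fintype.card U / 2 < t → edgeCount G t = 0 := by
    intro U _ G hG hlt
    obtain ⟨r⟩ := hG.connected.nonempty
    rw [edgeCount_eq hG r, Finset.card_eq_zero, Finset.filter_eq_empty_iff]
    intro x _
    omega
  rcases Nat.lt_or_ge (Fintype.card V / 2) t with hlt | hge
  · rw [hbig hT hlt, hbig hH (hn ▸ hlt)]
  · rcases Nat.eq_or_lt_of_le ht with rfl | ht'
    · have e1 := card_edgeFinset_tree hT
      have e2 := card_edgeFinset_tree hH
      rw [edgeCount_one hT, edgeCount_one hH]
      omega
    · have h5 := h4 (t - 1) (Finset.mem_Ico.2 ⟨by omega, by omega⟩)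
      have h6 := hterm (t - 1) (Finset.mem_Ico.2 ⟨by omega, by omega⟩)
      rw [Nat.sub_add_cancel ht] at h5 h6
      have h7 := (mul_eq_zero.1 h5).resolve_left h6.1.ne'
      exact_mod_cast sub_eq_zero.1 h7

/-- Among the trees with at most `q` leaves, the balanced starlike tree has the smallest distance
sums and edge counts. -/
theorem majorized_balanced (hT : T.IsTree) {q N : ℕ} (hq : 3 ≤ q) (hqN : q ≤ N)
    (hL : (leaves T).card ≤ q) (hn : Fintype.card V = N + 1) :
    Majorized (starlike (balanced q N)) T := by
  have hcard : Fintype.card V = Fintype.card (Option (Σ i : Fin q, Fin (balanced q N i))) := by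
    rw [card_starlike, sum_balanced (by omega), hn]
  have hK : ∀ t, 1 ≤ t → edgeCount (starlike (balanced q N)) t ≤ edgeCount T t := by
    intro t ht
    have h1 := le_edgeCount_of_leaves hT hL ht
    rw [hn, Nat.add_sub_cancel] at h1
    exact (edgeCount_balanced_le (by omega) N ht).trans h1
  have hW := distSum_zero_le_of_edgeCount hT (isTree_starlike _) hcard
    fun t ht => hK t (by omega)
  have hQ : distSum quad (starlike (balanced q N)) ≤ distSum quad T := by
    obtain ⟨c, rfl⟩ : ∃ c, q = c + 2 := ⟨q - 2, by omega⟩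
    exact distSum_quad_balanced_le (by omega) N V T hT hL hn
  refine ⟨fun α hα => ?_, fun α hα heq => ?_, fun t ht => hK t (by omega)⟩
  · rw [distSum_wt_eq, distSum_wt_eq T]
    have := mul_le_mul_of_nonneg_left hQ (by linarith : 0 ≤ α / 2)
    linarith [hW.1]
  · rw [distSum_wt_eq, distSum_wt_eq T] at heq
    have := mul_le_mul_of_nonneg_left hQ (by linarith : 0 ≤ α / 2)
    -- Both parts of the weight are minimized, so equality of the total gives equality of the Wiener
    -- indices, and thus of all edge counts.
    have h1 := hW.2 (by linarith [hW.1])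
    obtain ⟨e⟩ := nonempty_iso_balanced hT (by omega) hL hn hqN fun t ht => by
      rw [h1 t ht]
      exact edgeCount_balanced_le (by omega) N ht
    exact ⟨e.symm⟩

end Majorization

end TreeIndices

namespace TreeIndices
open SimpleGraph Classical

/-- The four indices of the theorem whose extremal trees are the same. -/
abbrev increasingIndices : Set TreeIndex := {hyperWiener, wienerHosoya, degreeDistance, gutman}

/-! ### Membership of the extremal trees in their classes -/

section Members

theorem treesOn_doubleStarPath {n k a b : ℕ} (hk : 0 < k) (hn : k + (a + b) = n) :
    treesOn n _ (doubleStarPath k a b) :=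
  ⟨isTree_doubleStarPath hk, (card_doubleStarPath hk).trans hn⟩

theorem sum_centralCaterpillar_eq {n k : ℕ} (hk : 0 < k) :
    ∑ i : Fin k, (if i.val + 1 = (k + 1) / 2 then n - k else 0) = n - k := by
  obtain ⟨s, hs⟩ : ∃ s, (k + 1) / 2 = s + 1 := ⟨(k + 1) / 2 - 1, by omega⟩
  rw [hs]
  exact sum_nat_centralCaterpillar (by omega)

theorem treesOn_centralCaterpillar {n k : ℕ} (hk : 0 < k) (hn : k ≤ n) :
    treesOn n _ (centralCaterpillar n k ((k + 1) / 2)) := by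
  refine ⟨isTree_caterpillar hk _, ?_⟩
  rw [card_caterpillar, sum_centralCaterpillar_eq hk]
  omega

theorem treesOn_of_caterpillarsOn {n k : ℕ} (hk : 0 < k) {V : Type} [Fintype V]
    {T : SimpleGraph V} (h : caterpillarsOn n k V T) : treesOn n V T := by
  obtain ⟨a, ha, ⟨e⟩⟩ := h
  refine ⟨e.isTree_iff.2 (isTree_caterpillar hk a), ?_⟩
  rw [Fintype.card_congr e.toEquiv, card_caterpillar]
  omega

theorem treesWithDiam_centralCaterpillar {n k : ℕ} (hk : 3 ≤ k) (hn : k ≤ n) :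
    treesWithDiam n (k - 1) _ (centralCaterpillar n k ((k + 1) / 2)) := by
  refine ⟨treesOn_centralCaterpillar (by omega) hn, ?_⟩
  have hconn := (isTree_caterpillar (show 0 < k by omega)
    fun i : Fin k => if i.val + 1 = (k + 1) / 2 then n - k else 0).connected
  have : Nonempty (Fin k ⊕ (Σ i : Fin k,
    Fin (if i.val + 1 = (k + 1) / 2 then n - k else 0))) := hconn.nonempty
  refine le_antisymm ?_ ?_
  · obtain ⟨x, y, h⟩ := (centralCaterpillar n k ((k + 1) / 2)).exists_dist_eq_diam
    rw [← h]
    have hpos : ∀ p : (Σ i : Fin k, Fin (if i.val + 1 = (k + 1) / 2 then n - k else 0)),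
        p.1.val + 1 = (k + 1) / 2 := by
      rintro ⟨i, j⟩
      by_contra hne
      have hlt : j.val < (if i.val + 1 = (k + 1) / 2 then n - k else 0) := j.isLt
      exact Nat.not_lt_zero _ (hlt.trans_eq (if_neg hne))
    rcases x with i | p <;> rcases y with j | r
    · rw [caterpillar_dist_inl_inl]
      omega
    · rw [caterpillar_dist_inl_inr]
      have := hpos r
      omega
    · rw [(centralCaterpillar n k ((k + 1) / 2)).dist_comm, caterpillar_dist_inl_inr]
      have := hpos p
      omega
    · by_cases hpr : p = r
      · rw [hpr, SimpleGraph.dist_self]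
        omega
      · rw [caterpillar_dist_inr_inr hpr]
        have := hpos p
        have := hpos r
        omega
  · have h1 := dist_le_diam (connected_iff_ediam_ne_top.1 hconn) (u := .inl ⟨0, by omega⟩)
      (v := .inl ⟨k - 1, by omega⟩)
    rw [caterpillar_dist_inl_inl] at h1
    refine le_trans ?_ h1
    simp only
    omega

theorem treesWithPendent_doubleStarPath {n k a b : ℕ} (hk : 2 ≤ k) (ha : 1 ≤ a) (hb : 1 ≤ b)
    (hn : k + (a + b) = n) : treesWithPendent n (a + b) _ (doubleStarPath k a b) := by
  refine ⟨treesOn_doubleStarPath (by omega) hn, ?_⟩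
  rw [card_filter_caterpillar, Finset.card_eq_zero.2, zero_add]
  · rw [← sum_nat_doubleStarPath (k := k) (a := a) (b := b) (by omega)]
    refine Finset.sum_congr rfl fun i _ => ?_
    rw [Finset.filter_true_of_mem fun j _ => degree_caterpillar_inr _, Finset.card_univ,
      Fintype.card_fin]
  · rw [Finset.filter_eq_empty_iff]
    intro i _ h
    have hpath : ∀ j : Fin k, j.val + 1 = i.val ∨ i.val + 1 = j.val →
        (doubleStarPath k a b).Adj (.inl i) (.inl j) := by
      intro j hj
      change (pathGraph k).Adj i j
      rw [pathGraph_adj]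
      omega
    have hleft : ∃ x, (doubleStarPath k a b).Adj (.inl i) x ∧
        ∀ j : Fin k, i.val < j.val → x ≠ .inl j := by
      rcases Nat.eq_zero_or_pos i.val with h0 | h0
      · exact ⟨.inr ⟨i, ⟨0, by rw [if_pos h0]; omega⟩⟩, rfl, by simp⟩
      · refine ⟨.inl ⟨i.val - 1, by omega⟩, hpath _ (Or.inl (by simp only; omega)), ?_⟩
        intro j hj he
        have := congrArg Fin.val (Sum.inl.inj he)
        simp only at this
        omega
    obtain ⟨x, hx, hx'⟩ := hleft
    by_cases hi : i.val + 1 = k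
    · have h0 : ¬ i.val = 0 := by omega
      have h1 := eq_of_degree_one h (hpath ⟨i.val - 1, by omega⟩ (Or.inl (by simp only; omega)))
        (b := .inr ⟨i, ⟨0, by rw [if_pos hi]; omega⟩⟩) rfl
      simp at h1
    · exact hx' ⟨i.val + 1, by omega⟩ (by simp) (eq_of_degree_one h hx (hpath _ (Or.inr rfl)))

theorem degree_pathGraph_le {k : ℕ} (i : Fin k) : (pathGraph k).degree i ≤
    (if 0 < i.val then 1 else 0) + (if i.val + 1 < k then 1 else 0) := by
  have h1 : (pathGraph k).neighborFinset i ⊆ (Finset.univ.filter fun j => j.val + 1 = i.val) ∪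
      Finset.univ.filter fun j => i.val + 1 = j.val := by
    intro j hj
    rw [mem_neighborFinset, pathGraph_adj] at hj
    rw [Finset.mem_union, Finset.mem_filter, Finset.mem_filter]
    rcases hj with h | h
    · exact Or.inr ⟨Finset.mem_univ j, h⟩
    · exact Or.inl ⟨Finset.mem_univ j, h⟩
  rw [← card_neighborFinset_eq_degree]
  refine (Finset.card_le_card h1).trans ((Finset.card_union_le _ _).trans (add_le_add ?_ ?_))
  · split_ifs with h
    · exact Finset.card_le_one.2 fun x hx y hy => by
        rw [Finset.mem_filter] at hx hy
        exact Fin.ext (by omega)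
    · rw [Nat.le_zero, Finset.card_eq_zero, Finset.filter_eq_empty_iff]
      omega
  · split_ifs with h
    · exact Finset.card_le_one.2 fun x hx y hy => by
        rw [Finset.mem_filter] at hx hy
        exact Fin.ext (by omega)
    · rw [Nat.le_zero, Finset.card_eq_zero, Finset.filter_eq_empty_iff]
      intro j _
      have := j.isLt
      omega

theorem treesWithMaxDegree_doubleStarPath {n k b : ℕ} (hk : 2 ≤ k) (hb : 1 ≤ b)
    (hn : k + (1 + b) = n) : treesWithMaxDegree n (b + 1) _ (doubleStarPath k 1 b) := by
  refine ⟨treesOn_doubleStarPath (by omega) hn, le_antisymm ?_ ?_⟩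
  · refine maxDegree_le_of_forall_degree_le _ _ ?_
    rintro (i | p)
    · rw [degree_caterpillar_inl]
      have := degree_pathGraph_le i
      split_ifs at this ⊢ <;> omega
    · rw [degree_caterpillar_inr]
      omega
  · have h1 := (doubleStarPath k 1 b).degree_le_maxDegree (.inl ⟨k - 1, by omega⟩)
    have h2 : 0 < (pathGraph k).degree ⟨k - 1, by omega⟩ := by
      rw [degree_pos_iff_exists_adj]
      refine ⟨⟨k - 2, by omega⟩, ?_⟩
      rw [pathGraph_adj]
      simp only
      omega
    rw [degree_caterpillar_inl] at h1
    simp only at h1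
    rw [if_neg (by omega), if_pos (by omega)] at h1
    omega

theorem treesWithPendent_balancedStarlike {n q : ℕ} (hq : 2 < q) (hqn : q + 1 < n) :
    treesWithPendent n q _ (balancedStarlike n q) := by
  refine ⟨⟨isTree_starlike _, ?_⟩, ?_⟩
  · rw [card_starlike]
    have := sum_balanced (show 0 < q by omega) (n - 1)
    simp only [balanced] at this
    rw [this]
    omega
  · refine card_leaves_starlike (fun i => ?_) (by omega)
    have : 1 ≤ (n - 1) / q := (Nat.one_le_div_iff (by omega)).2 (by omega)
    omega

theorem nonempty_iso_starGraph {n : ℕ} (hn : 2 ≤ n) :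
    Nonempty (starGraph (⟨0, by omega⟩ : Fin n) ≃g centralCaterpillar n 2 ((2 + 1) / 2)) := by
  let p : Fin 2 → Fin n := fun i => ⟨i.val, by omega⟩
  have hrange : ∀ x : Fin n, x ∉ Set.range p ↔ 2 ≤ x.val := by
    intro x
    constructor
    · intro h
      by_contra hlt
      exact h ⟨⟨x.val, by omega⟩, rfl⟩
    · rintro h ⟨i, rfl⟩
      have : i.val < 2 := i.isLt
      have : 2 ≤ i.val := h
      omega
  refine nonempty_iso_caterpillar (isTree_starGraph _) (p := p) (J := fun _ => 0) ?_ ?_ ?_ ?_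
  · intro i j h
    have hval : (p i).val = (p j).val := congrArg Fin.val h
    exact Fin.ext hval
  · intro i j hij
    refine starGraph_adj.2 ⟨fun h => ?_, Or.inl (Fin.ext ?_)⟩
    · have hval : (p i).val = (p j).val := congrArg Fin.val h
      have : i.val = j.val := hval
      omega
    · change i.val = 0
      omega
  · intro x hx
    rw [hrange] at hx
    refine starGraph_adj.2 ⟨fun h => ?_, Or.inr rfl⟩
    rw [h] at hx
    have : 2 ≤ 0 := hx
    omega
  · intro i
    by_cases hi : i = 0
    · subst hi
      rw [Nat.card_eq_fintype_card, Fintype.card_subtype]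
      have h1 : (Finset.univ.filter fun x => x ∉ Set.range p ∧ (0 : Fin 2) = 0) =
          Finset.univ.filter fun x : Fin n => ¬ x.val < 2 := by
        ext x
        simp only [Finset.mem_filter, Finset.mem_univ, true_and, and_true]
        rw [hrange]
        omega
      have h2 := Finset.card_filter_add_card_filter_not (s := (Finset.univ : Finset (Fin n)))
        fun x => x.val < 2
      rw [Fin.card_filter_val_lt, Finset.card_univ, Fintype.card_fin] at h2
      rw [h1, if_pos (by simp)]
      omega
    · have h1 : i.val ≠ 0 := fun h => hi (Fin.ext h)
      have : IsEmpty {x // x ∉ Set.range p ∧ (0 : Fin 2) = i} := ⟨fun x => hi x.2.2.symm⟩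
      rw [Nat.card_of_isEmpty, if_neg (by omega)]

end Members

/-! ### The extremal statements -/

section Extremal

theorem isUniqueMax_pathGraph {n : ℕ} (hn : 1 ≤ n) :
    (∀ F ∈ increasingIndices, IsUniqueMax F (treesOn n) (pathGraph n)) ∧
      IsUniqueMin abc₂ (treesOn n) (pathGraph n) := by
  obtain ⟨e⟩ := caterpillar_iso_pathGraph n
  exact isUniqueMax_of_majorized (fun _ _ _ h => h)
    ⟨e.isTree_iff.1 (isTree_doubleStarPath hn), Fintype.card_fin n⟩
    fun V _ T h => (majorized_path h.1 h.2).of_iso Iso.refl e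

theorem isUniqueMin_starGraph {n : ℕ} (hn : 1 ≤ n) :
    (∀ F ∈ increasingIndices, IsUniqueMin F (treesOn n) (starGraph (⟨0, hn⟩ : Fin n))) ∧
      IsUniqueMax abc₂ (treesOn n) (starGraph (⟨0, hn⟩ : Fin n)) := by
  refine isUniqueMin_of_majorized (fun _ _ _ h => h) ⟨isTree_starGraph _, Fintype.card_fin n⟩
    fun V _ T h => ?_
  -- The star with at least two vertices is a central caterpillar over one edge, and every tree with
  -- at least two vertices contains such a path. A single vertex has no edge and is compared as a
  -- path.
  rcases Nat.eq_or_lt_of_le hn with rfl | h2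
  · obtain ⟨e⟩ := caterpillar_iso_pathGraph 1
    have hpath : ∀ {W : Type} [Fintype W] {G : SimpleGraph W}, treesOn 1 W G →
        Nonempty (G ≃g T) := by
      intro W _ G hG
      have h1 : Subsingleton W := Fintype.card_le_one_iff_subsingleton.1 hG.2.le
      exact nonempty_iso_of_bijective hG.1 h.1
        (Fintype.equivOfCardEq (hG.2.trans h.2.symm)) (Equiv.bijective _)
        fun x y hxy => absurd (Subsingleton.elim x y) hxy.ne
    obtain ⟨e1⟩ := hpath (W := Fin 1) (G := starGraph ⟨0, hn⟩)
      ⟨isTree_starGraph _, Fintype.card_fin 1⟩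
    obtain ⟨e2⟩ := hpath (treesOn_doubleStarPath (k := 1) (a := 0) (b := 0) one_pos rfl)
    exact (majorized_path h.1 h.2).of_iso e1.symm e2
  · obtain ⟨e⟩ := nonempty_iso_starGraph h2
    have : Nontrivial V := Fintype.one_lt_card_iff_nontrivial.1 (by rw [h.2]; exact h2)
    obtain ⟨v, w, hvw⟩ := exists_pair_ne V
    obtain ⟨u, hu, -⟩ := exists_adj_dist_eq h.1.connected hvw
    obtain ⟨p, -, -, hp⟩ := exists_geodesic h.1.connected (dist_eq_one_iff_adj.2 hu)
    exact (majorized_centralCaterpillar h.1 h.2 le_rfl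
      fun i j hi hj => hp i j (by omega) (by omega)).of_iso e.symm Iso.refl

/-- The deleted set consists of the attached vertices only. The path ends may be leaves too, which
is why `majorized_doubleStarPath` allows any set of leaves. -/
theorem isUniqueMax_caterpillarsOn {n k : ℕ} (hk : 2 ≤ k) (hkn : k < n) :
    (∀ F ∈ increasingIndices, IsUniqueMax F (caterpillarsOn n k)
      (doubleStarPath k ((n - k) / 2) ((n - k + 1) / 2))) ∧
      IsUniqueMin abc₂ (caterpillarsOn n k)
        (doubleStarPath k ((n - k) / 2) ((n - k + 1) / 2)) := by
  refine isUniqueMax_of_majorized (n := n) (fun _ _ _ h => treesOn_of_caterpillarsOn (by omega) h)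
    ⟨_, by rw [sum_nat_doubleStarPath (by omega)]; omega, ⟨Iso.refl⟩⟩ fun V _ T h => ?_
  obtain ⟨a, ha, ⟨e⟩⟩ := h
  refine (majorized_doubleStarPath (isTree_caterpillar (by omega) a)
    (L := Finset.univ.map ⟨Sum.inr, Sum.inr_injective⟩) ?_ ?_ hk ?_).of_iso e.symm Iso.refl
  · intro x hx
    obtain ⟨y, -, rfl⟩ := Finset.mem_map.1 hx
    exact degree_caterpillar_inr y
  · rw [Finset.card_map, Finset.card_univ, Fintype.card_sigma]
    simp only [Fintype.card_fin]
    omega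
  · rw [card_caterpillar]
    omega

theorem isUniqueMin_caterpillarsOn {n k : ℕ} (hk : 2 ≤ k) (hkn : k < n) :
    (∀ F ∈ increasingIndices, IsUniqueMin F (caterpillarsOn n k)
      (centralCaterpillar n k ((k + 1) / 2))) ∧
      IsUniqueMax abc₂ (caterpillarsOn n k) (centralCaterpillar n k ((k + 1) / 2)) := by
  refine isUniqueMin_of_majorized (n := n) (fun _ _ _ h => treesOn_of_caterpillarsOn (by omega) h)
    ⟨_, by rw [sum_centralCaterpillar_eq (by omega)]; omega, ⟨Iso.refl⟩⟩ fun V _ T h => ?_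
  obtain ⟨a, ha, ⟨e⟩⟩ := h
  refine (majorized_centralCaterpillar (isTree_caterpillar (by omega) a)
    -- The value for `i ≥ k` is a dummy that only extends the path to a function on `ℕ`.
    (p := fun i => .inl (if h : i < k then ⟨i, h⟩ else ⟨0, by omega⟩)) ?_ hk ?_).of_iso Iso.refl
      e.symm
  · rw [card_caterpillar]
    omega
  · intro i j hi hj
    rw [dif_pos hi, dif_pos hj, caterpillar_dist_inl_inl]

theorem isUniqueMin_treesWithDiam {n k : ℕ} (hk : 3 ≤ k) (hkn : k ≤ n) :
    (∀ F ∈ increasingIndices, IsUniqueMin F (treesWithDiam n (k - 1))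
      (centralCaterpillar n k ((k + 1) / 2))) ∧
      IsUniqueMax abc₂ (treesWithDiam n (k - 1)) (centralCaterpillar n k ((k + 1) / 2)) := by
  refine isUniqueMin_of_majorized (n := n) (fun _ _ _ h => h.1)
    (treesWithDiam_centralCaterpillar hk hkn) fun V _ T h => ?_
  obtain ⟨hT, hd⟩ := h
  have := hT.1.connected.nonempty
  obtain ⟨u, v, huv⟩ := T.exists_dist_eq_diam
  obtain ⟨p, -, -, hp⟩ := exists_geodesic hT.1.connected (huv.trans hd)
  exact majorized_centralCaterpillar hT.1 hT.2 (by omega)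
    fun i j hi hj => hp i j (by omega) (by omega)

theorem isUniqueMax_treesWithPendent {n q : ℕ} (hq : 2 < q) (hqn : q + 1 < n) :
    (∀ F ∈ increasingIndices, IsUniqueMax F (treesWithPendent n q)
      (doubleStarPath (n - q) (q / 2) ((q + 1) / 2))) ∧
      IsUniqueMin abc₂ (treesWithPendent n q)
        (doubleStarPath (n - q) (q / 2) ((q + 1) / 2)) := by
  have hH := treesWithPendent_doubleStarPath (n := n) (k := n - q) (a := q / 2)
    (b := (q + 1) / 2) (by omega) (by omega) (by omega) (by omega)
  rw [show q / 2 + (q + 1) / 2 = q by omega] at hH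
  refine isUniqueMax_of_majorized (n := n) (fun _ _ _ h => h.1) hH fun V _ T h => ?_
  obtain ⟨hT, hL⟩ := h
  exact majorized_doubleStarPath hT.1 (fun x hx => mem_leaves.1 hx) hL (by omega)
    (by rw [hT.2]; omega)

theorem isUniqueMin_treesWithPendent {n q : ℕ} (hq : 2 < q) (hqn : q + 1 < n) :
    (∀ F ∈ increasingIndices, IsUniqueMin F (treesWithPendent n q) (balancedStarlike n q)) ∧
      IsUniqueMax abc₂ (treesWithPendent n q) (balancedStarlike n q) := by
  refine isUniqueMin_of_majorized (n := n) (fun _ _ _ h => h.1)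
    (treesWithPendent_balancedStarlike hq hqn) fun V _ T h => ?_
  obtain ⟨hT, hL⟩ := h
  exact majorized_balanced hT.1 hq (by omega) (le_of_eq hL) (by rw [hT.2]; omega)

theorem isUniqueMax_treesWithMaxDegree {n D : ℕ} (hD : 2 < D) (hDn : D + 1 < n) :
    (∀ F ∈ increasingIndices, IsUniqueMax F (treesWithMaxDegree n D)
      (doubleStarPath (n - D) 1 (D - 1))) ∧
      IsUniqueMin abc₂ (treesWithMaxDegree n D) (doubleStarPath (n - D) 1 (D - 1)) := by
  have hH := treesWithMaxDegree_doubleStarPath (n := n) (k := n - D) (b := D - 1) (by omega)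
    (by omega) (by omega)
  rw [show D - 1 + 1 = D by omega] at hH
  refine isUniqueMax_of_majorized (n := n) (fun _ _ _ h => h.1) hH fun V _ T h => ?_
  obtain ⟨hT, hd⟩ := h
  have := hT.1.connected.nonempty
  obtain ⟨c, hc⟩ := T.exists_maximal_degree_vertex
  exact majorized_of_degree hT.1 (by omega) (hc.symm.trans hd) (by omega) (by rw [hT.2]; omega)

end Extremal

end TreeIndices

theorem mainTheorem7 :
    (∀ n : ℕ,
      TreeIndices.IsWienerType n TreeIndices.wienerHosoya ∧
      TreeIndices.IsWienerType n TreeIndices.degreeDistance ∧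
      TreeIndices.IsWienerType n TreeIndices.gutman ∧
      TreeIndices.IsAntiWienerType n TreeIndices.abc₂) ∧
    (∀ F ∈ ({TreeIndices.hyperWiener, TreeIndices.wienerHosoya, TreeIndices.degreeDistance,
        TreeIndices.gutman} : Set TreeIndices.TreeIndex),
      (∀ (n : ℕ) (hn : 1 ≤ n),
        TreeIndices.IsUniqueMax F (TreeIndices.treesOn n) (SimpleGraph.pathGraph n) ∧
        TreeIndices.IsUniqueMin F (TreeIndices.treesOn n)
          (SimpleGraph.starGraph (⟨0, hn⟩ : Fin n))) ∧
      (∀ n k : ℕ, 2 ≤ k → k < n →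
        TreeIndices.IsUniqueMax F (TreeIndices.caterpillarsOn n k)
          (TreeIndices.doubleStarPath k ((n - k) / 2) ((n - k + 1) / 2)) ∧
        TreeIndices.IsUniqueMin F (TreeIndices.caterpillarsOn n k)
          (TreeIndices.centralCaterpillar n k ((k + 1) / 2))) ∧
      (∀ n k : ℕ, 3 ≤ k → k ≤ n →
        TreeIndices.IsUniqueMin F (TreeIndices.treesWithDiam n (k - 1))
          (TreeIndices.centralCaterpillar n k ((k + 1) / 2))) ∧
      (∀ n q : ℕ, 2 < q → q + 1 < n →
        TreeIndices.IsUniqueMax F (TreeIndices.treesWithPendent n q)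
          (TreeIndices.doubleStarPath (n - q) (q / 2) ((q + 1) / 2)) ∧
        TreeIndices.IsUniqueMin F (TreeIndices.treesWithPendent n q)
          (TreeIndices.balancedStarlike n q)) ∧
      (∀ n D : ℕ, 2 < D → D + 1 < n →
        TreeIndices.IsUniqueMax F (TreeIndices.treesWithMaxDegree n D)
          (TreeIndices.doubleStarPath (n - D) 1 (D - 1)))) ∧
    ((∀ (n : ℕ) (hn : 1 ≤ n),
        TreeIndices.IsUniqueMax TreeIndices.abc₂ (TreeIndices.treesOn n)
          (SimpleGraph.starGraph (⟨0, hn⟩ : Fin n)) ∧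
        TreeIndices.IsUniqueMin TreeIndices.abc₂ (TreeIndices.treesOn n)
          (SimpleGraph.pathGraph n)) ∧
      (∀ n k : ℕ, 2 ≤ k → k < n →
        TreeIndices.IsUniqueMax TreeIndices.abc₂ (TreeIndices.caterpillarsOn n k)
          (TreeIndices.centralCaterpillar n k ((k + 1) / 2)) ∧
        TreeIndices.IsUniqueMin TreeIndices.abc₂ (TreeIndices.caterpillarsOn n k)
          (TreeIndices.doubleStarPath k ((n - k) / 2) ((n - k + 1) / 2))) ∧
      (∀ n k : ℕ, 3 ≤ k → k ≤ n →
        TreeIndices.IsUniqueMax TreeIndices.abc₂ (TreeIndices.treesWithDiam n (k - 1))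
          (TreeIndices.centralCaterpillar n k ((k + 1) / 2))) ∧
      (∀ n q : ℕ, 2 < q → q + 1 < n →
        TreeIndices.IsUniqueMax TreeIndices.abc₂ (TreeIndices.treesWithPendent n q)
          (TreeIndices.balancedStarlike n q) ∧
        TreeIndices.IsUniqueMin TreeIndices.abc₂ (TreeIndices.treesWithPendent n q)
          (TreeIndices.doubleStarPath (n - q) (q / 2) ((q + 1) / 2))) ∧
      (∀ n D : ℕ, 2 < D → D + 1 < n →
        TreeIndices.IsUniqueMin TreeIndices.abc₂ (TreeIndices.treesWithMaxDegree n D)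
          (TreeIndices.doubleStarPath (n - D) 1 (D - 1)))) := by
  refine ⟨fun n => ⟨TreeIndices.isWienerType_wienerHosoya n,
    TreeIndices.isWienerType_degreeDistance n, TreeIndices.isWienerType_gutman n,
    TreeIndices.isAntiWienerType_abc₂ n⟩, fun F hF => ⟨fun n hn => ?_, fun n k hk hkn => ?_,
    fun n k hk hkn => ?_, fun n q hq hqn => ?_, fun n D hD hDn => ?_⟩, fun n hn => ?_,
    fun n k hk hkn => ?_, fun n k hk hkn => ?_, fun n q hq hqn => ?_, fun n D hD hDn => ?_⟩
  · exact ⟨(TreeIndices.isUniqueMax_pathGraph hn).1 F hF,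
      (TreeIndices.isUniqueMin_starGraph hn).1 F hF⟩
  · exact ⟨(TreeIndices.isUniqueMax_caterpillarsOn hk hkn).1 F hF,
      (TreeIndices.isUniqueMin_caterpillarsOn hk hkn).1 F hF⟩
  · exact (TreeIndices.isUniqueMin_treesWithDiam hk hkn).1 F hF
  · exact ⟨(TreeIndices.isUniqueMax_treesWithPendent hq hqn).1 F hF,
      (TreeIndices.isUniqueMin_treesWithPendent hq hqn).1 F hF⟩
  · exact (TreeIndices.isUniqueMax_treesWithMaxDegree hD hDn).1 F hF
  · exact ⟨(TreeIndices.isUniqueMin_starGraph hn).2, (TreeIndices.isUniqueMax_pathGraph hn).2⟩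
  · exact ⟨(TreeIndices.isUniqueMin_caterpillarsOn hk hkn).2,
      (TreeIndices.isUniqueMax_caterpillarsOn hk hkn).2⟩
  · exact (TreeIndices.isUniqueMin_treesWithDiam hk hkn).2
  · exact ⟨(TreeIndices.isUniqueMin_treesWithPendent hq hqn).2,
      (TreeIndices.isUniqueMax_treesWithPendent hq hqn).2⟩
  · exact (TreeIndices.isUniqueMax_treesWithMaxDegree hD hDn).2
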